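/- Let $k$ be a field and let $G$ be a locally profinite group, i.e. a locally compact totally disconnected topological group. **Smooth modules.** A smooth $G$-module over $k$ is a $k$-linear representation of $G$ in which the stabilizer of every vector is open. Smooth $G$-modules form an abelian category $G\text{-}\mathrm{smooth}_k$, a full subcategory of the category of representations. For a profinite group $H$ this is the category of discrete $H$-modules over $k$, and the *$k$-cohomological dimension* of $H$ is the homological dimension of this abelian category (the supremum of all $i$ for which some $\mathrm{Ext}^i$ in it is nonzero). **Contramodules.** For a locally compact totally disconnected space $X$ and a $k$-vector space $V$, let $V[[X]]$ be the vector space of compactly supported finitely additive $V$-valued measures defined on all the open-closed subsets of $X$ (a measure is supported on a compact set $K\subset X$ if it vanishes on every open-closed set disjoint from $K$). A $G$-contramodule over $k$ is a $k$-vector space $P$ with a $k$-linear contraaction map $\pi\colon P[[G]]\to P$ such that * the two maps $P[[G\times G]]\rightrightarrows P[[G]]$, namely the pushforward along the multiplication $G\times G\to G$, and the composition of the natural map $P[[G\times G]]\to P[[G]][[G]]$, $\mu\mapsto\bigl(B\mapsto (A\mapsto\mu(A\times B))\bigr)$, with the map $P[[G]][[G]]\to P[[G]]$ induced by $\pi$,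 have equal compositions with $\pi$; * $\pi$ takes the point measure at the unit of $G$ with value $x$ to $x$, for every $x\in P$. Morphisms are the linear maps commuting with the contraactions; $G$-contramodules form an abelian category $G\text{-}\mathrm{contra}_k$. **The adjoint functors.** Let $S=k(G)$ be the space of compactly supported locally constant functions $G\to k$, with the left action $(gs)(x)=s(g^{-1}x)$ and the commuting right action $(sg)(x)=s(xg^{-1})$, so that $(sg^{-1})(x)=s(xg)$. * $\Psi_G=\mathrm{Hom}_{k[G]}(S,-)\colon G\text{-}\mathrm{smooth}_k\to G\text{-}\mathrm{contra}_k$, where $\mathrm{Hom}_{k[G]}$ is taken with respect to the left action on $S$, and the contraaction on $\mathrm{Hom}_{k[G]}(S,M)$ is $\pi(\mu)(s)=\int_G d\mu_g(sg^{-1})$. * $\Phi_G=S\odot_{k,G}-\colon G\text{-}\mathrm{contra}_k\to G\text{-}\mathrm{smooth}_k$ is the contratensor product: $\Phi_G(P)$ is the cokernel of the difference of the two maps $S\otimes_k P[[G]]\rightrightarrows S\otimes_k P$ given by $s\otimes\mu\mapsto s\otimes\pi(\mu)$ and $s\otimes\mu\mapsto\int_G sg^{-1}\otimes d\mu_g$,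 with the action of $G$ induced by the left action on $S$. Here the integral of a locally constant function with respect to a compactly supported measure is the evident finite sum. The functor $\Phi_G$ is left adjoint to $\Psi_G$. **Derived categories and functors.** For $\star=b,+,-$ or $\varnothing$ and an abelian category $A$, let $K^\star(A)$ be the homotopy category of bounded, bounded below, bounded above, or arbitrary cochain complexes in $A$, respectively, and let $D^\star(A)$ be the corresponding derived category, i.e. the full subcategory of $D(A)$ of the objects with bounded, bounded below, bounded above, or arbitrary cohomology. For an additive functor $F\colon A\to B$, a right (resp. left) derived functor $D^\star(A)\to D^\star(B)$ is a triangulated functor $\mathbb RF$ (resp. $\mathbb LF$) with a natural transformation $Q_B\circ F\to\mathbb RF\circ Q_A$ (resp. $\mathbb LF\circ Q_A\to Q_B\circ F$) of functors $K^\star(A)\to D^\star(B)$ which commutes with the shifts and is universal (initial, resp. terminal) among such transformations to (resp. from) functors of the form $E\circ Q_A$, where $E\colon D^\star(A)\to D^\star(B)$; here $Q$ denotes the localization functors $K^\star\to D^\star$. **Theorem.** Assume that $G$ has a compact open subgroup of finite $k$-cohomological dimension. Then, for every $\star=b,+,-,\varnothing$, there exist a right derived functor of $\Psi_G$ and a left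 derived functor of $\Phi_G$ between the derived categories $D^\star$, and they are mutually inverse triangulated equivalences $$\mathbb R\Psi_G\colon D^\star(G\text{-}\mathrm{smooth}_k)\;\simeq\; D^\star(G\text{-}\mathrm{contra}_k)\;:\!\mathbb L\Phi_G .$$ -/

import Mathlib

open CategoryTheory TopologicalSpace
open scoped TensorProduct

universe w w' u

noncomputable section

namespace Contra

/-! ### Compactly supported finitely additive measures -/

section Measures

variable (k : Type*) [Field k] (X : Type*) [TopologicalSpace X]
  (V : Type*) [AddCommGroup V] [Module k V]

/-- A set function on open-closed sets is supported on `K` if it vanishes on the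
open-closed sets disjoint from `K`. -/
def SupportedOn {X V : Type*} [TopologicalSpace X] [Zero V] (K : Set X) (μ : Clopens X → V) :
    Prop :=
  ∀ A : Clopens X, Disjoint (A : Set X) K → μ A = 0

/-- `V[[X]]`: the space of compactly supported finitely additive `V`-valued measures defined on
all the open-closed subsets of `X`. -/
def Meas : Submodule k (Clopens X → V) where
  carrier := {μ | (∀ A B : Clopens X, Disjoint (A : Set X) B → μ (A ⊔ B) = μ A + μ B) ∧
    ∃ K : Set X, IsCompact K ∧ SupportedOn K μ}
  add_mem' := by
    rintro μ ν ⟨h1, K, hK, h2⟩ ⟨h1', K', hK', h2'⟩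
    refine ⟨fun A B h => ?_, K ∪ K', hK.union hK', fun A h => ?_⟩
    · simp only [Pi.add_apply, h1 A B h, h1' A B h]; abel
    · rw [Set.disjoint_union_right] at h
      simp [h2 A h.1, h2' A h.2]
  zero_mem' := ⟨fun _ _ _ => by simp, ∅, isCompact_empty, fun _ _ => rfl⟩
  smul_mem' := by
    rintro c μ ⟨h1, K, hK, h2⟩
    exact ⟨fun A B h => by simp [h1 A B h], K, hK, fun A h => by simp [h2 A h]⟩

variable {k X V}
variable {Y : Type*} [TopologicalSpace Y] {W : Type*} [AddCommGroup W] [Module k W]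
  {W' : Type*} [AddCommGroup W'] [Module k W']

namespace Meas

@[ext] lemma ext {μ ν : Meas k X V} (h : ∀ A, μ.1 A = ν.1 A) : μ = ν :=
  Subtype.ext (funext h)

lemma apply_bot (μ : Meas k X V) : μ.1 ⊥ = 0 := by
  have := μ.2.1 ⊥ ⊥ (by simp)
  simpa using this

/-- The map `V[[X]] → W[[X]]` induced by a linear map `V → W`. -/
def map (f : V →ₗ[k] W) : Meas k X V →ₗ[k] Meas k X W where
  toFun μ := ⟨fun A => f (μ.1 A), fun A B h => by
      show f _ = f _ + f _
      rw [μ.2.1 A B h, map_add], by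
    obtain ⟨K, hK, h⟩ := μ.2.2
    exact ⟨K, hK, fun A hA => (congrArg f (h A hA)).trans (map_zero f)⟩⟩
  map_add' _ _ := by ext; simp
  map_smul' _ _ := by ext; simp

@[simp] lemma map_apply (f : V →ₗ[k] W) (μ : Meas k X V) (A : Clopens X) :
    (map f μ).1 A = f (μ.1 A) := rfl

/-- The preimage of an open-closed set. -/
def _root_.Contra.clopenPreimage (φ : C(X, Y)) (B : Clopens Y) : Clopens X :=
  ⟨φ ⁻¹' B, B.isClopen.preimage φ.continuous⟩

/-- The pushforward of measures `V[[X]] → V[[Y]]` along a continuous map `X → Y`. -/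
def push (φ : C(X, Y)) : Meas k X V →ₗ[k] Meas k Y V where
  toFun μ := ⟨fun B => μ.1 (clopenPreimage φ B), fun A B h => by
      rw [← μ.2.1 _ _ (by exact h.preimage φ)]; rfl, by
    obtain ⟨K, hK, h⟩ := μ.2.2
    refine ⟨φ '' K, hK.image φ.continuous, fun A hA => h _ ?_⟩
    exact Set.disjoint_left.2 fun x hx hxK =>
      Set.disjoint_left.1 hA (show φ x ∈ (A : Set Y) from hx) ⟨x, hxK, rfl⟩⟩
  map_add' _ _ := by ext; simp
  map_smul' _ _ := by ext; simp

@[simp] lemma push_apply (φ : C(X, Y)) (μ : Meas k X V) (B : Clopens Y) :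
    (push φ μ).1 B = μ.1 (clopenPreimage φ B) := rfl

/-- The natural map `V[[X × Y]] → V[[X]][[Y]]`. -/
def curry : Meas k (X × Y) V →ₗ[k] Meas k Y (Meas k X V) where
  toFun μ := ⟨fun B => ⟨fun A => μ.1 (A ×ˢ B), fun A A' h => by
        rw [← μ.2.1 _ _ (by exact Set.disjoint_prod.2 (Or.inl h))]
        exact congrArg μ.1 (Clopens.ext Set.union_prod), by
      obtain ⟨K, hK, h⟩ := μ.2.2
      refine ⟨Prod.fst '' K, hK.image continuous_fst, fun A hA => h _ ?_⟩
      exact Set.disjoint_left.2 fun x hx hxK => Set.disjoint_left.1 hA hx.1 ⟨x, hxK, rfl⟩⟩,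
    fun B B' h => by
      refine Meas.ext fun A => ?_
      refine Eq.trans ?_ (μ.2.1 (A ×ˢ B) (A ×ˢ B') (by exact Set.disjoint_prod.2 (Or.inr h)))
      exact congrArg μ.1 (Clopens.ext Set.prod_union), by
    obtain ⟨K, hK, h⟩ := μ.2.2
    refine ⟨Prod.snd '' K, hK.image continuous_snd, fun B hB => ?_⟩
    refine Meas.ext fun A => ?_
    refine h _ ?_
    exact Set.disjoint_left.2 fun x hx hxK => Set.disjoint_left.1 hB hx.2 ⟨x, hxK, rfl⟩⟩
  map_add' _ _ := rfl
  map_smul' _ _ := rfl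

@[simp] lemma curry_apply (μ : Meas k (X × Y) V) (A : Clopens X) (B : Clopens Y) :
    ((curry μ).1 B).1 A = μ.1 (A ×ˢ B) := rfl

open Classical in
/-- The point measure at `x` with the value `v`. -/
def dirac (x : X) : V →ₗ[k] Meas k X V where
  toFun v := ⟨fun A => if x ∈ A then v else 0, fun A B h => by
      have : x ∈ A → x ∉ B := fun h1 h2 => Set.disjoint_left.1 h h1 h2
      have h' : x ∈ A ⊔ B ↔ x ∈ A ∨ x ∈ B := Iff.rfl
      by_cases h1 : x ∈ A <;> by_cases h2 : x ∈ B <;> simp_all, by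
    refine ⟨{x}, isCompact_singleton, fun A hA => if_neg fun h => ?_⟩
    exact Set.disjoint_left.1 hA h rfl⟩
  map_add' _ _ := by ext; simp; split_ifs <;> simp
  map_smul' _ _ := by ext; simp

/-- The open-closed set on which a locally constant function takes a given value. -/
def _root_.Contra.fiber {T : Type*} (c : LocallyConstant X T) (t : T) : Clopens X :=
  ⟨c ⁻¹' {t}, c.isLocallyConstant.isClopen_fiber t⟩

/-- The integral `∫ F dμ` of a locally constant operator-valued function `F` with respect to a
compactly supported `V`-valued measure `μ`. The sum is finite, as `F` takes
only finitely many values on the compact support of `μ`. -/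
def integral (F : LocallyConstant X (V →ₗ[k] W)) (μ : Meas k X V) : W :=
  ∑ᶠ T : V →ₗ[k] W, T (μ.1 (fiber F T))

lemma isClopen_preimage {T : Type*} (c : LocallyConstant X T) (s : Set T) :
    IsClopen (c ⁻¹' s) :=
  ⟨⟨by rw [← Set.preimage_compl]; exact c.isLocallyConstant _⟩, c.isLocallyConstant _⟩

lemma exists_finset {T : Type*} (c : LocallyConstant X T) {K : Set X} (hK : IsCompact K) :
    ∃ t : Finset T, ∀ x ∈ K, c x ∈ t := by
  have : (c '' K).Finite := by
    let _ : TopologicalSpace T := ⊥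
    have : DiscreteTopology T := ⟨rfl⟩
    exact (hK.image c.continuous).finite_of_discrete
  exact ⟨this.toFinset, fun x hx => by simpa using ⟨x, hx, rfl⟩⟩

lemma eq_sum {μ : Meas k X V} {K : Set X} (hμ : SupportedOn K μ.1) {T : Type*}
    (c : LocallyConstant X T) (t : Finset T) (ht : ∀ x ∈ K, c x ∈ t) (A : Clopens X) :
    μ.1 A = ∑ s ∈ t, μ.1 (A ⊓ fiber c s) := by
  classical
  have key : ∀ t : Finset T, μ.1 (A ⊓ ⟨c ⁻¹' (t : Set T), isClopen_preimage c _⟩) =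
      ∑ s ∈ t, μ.1 (A ⊓ fiber c s) := by
    intro t
    induction t using Finset.induction with
    | empty =>
      rw [Finset.sum_empty, ← apply_bot μ]
      refine congrArg μ.1 (Clopens.ext ?_)
      ext x; simp
    | insert a t ha ih =>
      rw [Finset.sum_insert ha, ← ih, ← μ.2.1]
      · refine congrArg μ.1 (Clopens.ext ?_)
        ext x
        simp [fiber]
        tauto
      · refine Set.disjoint_left.2 fun x hx hx' => ha ?_
        have h1 : c x = a := hx.2
        have h2 : c x ∈ t := hx'.2
        rwa [h1] at h2
  rw [← key t]
  have h0 : μ.1 (A \ ⟨c ⁻¹' (t : Set T), isClopen_preimage c _⟩) = 0 :=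
    hμ _ (Set.disjoint_left.2 fun x hx hxK => hx.2 (ht x hxK))
  rw [← add_zero (μ.1 (A ⊓ _)), ← h0, ← μ.2.1]
  · refine congrArg μ.1 (Clopens.ext ?_)
    ext x
    simp
  · exact Set.disjoint_left.2 fun x hx hx' => hx'.2 hx.2

lemma integral_eq_sum {μ : Meas k X V} {K : Set X} (hμ : SupportedOn K μ.1) {T : Type*}
    (c : LocallyConstant X T) (t : Finset T) (ht : ∀ x ∈ K, c x ∈ t)
    (φ : T → (V →ₗ[k] W)) (F : LocallyConstant X (V →ₗ[k] W)) (hF : ∀ x, F x = φ (c x)) :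
    integral F μ = ∑ s ∈ t, φ s (μ.1 (fiber c s)) := by
  classical
  have h1 : integral F μ = ∑ T ∈ t.image φ, T (μ.1 (fiber F T)) := by
    refine finsum_eq_sum_of_support_subset _ fun S hS => ?_
    by_contra h
    refine hS ?_
    refine (congrArg S (hμ _ ?_)).trans (map_zero S)
    refine Set.disjoint_left.2 fun x hx hxK => h ?_
    have hx : F x = S := hx
    rw [← hx, hF]
    exact Finset.mem_coe.2 (Finset.mem_image_of_mem φ (ht x hxK))
  have h2 : ∀ S : V →ₗ[k] W, S (μ.1 (fiber F S)) =
      ∑ s ∈ t, if φ s = S then φ s (μ.1 (fiber c s)) else 0 := by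
    intro S
    rw [eq_sum hμ c t ht, map_sum]
    refine Finset.sum_congr rfl fun s _ => ?_
    split_ifs with h
    · subst h
      refine congrArg _ (congrArg μ.1 (Clopens.ext ?_))
      ext x
      simp only [Clopens.coe_inf, Set.mem_inter_iff, and_iff_right_iff_imp]
      intro hx
      have hx : c x = s := hx
      show F x = φ s
      rw [hF, hx]
    · have : fiber F S ⊓ fiber c s = ⊥ := by
        apply Clopens.ext
        ext x
        simp only [Clopens.coe_inf, Set.mem_inter_iff, Clopens.coe_bot, Set.mem_empty_iff_false,
          iff_false, not_and]
        intro hx hx'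
        have hx : F x = S := hx
        have hx' : c x = s := hx'
        exact h (by rw [← hx, hF, hx'])
      rw [this, apply_bot, map_zero]
  rw [h1, Finset.sum_congr rfl fun S _ => h2 S, Finset.sum_comm]
  refine Finset.sum_congr rfl fun s hs => ?_
  rw [Finset.sum_ite_eq, if_pos (Finset.mem_image_of_mem φ hs)]

lemma integral_add (F : LocallyConstant X (V →ₗ[k] W)) (μ ν : Meas k X V) :
    integral F (μ + ν) = integral F μ + integral F ν := by
  obtain ⟨K, hK, hμ⟩ := μ.2.2
  obtain ⟨K', hK', hν⟩ := ν.2.2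
  obtain ⟨t, ht⟩ := exists_finset F (hK.union hK')
  have hμ' : SupportedOn (K ∪ K') μ.1 := fun A hA => hμ A (Set.disjoint_union_right.1 hA).1
  have hν' : SupportedOn (K ∪ K') ν.1 := fun A hA => hν A (Set.disjoint_union_right.1 hA).2
  have hs : SupportedOn (K ∪ K') (μ + ν).1 := fun A hA => by
    simp [hμ' A hA, hν' A hA]
  rw [integral_eq_sum hμ' F t ht id F fun _ => rfl, integral_eq_sum hν' F t ht id F fun _ => rfl,
    integral_eq_sum hs F t ht id F fun _ => rfl, ← Finset.sum_add_distrib]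
  simp

lemma integral_smul (F : LocallyConstant X (V →ₗ[k] W)) (a : k) (μ : Meas k X V) :
    integral F (a • μ) = a • integral F μ := by
  obtain ⟨K, hK, hμ⟩ := μ.2.2
  obtain ⟨t, ht⟩ := exists_finset F hK
  have hs : SupportedOn K (a • μ).1 := fun A hA => by simp [hμ A hA]
  rw [integral_eq_sum hμ F t ht id F fun _ => rfl, integral_eq_sum hs F t ht id F fun _ => rfl,
    Finset.smul_sum]
  simp

/-- Integration of a fixed function, as a linear map in the measure. -/
def integralₗ (F : LocallyConstant X (V →ₗ[k] W)) : Meas k X V →ₗ[k] W where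
  toFun := integral F
  map_add' := integral_add F
  map_smul' := integral_smul F

lemma integral_comp (L : W →ₗ[k] W') (F : LocallyConstant X (V →ₗ[k] W))
    (F' : LocallyConstant X (V →ₗ[k] W')) (h : ∀ x, F' x = L ∘ₗ F x) (μ : Meas k X V) :
    integral F' μ = L (integral F μ) := by
  obtain ⟨K, hK, hμ⟩ := μ.2.2
  obtain ⟨t, ht⟩ := exists_finset F hK
  rw [integral_eq_sum hμ F t ht id F fun _ => rfl,
    integral_eq_sum hμ F t ht (fun S => L ∘ₗ S) F' h, map_sum]
  rfl

lemma integral_map (f : V →ₗ[k] W) (F : LocallyConstant X (W →ₗ[k] W'))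
    (F' : LocallyConstant X (V →ₗ[k] W')) (h : ∀ x, F' x = F x ∘ₗ f) (μ : Meas k X V) :
    integral F (map f μ) = integral F' μ := by
  obtain ⟨K, hK, hμ⟩ := μ.2.2
  obtain ⟨t, ht⟩ := exists_finset F hK
  have hs : SupportedOn K (map f μ).1 := fun A hA => by simp [hμ A hA]
  rw [integral_eq_sum hs F t ht id F fun _ => rfl,
    integral_eq_sum hμ F t ht (fun S => S ∘ₗ f) F' h]
  rfl

lemma integral_push (φ : C(X, Y)) (F : LocallyConstant Y (V →ₗ[k] W))
    (F' : LocallyConstant X (V →ₗ[k] W)) (h : ∀ x, F' x = F (φ x)) (μ : Meas k X V) :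
    integral F (push φ μ) = integral F' μ := by
  unfold integral
  refine finsum_congr fun T => ?_
  rw [push_apply]
  refine congrArg _ (congrArg μ.1 (Clopens.ext ?_))
  ext x
  show F (φ x) = T ↔ F' x = T
  rw [h]

lemma integral_add_fun (F₁ F₂ F : LocallyConstant X (V →ₗ[k] W))
    (h : ∀ x, F x = F₁ x + F₂ x) (μ : Meas k X V) :
    integral F μ = integral F₁ μ + integral F₂ μ := by
  obtain ⟨K, hK, hμ⟩ := μ.2.2
  let c : LocallyConstant X ((V →ₗ[k] W) × (V →ₗ[k] W)) :=
    ⟨fun x => (F₁ x, F₂ x), F₁.isLocallyConstant.prodMk F₂.isLocallyConstant⟩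
  obtain ⟨t, ht⟩ := exists_finset c hK
  rw [integral_eq_sum hμ c t ht (fun S => S.1 + S.2) F h,
    integral_eq_sum hμ c t ht (fun S => S.1) F₁ fun _ => rfl,
    integral_eq_sum hμ c t ht (fun S => S.2) F₂ fun _ => rfl, ← Finset.sum_add_distrib]
  rfl

lemma integral_smul_fun (a : k) (F₁ F : LocallyConstant X (V →ₗ[k] W))
    (h : ∀ x, F x = a • F₁ x) (μ : Meas k X V) :
    integral F μ = a • integral F₁ μ :=
  integral_comp (a • LinearMap.id) F₁ F (fun x => by rw [h]; ext; simp) μ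

lemma integral_dirac (F : LocallyConstant X (V →ₗ[k] W)) (x : X) (v : V) :
    integral F (dirac x v) = F x v := by
  classical
  have hs : SupportedOn {x} (dirac (k := k) x v).1 := fun A hA =>
    if_neg fun h => Set.disjoint_left.1 hA h rfl
  rw [integral_eq_sum hs F {F x} (by simp) id F fun _ => rfl, Finset.sum_singleton]
  show F x (if _ then _ else _) = _
  rw [if_pos]
  exact (rfl : F x = F x)

/-- A form of Fubini's theorem. -/
lemma integral_curry {D : Type*} (d : LocallyConstant Y D)
    (E : D → LocallyConstant X (V →ₗ[k] W)) (F : LocallyConstant (X × Y) (V →ₗ[k] W))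
    (hF : ∀ x y, F (x, y) = E (d y) x) (F' : LocallyConstant Y (Meas k X V →ₗ[k] W))
    (hF' : ∀ y, F' y = integralₗ (E (d y))) (μ : Meas k (X × Y) V) :
    integral F' (curry μ) = integral F μ := by
  classical
  obtain ⟨K, hK, hμ⟩ := μ.2.2
  have hcur : SupportedOn (Prod.snd '' K) (curry μ).1 := fun B hB => by
    refine Meas.ext fun A => hμ _ ?_
    exact Set.disjoint_left.2 fun x hx hxK => Set.disjoint_left.1 hB hx.2 ⟨x, hxK, rfl⟩
  let c : LocallyConstant (X × Y) (D × (V →ₗ[k] W)) :=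
    ⟨fun z => (d z.2, F z),
      (d.isLocallyConstant.comp_continuous continuous_snd).prodMk F.isLocallyConstant⟩
  obtain ⟨t, ht⟩ := exists_finset c hK
  have ht' : ∀ z ∈ K, c z ∈ t.image Prod.fst ×ˢ t.image Prod.snd := fun z hz =>
    Finset.mem_product.2 ⟨Finset.mem_image_of_mem _ (ht z hz), Finset.mem_image_of_mem _ (ht z hz)⟩
  have hd : ∀ y ∈ Prod.snd '' K, d y ∈ t.image Prod.fst := by
    rintro _ ⟨z, hz, rfl⟩
    exact (Finset.mem_product.1 (ht' z hz)).1
  rw [integral_eq_sum hcur d _ hd (fun δ => integralₗ (E δ)) F' hF',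
    integral_eq_sum hμ c _ ht' Prod.snd F fun _ => rfl, Finset.sum_product]
  refine Finset.sum_congr rfl fun δ _ => ?_
  have hs : SupportedOn (Prod.fst '' (K ∩ {z | d z.2 = δ})) ((curry μ).1 (fiber d δ)).1 := by
    intro A hA
    refine hμ _ (Set.disjoint_left.2 fun z hz hzK => ?_)
    exact Set.disjoint_left.1 hA hz.1 ⟨z, ⟨hzK, hz.2⟩, rfl⟩
  have hE : ∀ x ∈ Prod.fst '' (K ∩ {z | d z.2 = δ}), E δ x ∈ t.image Prod.snd := by
    rintro _ ⟨z, ⟨hzK, hz⟩, rfl⟩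
    have h1 : E δ z.1 = F z := by
      have hz : d z.2 = δ := hz
      rw [← hz, ← hF]
    rw [h1]
    exact (Finset.mem_product.1 (ht' z hzK)).2
  refine (integral_eq_sum hs (E δ) _ hE id (E δ) fun _ => rfl).trans ?_
  refine Finset.sum_congr rfl fun S _ => ?_
  show S _ = S _
  rw [curry_apply]
  refine congrArg _ (congrArg μ.1 (Clopens.ext ?_))
  ext ⟨x, y⟩
  show (E δ x = S ∧ d y = δ) ↔ (d y, F (x, y)) = (δ, S)
  rw [hF, Prod.mk.injEq]
  constructor
  · rintro ⟨h1, h2⟩; rw [h2]; exact ⟨rfl, h1⟩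
  · rintro ⟨h1, h2⟩; rw [h1] at h2; exact ⟨h2, h1⟩

lemma map_id (μ : Meas k X V) : map LinearMap.id μ = μ := rfl

lemma map_comp (g : W →ₗ[k] W') (f : V →ₗ[k] W) (μ : Meas k X V) :
    map (g ∘ₗ f) μ = map g (map f μ) := rfl

lemma map_push (f : V →ₗ[k] W) (φ : C(X, Y)) (μ : Meas k X V) :
    map f (push φ μ) = push φ (map f μ) := rfl

lemma map_curry (f : V →ₗ[k] W) (μ : Meas k (X × Y) V) :
    map (map f) (curry μ) = curry (map f μ) := rfl

lemma map_dirac (f : V →ₗ[k] W) (x : X) (v : V) :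
    map f (dirac x v) = dirac x (f v) := by
  classical
  refine Meas.ext fun A => ?_
  show f (if _ then _ else _) = if _ then _ else _
  split_ifs <;> simp

lemma map_surjective {f : V →ₗ[k] W} (hf : Function.Surjective f) :
    Function.Surjective (map (X := X) f) := by
  obtain ⟨g, hg⟩ := f.exists_rightInverse_of_surjective (LinearMap.range_eq_top.2 hf)
  exact fun μ => ⟨map g μ, by rw [← map_comp, hg, map_id]⟩

lemma map_injective {f : V →ₗ[k] W} (hf : Function.Injective f) :
    Function.Injective (map (X := X) f) := by
  intro μ ν h
  refine Meas.ext fun A => hf ?_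
  exact congrArg (fun ρ : Meas k X W => ρ.1 A) h

end Meas
end Measures

/-! ### `G`-contramodules -/

/-- The multiplication of a topological group as a continuous map. -/
def mulMap (G : Type*) [Group G] [TopologicalSpace G] [IsTopologicalGroup G] : C(G × G, G) :=
  ⟨fun z => z.1 * z.2, continuous_mul⟩

end Contra

open Contra

/-- A `G`-contramodule over `k`: a vector space `P` with a contraaction map `P[[G]] → P`
satisfying contraassociativity and contraunitality. -/
structure GContra (k G : Type u) [Field k] [Group G] [TopologicalSpace G]
    [IsTopologicalGroup G] where
  /-- The underlying vector space. -/
  V : Type u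
  [addCommGroup : AddCommGroup V]
  [module : Module k V]
  /-- The contraaction map. -/
  act : Meas k G V →ₗ[k] V
  /-- Contraassociativity: the two maps `P[[G × G]] ⇉ P[[G]]`, the pushforward along the
  multiplication and the composition `P[[G × G]] → P[[G]][[G]] → P[[G]]`, have equal
  compositions with the contraaction map. -/
  act_assoc : ∀ μ : Meas k (G × G) V, act (Meas.push (mulMap G) μ) = act (Meas.map act (Meas.curry μ))
  /-- Contraunitality. -/
  act_unit : ∀ x : V, act (Meas.dirac 1 x) = x

namespace GContra

variable {k G : Type u} [Field k] [Group G] [TopologicalSpace G] [IsTopologicalGroup G]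

attribute [instance] addCommGroup module

/-- Morphisms of `G`-contramodules: linear maps commuting with the contraaction. -/
@[ext]
structure Hom (P Q : GContra k G) where
  /-- The underlying linear map. -/
  lin : P.V →ₗ[k] Q.V
  comm : ∀ μ : Meas k G P.V, lin (P.act μ) = Q.act (Meas.map lin μ)

instance : Category (GContra k G) where
  Hom := Hom
  id P := ⟨LinearMap.id, fun _ => rfl⟩
  comp f g := ⟨g.lin ∘ₗ f.lin, fun μ => by
    rw [LinearMap.comp_apply, f.comm, g.comm, Meas.map_comp]⟩

variable {P Q R : GContra k G}

@[ext] lemma hom_ext {f g : P ⟶ Q} (h : f.lin = g.lin) : f = g := Hom.ext h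

@[simp] lemma id_lin : Hom.lin (𝟙 P) = LinearMap.id := rfl

@[simp] lemma comp_lin (f : P ⟶ Q) (g : Q ⟶ R) : (f ≫ g).lin = g.lin ∘ₗ f.lin := rfl

lemma lin_injective : Function.Injective (fun f : P ⟶ Q => f.lin) := fun _ _ h => Hom.ext h

instance : Zero (P ⟶ Q) := ⟨⟨0, fun μ => by
  rw [show Meas.map (0 : P.V →ₗ[k] Q.V) μ = 0 from rfl, map_zero]; rfl⟩⟩

instance : Add (P ⟶ Q) := ⟨fun f g => ⟨f.lin + g.lin, fun μ => by
  rw [show Meas.map (f.lin + g.lin) μ = Meas.map f.lin μ + Meas.map g.lin μ from rfl, map_add,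
    ← f.comm, ← g.comm]; rfl⟩⟩

instance : Neg (P ⟶ Q) := ⟨fun f => ⟨-f.lin, fun μ => by
  rw [show Meas.map (-f.lin) μ = -Meas.map f.lin μ from rfl, map_neg, ← f.comm]; rfl⟩⟩

instance : Sub (P ⟶ Q) := ⟨fun f g => ⟨f.lin - g.lin, fun μ => by
  rw [show Meas.map (f.lin - g.lin) μ = Meas.map f.lin μ - Meas.map g.lin μ from
    Meas.ext fun A => rfl, map_sub, ← f.comm, ← g.comm]; rfl⟩⟩

instance : SMul ℕ (P ⟶ Q) := ⟨fun n f => ⟨n • f.lin, fun μ => by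
  rw [show Meas.map (n • f.lin) μ = n • Meas.map f.lin μ from rfl, map_nsmul, ← f.comm]; rfl⟩⟩

instance : SMul ℤ (P ⟶ Q) := ⟨fun n f => ⟨n • f.lin, fun μ => by
  rw [show Meas.map (n • f.lin) μ = n • Meas.map f.lin μ from rfl, map_zsmul, ← f.comm]; rfl⟩⟩

instance : AddCommGroup (P ⟶ Q) :=
  lin_injective.addCommGroup _ rfl (fun _ _ => rfl) (fun _ => rfl) (fun _ _ => rfl)
    (fun _ _ => rfl) (fun _ _ => rfl)

@[simp] lemma zero_lin : Hom.lin (0 : P ⟶ Q) = 0 := rfl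

@[simp] lemma add_lin (f g : P ⟶ Q) : Hom.lin (f + g) = f.lin + g.lin := rfl

instance : Preadditive (GContra k G) where
  add_comp _ _ _ _ _ _ := by ext; simp
  comp_add _ _ _ _ _ _ := by ext; simp

/-- The contramodule structure on a subspace stable under the contraaction. -/
def sub (P : GContra k G) (S : Submodule k P.V)
    (hS : ∀ μ : Meas k G S, P.act (Meas.map S.subtype μ) ∈ S) : GContra k G where
  V := S
  act := (P.act ∘ₗ Meas.map S.subtype).codRestrict S hS
  act_assoc μ := by
    apply Subtype.ext
    show P.act (Meas.map _ (Meas.push _ μ)) = P.act (Meas.map _ (Meas.map _ (Meas.curry μ)))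
    rw [Meas.map_push, P.act_assoc, ← Meas.map_curry, ← Meas.map_comp, ← Meas.map_comp]
    rfl
  act_unit x := by
    apply Subtype.ext
    show P.act (Meas.map _ (Meas.dirac 1 x)) = _
    rw [Meas.map_dirac, P.act_unit]
    rfl

/-- The inclusion of a subcontramodule. -/
def subι (P : GContra k G) (S : Submodule k P.V)
    (hS : ∀ μ : Meas k G S, P.act (Meas.map S.subtype μ) ∈ S) : P.sub S hS ⟶ P :=
  ⟨S.subtype, fun _ => rfl⟩

/-- The induced contraaction on a quotient. -/
def quotAct (P : GContra k G) (S : Submodule k P.V)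
    (hS : ∀ μ : Meas k G P.V, Meas.map S.mkQ μ = 0 → P.act μ ∈ S) :
    Meas k G (P.V ⧸ S) →ₗ[k] P.V ⧸ S :=
  let e := (Meas.map (X := G) S.mkQ).quotKerEquivOfSurjective
    (Meas.map_surjective S.mkQ_surjective)
  ((LinearMap.ker (Meas.map (X := G) S.mkQ)).liftQ (S.mkQ ∘ₗ P.act)
    (fun μ hμ => by simpa using hS μ hμ)) ∘ₗ e.symm.toLinearMap

lemma quotAct_map (P : GContra k G) (S : Submodule k P.V)
    (hS : ∀ μ : Meas k G P.V, Meas.map S.mkQ μ = 0 → P.act μ ∈ S) (μ : Meas k G P.V) :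
    P.quotAct S hS (Meas.map S.mkQ μ) = S.mkQ (P.act μ) := by
  simp only [quotAct, LinearMap.comp_apply, LinearEquiv.coe_coe]
  have : ((Meas.map (X := G) S.mkQ).quotKerEquivOfSurjective
    (Meas.map_surjective S.mkQ_surjective)).symm (Meas.map S.mkQ μ) = Submodule.Quotient.mk μ := by
    rw [LinearEquiv.symm_apply_eq]; rfl
  rw [this]; rfl

/-- The quotient contramodule. -/
def quot (P : GContra k G) (S : Submodule k P.V)
    (hS : ∀ μ : Meas k G P.V, Meas.map S.mkQ μ = 0 → P.act μ ∈ S) : GContra k G where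
  V := P.V ⧸ S
  act := P.quotAct S hS
  act_assoc μ := by
    obtain ⟨μ, rfl⟩ := Meas.map_surjective S.mkQ_surjective μ
    have h : P.quotAct S hS ∘ₗ Meas.map S.mkQ = S.mkQ ∘ₗ P.act :=
      LinearMap.ext (P.quotAct_map S hS)
    rw [← Meas.map_push, quotAct_map, P.act_assoc, ← Meas.map_curry, ← Meas.map_comp, h,
      Meas.map_comp, quotAct_map]
  act_unit x := by
    obtain ⟨x, rfl⟩ := S.mkQ_surjective x
    rw [← Meas.map_dirac, quotAct_map, P.act_unit]

/-- The projection onto a quotient contramodule. -/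
def quotπ (P : GContra k G) (S : Submodule k P.V)
    (hS : ∀ μ : Meas k G P.V, Meas.map S.mkQ μ = 0 → P.act μ ∈ S) : P ⟶ P.quot S hS :=
  ⟨S.mkQ, fun μ => (P.quotAct_map S hS μ).symm⟩

lemma ker_stable (f : P ⟶ Q) (μ : Meas k G (LinearMap.ker f.lin)) :
    P.act (Meas.map (LinearMap.ker f.lin).subtype μ) ∈ LinearMap.ker f.lin := by
  rw [LinearMap.mem_ker, f.comm, ← Meas.map_comp]
  have : f.lin ∘ₗ (LinearMap.ker f.lin).subtype = 0 := by ext x; exact x.2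
  rw [this]
  exact map_zero Q.act

lemma range_stable (f : P ⟶ Q) (μ : Meas k G Q.V)
    (hμ : Meas.map (LinearMap.range f.lin).mkQ μ = 0) : Q.act μ ∈ LinearMap.range f.lin := by
  have hμ' : ∀ A, μ.1 A ∈ LinearMap.range f.lin := fun A => by
    have := congrArg (fun ρ : Meas k G _ => ρ.1 A) hμ
    simpa using this
  let ν : Meas k G (LinearMap.range f.lin) := ⟨fun A => ⟨μ.1 A, hμ' A⟩,
    fun A B h => Subtype.ext (μ.2.1 A B h), by
      obtain ⟨K, hK, h⟩ := μ.2.2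
      exact ⟨K, hK, fun A hA => Subtype.ext (h A hA)⟩⟩
  obtain ⟨ρ, hρ⟩ := Meas.map_surjective f.lin.surjective_rangeRestrict ν
  refine ⟨P.act ρ, ?_⟩
  rw [f.comm]
  congr 1
  have := congrArg (Meas.map (LinearMap.range f.lin).subtype) hρ
  exact this

open Limits

/-- The subcontramodule inclusion is a kernel. -/
def isLimitKer (f : P ⟶ Q) :
    IsLimit (KernelFork.ofι (f := f) (P.subι (LinearMap.ker f.lin) (ker_stable f))
      (by ext x; exact x.2)) :=
  KernelFork.IsLimit.ofι _ _
    (fun {T} g hg => ⟨g.lin.codRestrict _ fun t => by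
        have := congrArg (fun h : T ⟶ Q => h.lin t) hg
        exact this, fun μ => Subtype.ext (g.comm μ)⟩)
    (fun _ _ => rfl)
    (fun {T} g hg m hm => by
      subst hm
      rfl)

/-- A morphism out of `P` killing the kernel of a surjection descends. -/
def descOfSurj (q : P ⟶ Q) (hq : Function.Surjective q.lin) (g : P ⟶ R)
    (hg : LinearMap.ker q.lin ≤ LinearMap.ker g.lin) : Q ⟶ R :=
  ⟨((LinearMap.ker q.lin).liftQ g.lin hg) ∘ₗ
      (q.lin.quotKerEquivOfSurjective hq).symm.toLinearMap, by
    have h : (((LinearMap.ker q.lin).liftQ g.lin hg) ∘ₗ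
      (q.lin.quotKerEquivOfSurjective hq).symm.toLinearMap) ∘ₗ q.lin = g.lin := by
      ext x
      have : (q.lin.quotKerEquivOfSurjective hq).symm (q.lin x) = Submodule.Quotient.mk x := by
        rw [LinearEquiv.symm_apply_eq]; rfl
      simp only [LinearMap.comp_apply, LinearEquiv.coe_coe, this]
      rfl
    intro μ
    obtain ⟨μ, rfl⟩ := Meas.map_surjective hq μ
    rw [← q.comm, ← Meas.map_comp, h, ← g.comm]
    exact congrArg (fun l => l (P.act μ)) h⟩

lemma comp_descOfSurj (q : P ⟶ Q) (hq : Function.Surjective q.lin) (g : P ⟶ R)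
    (hg : LinearMap.ker q.lin ≤ LinearMap.ker g.lin) : q ≫ descOfSurj q hq g hg = g := by
  ext x
  have : (q.lin.quotKerEquivOfSurjective hq).symm (q.lin x) = Submodule.Quotient.mk x := by
    rw [LinearEquiv.symm_apply_eq]; rfl
  simp only [descOfSurj, comp_lin, LinearMap.comp_apply, LinearEquiv.coe_coe, this]
  rfl

lemma epi_of_surj (q : P ⟶ Q) (hq : Function.Surjective q.lin) : Epi q where
  left_cancellation g h hgh := by
    ext x
    obtain ⟨x, rfl⟩ := hq x
    exact congrArg (fun h : P ⟶ _ => h.lin x) hgh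

/-- A surjective morphism is a cokernel of any morphism whose image is its kernel. -/
def isColimitOfSurj (f : P ⟶ Q) (q : Q ⟶ R) (w : f ≫ q = 0)
    (hq : Function.Surjective q.lin) (hf : LinearMap.ker q.lin ≤ LinearMap.range f.lin) :
    IsColimit (CokernelCofork.ofπ q w) :=
  CokernelCofork.IsColimit.ofπ _ _
    (fun {T} g hg => descOfSurj q hq g (hf.trans (by
      rintro _ ⟨x, rfl⟩
      exact congrArg (fun h : P ⟶ T => h.lin x) hg)))
    (fun g hg => comp_descOfSurj q hq g _)
    (fun {T} g hg m hm => by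
      have := epi_of_surj q hq
      rw [← cancel_epi q, hm, comp_descOfSurj])

instance : HasKernels (GContra k G) := ⟨fun f => ⟨⟨_, isLimitKer f⟩⟩⟩

lemma range_comp_quotπ (f : P ⟶ Q) :
    f ≫ Q.quotπ (LinearMap.range f.lin) (range_stable f) = 0 := by
  ext x
  exact (Submodule.Quotient.mk_eq_zero _).2 ⟨x, rfl⟩

/-- The quotient by the image is a cokernel. -/
def isColimitCoker (f : P ⟶ Q) :
    IsColimit (CokernelCofork.ofπ (f := f) (Q.quotπ (LinearMap.range f.lin) (range_stable f))
      (range_comp_quotπ f)) :=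
  isColimitOfSurj f _ _ (Submodule.mkQ_surjective _) (Submodule.ker_mkQ _).le

instance : HasCokernels (GContra k G) := ⟨fun f => ⟨⟨_, isColimitCoker f⟩⟩⟩

lemma injective_of_mono (f : P ⟶ Q) [Mono f] : Function.Injective f.lin := by
  rw [← LinearMap.ker_eq_bot, eq_bot_iff]
  intro x hx
  have h : P.subι (LinearMap.ker f.lin) (ker_stable f) = 0 := by
    rw [← cancel_mono f, zero_comp]
    ext x
    exact x.2
  exact congrArg (fun h : P.sub (LinearMap.ker f.lin) (ker_stable f) ⟶ P => h.lin ⟨x, hx⟩) h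

lemma surjective_of_epi (f : P ⟶ Q) [Epi f] : Function.Surjective f.lin := by
  have h : Q.quotπ (LinearMap.range f.lin) (range_stable f) = 0 := by
    rw [← cancel_epi f, range_comp_quotπ, comp_zero]
  intro x
  have := congrArg (fun h : Q ⟶ Q.quot (LinearMap.range f.lin) (range_stable f) => h.lin x) h
  exact (Submodule.Quotient.mk_eq_zero _).1 this

/-- An injective morphism is a kernel of any morphism whose kernel is its image. -/
def isLimitOfInj (f : P ⟶ Q) (q : Q ⟶ R) (w : f ≫ q = 0)
    (hf : Function.Injective f.lin) (hq : LinearMap.ker q.lin ≤ LinearMap.range f.lin) :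
    IsLimit (KernelFork.ofι f w) := by
  have key : ∀ {T : GContra k G} (g : T ⟶ Q), g ≫ q = 0 → ∀ t, g.lin t ∈ LinearMap.range f.lin :=
    fun {T} g hg t => hq (congrArg (fun h : T ⟶ R => h.lin t) hg)
  have lift : ∀ {T : GContra k G} (g : T ⟶ Q), g ≫ q = 0 → ∃ l : T ⟶ P, l ≫ f = g := by
    intro T g hg
    let l : T.V →ₗ[k] P.V := (LinearEquiv.ofInjective f.lin hf).symm.toLinearMap ∘ₗ
      g.lin.codRestrict (LinearMap.range f.lin) (key g hg)
    have hl : f.lin ∘ₗ l = g.lin := by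
      ext t
      exact congrArg Subtype.val ((LinearEquiv.ofInjective f.lin hf).apply_symm_apply
        ⟨g.lin t, key g hg t⟩)
    refine ⟨⟨l, fun μ => hf ?_⟩, by ext t; exact congrArg (fun h => h t) hl⟩
    rw [f.comm, ← Meas.map_comp, hl, ← g.comm, ← hl]
    rfl
  exact KernelFork.IsLimit.ofι _ _ (fun g hg => (lift g hg).choose)
    (fun g hg => (lift g hg).choose_spec)
    (fun {T} g hg m hm => by
      have h := (lift g hg).choose_spec
      refine hom_ext (LinearMap.ext fun t => hf ?_)
      exact congrArg (fun h : T ⟶ Q => h.lin t) (hm.trans h.symm))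

/-- The product of two contramodules. -/
def prod (P Q : GContra k G) : GContra k G where
  V := P.V × Q.V
  act := (P.act ∘ₗ Meas.map (LinearMap.fst k P.V Q.V)).prod
    (Q.act ∘ₗ Meas.map (LinearMap.snd k P.V Q.V))
  act_assoc μ := by
    refine Prod.ext ?_ ?_
    · show P.act (Meas.map _ (Meas.push _ μ)) = P.act (Meas.map _ (Meas.map _ (Meas.curry μ)))
      rw [Meas.map_push, P.act_assoc, ← Meas.map_curry, ← Meas.map_comp, ← Meas.map_comp]
      rfl
    · show Q.act (Meas.map _ (Meas.push _ μ)) = Q.act (Meas.map _ (Meas.map _ (Meas.curry μ)))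
      rw [Meas.map_push, Q.act_assoc, ← Meas.map_curry, ← Meas.map_comp, ← Meas.map_comp]
      rfl
  act_unit x := by
    refine Prod.ext ?_ ?_
    · show P.act (Meas.map _ (Meas.dirac 1 x)) = _
      rw [Meas.map_dirac, P.act_unit]; rfl
    · show Q.act (Meas.map _ (Meas.dirac 1 x)) = _
      rw [Meas.map_dirac, Q.act_unit]; rfl

instance : HasBinaryProducts (GContra k G) := by
  have : ∀ P Q : GContra k G, HasLimit (pair P Q) := fun P Q =>
    ⟨⟨BinaryFan.mk (P := P.prod Q) ⟨LinearMap.fst k P.V Q.V, fun _ => rfl⟩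
        ⟨LinearMap.snd k P.V Q.V, fun _ => rfl⟩,
      BinaryFan.isLimitMk
        (fun s => ⟨s.fst.lin.prod s.snd.lin, fun μ =>
          Prod.ext (s.fst.comm μ) (s.snd.comm μ)⟩)
        (fun s => rfl) (fun s => rfl)
        (fun s m h1 h2 => by
          refine hom_ext (LinearMap.ext fun t => Prod.ext ?_ ?_)
          · exact congrArg (fun h : s.pt ⟶ P => h.lin t) h1
          · exact congrArg (fun h : s.pt ⟶ Q => h.lin t) h2)⟩⟩
  exact hasBinaryProducts_of_hasLimit_pair _

/-- The zero contramodule. -/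
def zeroObj : GContra k G where
  V := PUnit
  act := 0
  act_assoc _ := rfl
  act_unit _ := rfl

lemma isZero_zeroObj : IsZero (zeroObj : GContra k G) := by
  rw [IsZero.iff_id_eq_zero]
  rfl

instance : HasZeroObject (GContra k G) := ⟨⟨_, isZero_zeroObj⟩⟩

instance : HasFiniteProducts (GContra k G) :=
  have : HasTerminal (GContra k G) := HasZeroObject.hasTerminal
  hasFiniteProducts_of_has_binary_and_terminal

instance : Abelian (GContra k G) where
  normalMonoOfMono {P Q} f _ := ⟨{
    Z := Q.quot (LinearMap.range f.lin) (range_stable f)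
    g := Q.quotπ _ _
    w := range_comp_quotπ f
    isLimit := isLimitOfInj f _ _ (injective_of_mono f) (Submodule.ker_mkQ _).le }⟩
  normalEpiOfEpi {P Q} f _ := ⟨{
    W := P.sub (LinearMap.ker f.lin) (ker_stable f)
    g := P.subι _ _
    w := by ext x; exact x.2
    isColimit := isColimitOfSurj _ f _ (surjective_of_epi f) (fun x hx => ⟨⟨x, hx⟩, rfl⟩) }⟩

end GContra

/-! ### Smooth `G`-modules -/

section Smooth

variable {k G : Type u} [Field k] [Group G] [TopologicalSpace G]

/-- A representation is smooth if the stabilizer of every vector is open. -/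
def IsSmoothRep {V : Type*} [AddCommGroup V] [Module k V] (ρ : Representation k G V) : Prop :=
  ∀ v : V, IsOpen {g : G | ρ g v = v}

variable (k G) in
/-- The property of being a smooth `G`-module. -/
def isSmooth : ObjectProperty (Rep.{u} k G) := fun M => IsSmoothRep M.ρ

variable (k G) in
/-- The category of smooth `G`-modules over `k`. For a profinite group this is the
category of discrete modules. -/
abbrev GSmooth : Type (u + 1) := (isSmooth k G).FullSubcategory

variable [IsTopologicalGroup G]

section
variable {V : Type*} [AddCommGroup V] [Module k V] (ρ : Representation k G V)

/-- The stabilizer of a vector. -/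
def vecStab (v : V) : Subgroup G where
  carrier := {g | ρ g v = v}
  mul_mem' {a b} ha hb := by
    have ha : ρ a v = v := ha
    have hb : ρ b v = v := hb
    show ρ (a * b) v = v
    rw [map_mul, Module.End.mul_apply, hb, ha]
  one_mem' := by simp
  inv_mem' {a} ha := by
    have ha : ρ a v = v := ha
    show ρ a⁻¹ v = v
    conv_lhs => rw [← ha]
    rw [← Module.End.mul_apply, ← map_mul]
    simp

lemma isOpen_stab_of_le (v : V) (U : Subgroup G) (hU : IsOpen (U : Set G))
    (h : ∀ g ∈ U, ρ g v = v) : IsOpen {g : G | ρ g v = v} :=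
  Subgroup.isOpen_mono (H₁ := U) (H₂ := vecStab ρ v) h hU

lemma isOpen_stab_add {v w : V} (hv : IsOpen {g : G | ρ g v = v}) (hw : IsOpen {g : G | ρ g w = w}) :
    IsOpen {g : G | ρ g (v + w) = v + w} :=
  isOpen_stab_of_le ρ _ (vecStab ρ v ⊓ vecStab ρ w) (hv.inter hw) fun g hg => by
    rw [map_add, show ρ g v = v from hg.1, show ρ g w = w from hg.2]

lemma isOpen_stab_map {W : Type*} [AddCommGroup W] [Module k W] (σ : Representation k G W)
    (f : V → W) (hf : ∀ g v, f (ρ g v) = σ g (f v)) {v : V} (hv : IsOpen {g : G | ρ g v = v}) :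
    IsOpen {g : G | σ g (f v) = f v} :=
  isOpen_stab_of_le σ _ (vecStab ρ v) hv fun g hg => by
    rw [← hf, show ρ g v = v from hg]

/-- For a smooth vector, the orbit map is locally constant. -/
def orbitMap (v : V) (hv : IsOpen {g : G | ρ g v = v}) : LocallyConstant G V where
  toFun g := ρ g v
  isLocallyConstant := by
    rw [IsLocallyConstant.iff_exists_open]
    intro g
    refine ⟨(fun x => g⁻¹ * x) ⁻¹' {x | ρ x v = v}, hv.preimage (continuous_const_mul g⁻¹),
      by simp, fun x hx => ?_⟩
    have hx : ρ (g⁻¹ * x) v = v := hx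
    conv_rhs => rw [← hx]
    rw [← Module.End.mul_apply, ← map_mul]
    simp

end

instance : (isSmooth k G).IsClosedUnderIsomorphisms where
  of_iso {M N} e hM v := by
    have := isOpen_stab_map M.ρ N.ρ e.hom.hom (fun g v => Rep.hom_comm_apply _ _ _) (hM (e.inv.hom v))
    rwa [show e.hom.hom (e.inv.hom v) = v by simp] at this

instance : (isSmooth k G).ContainsZero where
  exists_zero := ⟨Rep.trivial k G PUnit, by
      rw [Limits.IsZero.iff_id_eq_zero]
      ext x
    , fun v => by simp⟩

instance : (isSmooth k G).IsClosedUnderSubobjects where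
  prop_of_mono {M N} f _ hN v := by
    have hf := (Rep.mono_iff_injective f).1 inferInstance
    have := hN (f.hom v)
    refine isOpen_stab_of_le M.ρ v (vecStab N.ρ (f.hom v)) this fun g hg => hf ?_
    rw [Rep.hom_comm_apply]
    exact hg

instance : (isSmooth k G).IsClosedUnderQuotients where
  prop_of_epi {M N} f _ hM v := by
    obtain ⟨v, rfl⟩ := (Rep.epi_iff_surjective f).1 inferInstance v
    exact isOpen_stab_map M.ρ N.ρ f.hom (fun g v => Rep.hom_comm_apply _ _ _) (hM v)

instance : (isSmooth k G).IsClosedUnderKernels where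
  kernels_le := by
    rintro _ ⟨f, c, hc, hf⟩
    have : Mono c.ι := Limits.mono_of_isLimit_fork hc
    exact (isSmooth k G).prop_of_mono c.ι hf.1

instance : (isSmooth k G).IsClosedUnderCokernels where
  cokernels_le := by
    rintro _ ⟨f, c, hc, hf⟩
    have : Epi c.π := Limits.epi_of_isColimit_cofork hc
    exact (isSmooth k G).prop_of_epi c.π hf.2

open Limits in
lemma isSmooth_biprod {M N : Rep.{u} k G} (hM : isSmooth k G M) (hN : isSmooth k G N) :
    isSmooth k G (M ⊞ N) := by
  intro v
  have h : v = (biprod.inl : M ⟶ M ⊞ N).hom ((biprod.fst : M ⊞ N ⟶ M).hom v) +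
      (biprod.inr : N ⟶ M ⊞ N).hom ((biprod.snd : M ⊞ N ⟶ N).hom v) := by
    have := congrArg (fun f : M ⊞ N ⟶ M ⊞ N => f.hom v) (biprod.total (X := M) (Y := N))
    exact this.symm
  rw [h]
  exact isOpen_stab_add _
    (isOpen_stab_map M.ρ _ _ (fun g v => Rep.hom_comm_apply _ _ _) (hM _))
    (isOpen_stab_map N.ρ _ _ (fun g v => Rep.hom_comm_apply _ _ _) (hN _))

open Limits in
instance : (isSmooth k G).IsClosedUnderBinaryProducts where
  limitsOfShape_le := by
    rintro X ⟨p⟩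
    let e : X ≅ p.diag.obj ⟨.left⟩ ⊞ p.diag.obj ⟨.right⟩ :=
      p.isLimit.conePointsIsoOfNatIso (limit.isLimit _) (diagramIsoPair p.diag) ≪≫
        (biprod.isoProd _ _).symm
    exact (isSmooth k G).prop_of_iso e.symm
      (isSmooth_biprod (p.prop_diag_obj _) (p.prop_diag_obj _))

instance : (isSmooth k G).IsClosedUnderFiniteProducts := .mk'

/-- The category of smooth `G`-modules is abelian. -/
instance : Abelian (GSmooth k G) := inferInstance

end Smooth

/-! ### The functors `Ψ_G` and `Φ_G` -/

section Functors

variable (k G : Type u) [Field k] [Group G] [TopologicalSpace G] [IsTopologicalGroup G]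

/-- The subspace of compactly supported locally constant functions in all functions `G → k`. -/
def compactFun : Submodule k (G → k) where
  carrier := {f | IsLocallyConstant f ∧ HasCompactSupport f}
  add_mem' hf hg := ⟨hf.1.add hg.1, hf.2.add hg.2⟩
  zero_mem' := ⟨IsLocallyConstant.const 0, HasCompactSupport.zero⟩
  smul_mem' c f hf := ⟨hf.1.comp (fun x => c • x), hf.2.comp_left (g := fun x => c • x) (by simp)⟩

/-- `k(G)`: the space of compactly supported locally constant functions `G → k`. -/
def CompactFun : Type u := ↥(compactFun k G)

namespace CompactFun

instance : AddCommGroup (CompactFun k G) := inferInstanceAs (AddCommGroup ↥(compactFun k G))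

instance : Module k (CompactFun k G) := inferInstanceAs (Module k ↥(compactFun k G))

variable {k G}

@[ext] lemma ext {f f' : CompactFun k G} (h : ∀ x, f.1 x = f'.1 x) : f = f' :=
  Subtype.ext (funext h)

/-- Precomposition of a compactly supported locally constant function with a homeomorphism. -/
def comap (e : G ≃ₜ G) : CompactFun k G →ₗ[k] CompactFun k G where
  toFun f := ⟨f.1 ∘ e, f.2.1.comp_continuous e.continuous, f.2.2.comp_homeomorph e⟩
  map_add' _ _ := rfl
  map_smul' _ _ := rfl

lemma comap_apply (e : G ≃ₜ G) (f : CompactFun k G) (x : G) : (comap e f).1 x = f.1 (e x) := rfl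

variable (k G) in
/-- The left action of `G` on `k(G)`, `(g f)(x) = f(g⁻¹ x)`. -/
def left : Representation k G (CompactFun k G) where
  toFun g := comap (Homeomorph.mulLeft g⁻¹)
  map_one' := by ext f x; simp [comap_apply]
  map_mul' a b := by ext f x; simp [comap_apply, mul_assoc]

variable (k G) in
/-- The right action of `G` on `k(G)`, written as the action `(g f)(x) = f(x g)`. -/
def right : Representation k G (CompactFun k G) where
  toFun g := comap (Homeomorph.mulRight g)
  map_one' := by ext f x; simp [comap_apply]
  map_mul' a b := by ext f x; simp [comap_apply, mul_assoc]

@[simp] lemma left_apply (g : G) (f : CompactFun k G) (x : G) :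
    (left k G g f).1 x = f.1 (g⁻¹ * x) := rfl

@[simp] lemma right_apply (g : G) (f : CompactFun k G) (x : G) :
    (right k G g f).1 x = f.1 (x * g) := rfl

lemma left_right (g h : G) (f : CompactFun k G) :
    left k G g (right k G h f) = right k G h (left k G g f) := by
  ext x; simp [mul_assoc]

lemma isOpen_stab_left (f : CompactFun k G) : IsOpen {g : G | left k G g f = f} := by
  have hopen : IsOpen {z : G × G | f.1 (z.1⁻¹ * z.2) = f.1 z.2} := by
    have : IsLocallyConstant fun z : G × G => (f.1 (z.1⁻¹ * z.2), f.1 z.2) :=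
      (f.2.1.comp_continuous (f := fun z : G × G => z.1⁻¹ * z.2) (by fun_prop)).prodMk
        (f.2.1.comp_continuous (f := fun z : G × G => z.2) (by fun_prop))
    exact this {p | p.1 = p.2}
  obtain ⟨U, W, hU, -, h1U, hW, hUW⟩ := generalized_tube_lemma (s := {(1 : G)})
    (t := tsupport f.1) isCompact_singleton f.2.2 hopen (by
      rintro ⟨g, x⟩ ⟨hg, -⟩
      have hg : g = 1 := hg
      simp [hg])
  refine Subgroup.isOpen_of_mem_nhds (vecStab (left k G) f) (g := 1) ?_
  have hU1 : U ∈ nhds (1 : G) := hU.mem_nhds (h1U rfl)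
  have hU2 : (fun x : G => x⁻¹) ⁻¹' U ∈ nhds (1 : G) :=
    (hU.preimage continuous_inv).mem_nhds (by simpa using h1U rfl)
  filter_upwards [hU1, hU2] with g hg hg'
  show left k G g f = f
  ext x
  rw [left_apply]
  by_cases hx : x ∈ tsupport f.1
  · exact hUW (show (g, x) ∈ U ×ˢ W from ⟨hg, hW hx⟩)
  · rw [image_eq_zero_of_notMem_tsupport hx]
    by_contra h0
    have hy : g⁻¹ * x ∈ tsupport f.1 := subset_tsupport _ h0
    have h2 : f.1 (g⁻¹⁻¹ * (g⁻¹ * x)) = f.1 (g⁻¹ * x) :=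
      hUW (show (g⁻¹, g⁻¹ * x) ∈ U ×ˢ W from ⟨hg', hW hy⟩)
    rw [inv_inv, mul_inv_cancel_left] at h2
    exact h0 (by rw [← h2, image_eq_zero_of_notMem_tsupport hx])

lemma isOpen_stab_right (f : CompactFun k G) : IsOpen {g : G | right k G g f = f} := by
  have := isOpen_stab_map (left k G) (right k G) (comap (Homeomorph.inv G))
    (fun g f => by ext x; simp [comap_apply]) (isOpen_stab_left (comap (Homeomorph.inv G) f))
  rwa [show comap (Homeomorph.inv G) (comap (Homeomorph.inv G) f) = f by
    ext x; simp [comap_apply]] at this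

end CompactFun

variable {k G}

section Psi

variable (M : Rep.{u} k G)

/-- `Hom_{k[G]}(k(G), M)`, with respect to the left action of `G` on `k(G)`. -/
abbrev PsiV : Type u := (CompactFun.left k G).IntertwiningMap M.ρ

/-- The evaluation at an element of `k(G)`. -/
def psiEval (s : CompactFun k G) : PsiV M →ₗ[k] M.V where
  toFun f := f s
  map_add' _ _ := rfl
  map_smul' _ _ := rfl

/-- The locally constant function `g ↦ (f ↦ f(s g⁻¹))`, where `s g⁻¹` is `s` acted upon by `g`
by right translation. -/
def psiFun (s : CompactFun k G) : LocallyConstant G (PsiV M →ₗ[k] M.V) :=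
  (orbitMap (CompactFun.right k G) s (CompactFun.isOpen_stab_right s)).map (psiEval M)

lemma psiFun_apply (s : CompactFun k G) (g : G) (f : PsiV M) :
    psiFun M s g f = f (CompactFun.right k G g s) := rfl

/-- The contraaction `π(μ)(s) = ∫ dμ_g (s g⁻¹)` on `Hom_{k[G]}(k(G), M)`. -/
def psiAct : Meas k G (PsiV M) →ₗ[k] PsiV M where
  toFun μ :=
    { toFun := fun s => Meas.integral (psiFun M s) μ
      map_add' := fun s t => Meas.integral_add_fun _ _ _ (fun g => by
        ext f; simp [psiFun_apply]) μ
      map_smul' := fun a s => Meas.integral_smul_fun a _ _ (fun g => by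
        ext f; simp [psiFun_apply]) μ
      isIntertwining' := fun g => by
        ext s
        refine Meas.integral_comp (M.ρ g) (psiFun M s) _ (fun h => ?_) μ
        ext f
        simp only [psiFun_apply, LinearMap.comp_apply]
        rw [← CompactFun.left_right, f.isIntertwining] }
  map_add' μ ν := by
    apply Representation.IntertwiningMap.ext
    ext s
    exact Meas.integral_add _ μ ν
  map_smul' a μ := by
    apply Representation.IntertwiningMap.ext
    ext s
    exact Meas.integral_smul _ a μ

lemma psiAct_apply (μ : Meas k G (PsiV M)) (s : CompactFun k G) :
    psiAct M μ s = Meas.integral (psiFun M s) μ := rfl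

/-- The `G`-contramodule `Ψ_G(M) = Hom_{k[G]}(k(G), M)`. -/
def psiObj : GContra k G where
  V := PsiV M
  act := psiAct M
  act_assoc μ := by
    apply Representation.IntertwiningMap.ext
    ext s
    show Meas.integral (psiFun M s) (Meas.push (mulMap G) μ) =
      Meas.integral (psiFun M s) (Meas.map (psiAct M) (Meas.curry μ))
    let F : LocallyConstant (G × G) (PsiV M →ₗ[k] M.V) :=
      ⟨fun z => psiFun M s (z.1 * z.2),
        (psiFun M s).isLocallyConstant.comp_continuous (mulMap G).continuous⟩
    let F' : LocallyConstant G (Meas k G (PsiV M) →ₗ[k] M.V) :=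
      (psiFun M s).map fun T => T ∘ₗ psiAct M
    rw [Meas.integral_push (mulMap G) (psiFun M s) F (fun _ => rfl),
      Meas.integral_map (psiAct M) (psiFun M s) F' (fun _ => rfl)]
    symm
    refine Meas.integral_curry (orbitMap (CompactFun.right k G) s (CompactFun.isOpen_stab_right s))
      (psiFun M) F (fun x y => ?_) F' (fun y => rfl) μ
    ext f
    show f (CompactFun.right k G (x * y) s) = f (CompactFun.right k G x (CompactFun.right k G y s))
    rw [map_mul, Module.End.mul_apply]
  act_unit f := by
    apply Representation.IntertwiningMap.ext
    ext s
    refine (Meas.integral_dirac (psiFun M s) 1 f).trans ?_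
    rw [psiFun_apply, map_one]
    rfl

variable {M} in
/-- The action of `Ψ_G` on morphisms. -/
def psiMap {N : Rep.{u} k G} (φ : M ⟶ N) : psiObj M ⟶ psiObj N where
  lin :=
    { toFun := fun f : PsiV M => (φ.hom.comp f : PsiV N)
      map_add' := fun f g => by
        apply Representation.IntertwiningMap.ext
        ext s
        exact map_add φ.hom.toLinearMap _ _
      map_smul' := fun a f => by
        apply Representation.IntertwiningMap.ext
        ext s
        exact map_smul φ.hom.toLinearMap _ _ }
  comm μ := by
    apply Representation.IntertwiningMap.ext
    ext s
    let F' : LocallyConstant G (PsiV M →ₗ[k] N.V) :=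
      (psiFun M s).map fun T => φ.hom.toLinearMap ∘ₗ T
    refine (Meas.integral_comp φ.hom.toLinearMap (psiFun M s) F' (fun _ => rfl) μ).symm.trans ?_
    exact (Meas.integral_map _ (psiFun N s) F' (fun _ => rfl) μ).symm

end Psi

variable (k G) in
/-- The functor `Ψ_G = Hom_{k[G]}(k(G), -)` from smooth `G`-modules to `G`-contramodules. -/
def Psi : GSmooth k G ⥤ GContra k G where
  obj M := psiObj M.obj
  map φ := psiMap φ.hom
  map_id _ := rfl
  map_comp _ _ := rfl

instance : (Psi k G).Additive where
  map_add := rfl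

section Phi

variable (P : GContra k G)

/-- The locally constant function `g ↦ (p ↦ s g⁻¹ ⊗ p)`, where `s g⁻¹` is `s` acted upon by `g`
by right translation. -/
def phiFun (s : CompactFun k G) : LocallyConstant G (P.V →ₗ[k] CompactFun k G ⊗[k] P.V) :=
  (orbitMap (CompactFun.right k G) s (CompactFun.isOpen_stab_right s)).map
    (TensorProduct.mk k (CompactFun k G) P.V)

lemma phiFun_apply (s : CompactFun k G) (g : G) (p : P.V) :
    phiFun P s g p = CompactFun.right k G g s ⊗ₜ p := rfl

/-- The image of the difference of the two maps `k(G) ⊗ P[[G]] ⇉ k(G) ⊗ P`,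
`s ⊗ μ ↦ s ⊗ π(μ)` and `s ⊗ μ ↦ ∫ s g⁻¹ ⊗ dμ_g`. -/
def phiRel : Submodule k (CompactFun k G ⊗[k] P.V) :=
  Submodule.span k {x | ∃ (s : CompactFun k G) (μ : Meas k G P.V),
    x = s ⊗ₜ P.act μ - Meas.integral (phiFun P s) μ}

/-- The contratensor product of `k(G)`, with the right translation action, and `P`. -/
abbrev PhiV : Type u := (CompactFun k G ⊗[k] P.V) ⧸ phiRel P

lemma phiRel_le_left (g : G) :
    phiRel P ≤ (phiRel P).comap ((CompactFun.left k G g).rTensor P.V) := by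
  refine Submodule.span_le.2 ?_
  rintro _ ⟨s, μ, rfl⟩
  refine Submodule.subset_span ⟨CompactFun.left k G g s, μ, ?_⟩
  rw [map_sub, LinearMap.rTensor_tmul]
  congr 1
  refine (Meas.integral_comp _ (phiFun P s) _ (fun h => ?_) μ).symm
  ext p
  simp only [phiFun_apply, LinearMap.comp_apply, LinearMap.rTensor_tmul, CompactFun.left_right]

/-- The action of `G` on the contratensor product induced by the left action on `k(G)`. -/
def phiRep : Representation k G (PhiV P) where
  toFun g := (phiRel P).mapQ (phiRel P) ((CompactFun.left k G g).rTensor P.V) (phiRel_le_left P g)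
  map_one' := by
    apply Submodule.linearMap_qext
    ext s p
    simp
  map_mul' a b := by
    apply Submodule.linearMap_qext
    ext s p
    simp

lemma phiRep_mk (g : G) (s : CompactFun k G) (p : P.V) :
    phiRep P g ((phiRel P).mkQ (s ⊗ₜ p)) = (phiRel P).mkQ (CompactFun.left k G g s ⊗ₜ p) := rfl

lemma isSmooth_phiRep : IsSmoothRep (phiRep P) := by
  intro v
  obtain ⟨t, rfl⟩ := (phiRel P).mkQ_surjective v
  induction t using TensorProduct.induction_on with
  | zero => simp
  | tmul s p =>
    exact isOpen_stab_map (CompactFun.left k G) (phiRep P) (fun s => (phiRel P).mkQ (s ⊗ₜ p))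
      (fun g s => rfl) (CompactFun.isOpen_stab_left s)
  | add x y hx hy =>
    rw [map_add]
    exact isOpen_stab_add _ hx hy

/-- The smooth `G`-module `Φ_G(P)`. -/
def phiObj : GSmooth k G := ⟨Rep.of (phiRep P), isSmooth_phiRep P⟩

variable {P} in
lemma phiRel_le_map {Q : GContra k G} (f : P ⟶ Q) :
    phiRel P ≤ (phiRel Q).comap (f.lin.lTensor (CompactFun k G)) := by
  refine Submodule.span_le.2 ?_
  rintro _ ⟨s, μ, rfl⟩
  refine Submodule.subset_span ⟨s, Meas.map f.lin μ, ?_⟩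
  rw [map_sub, LinearMap.lTensor_tmul, f.comm]
  congr 1
  let F' : LocallyConstant G (P.V →ₗ[k] CompactFun k G ⊗[k] Q.V) :=
    (phiFun P s).map fun T => f.lin.lTensor (CompactFun k G) ∘ₗ T
  refine (Meas.integral_comp _ (phiFun P s) F' (fun _ => rfl) μ).symm.trans ?_
  exact (Meas.integral_map _ (phiFun Q s) F' (fun _ => rfl) μ).symm

variable {P} in
/-- The action of `Φ_G` on morphisms. -/
def phiMap {Q : GContra k G} (f : P ⟶ Q) : phiObj P ⟶ phiObj Q :=
  ObjectProperty.homMk (Rep.ofHom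
    { toLinearMap :=
        (phiRel P).mapQ (phiRel Q) (f.lin.lTensor (CompactFun k G)) (phiRel_le_map f)
      isIntertwining' := fun g => by
        apply Submodule.linearMap_qext
        ext s p
        rfl })

end Phi

lemma gsmooth_hom_ext {P : GContra k G} {M : GSmooth k G} {f g : phiObj P ⟶ M}
    (h : ∀ s p, f.hom.hom ((phiRel P).mkQ (s ⊗ₜ p)) = g.hom.hom ((phiRel P).mkQ (s ⊗ₜ p))) :
    f = g := by
  apply ObjectProperty.hom_ext
  apply Rep.hom_ext
  apply Representation.IntertwiningMap.ext
  apply Submodule.linearMap_qext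
  ext s p
  exact h s p

variable (k G) in
/-- The functor `Φ_G` from `G`-contramodules to smooth `G`-modules, the contratensor product
with `k(G)`. -/
def Phi : GContra k G ⥤ GSmooth k G where
  obj P := phiObj P
  map f := phiMap f
  map_id _ := gsmooth_hom_ext fun _ _ => rfl
  map_comp _ _ := gsmooth_hom_ext fun _ _ => rfl

instance : (Phi k G).Additive where
  map_add {P Q f g} := gsmooth_hom_ext fun s p => by
    show (phiRel Q).mkQ (s ⊗ₜ (f.lin p + g.lin p)) =
      (phiRel Q).mkQ (s ⊗ₜ f.lin p) + (phiRel Q).mkQ (s ⊗ₜ g.lin p)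
    rw [TensorProduct.tmul_add, map_add]

/-- The adjunction bijection, from left to right: `f ↦ (p ↦ (s ↦ f(s ⊗ p)))`. -/
def adjTo {P : GContra k G} {M : GSmooth k G} (f : phiObj P ⟶ M) : P ⟶ psiObj M.obj where
  lin :=
    { toFun := fun p =>
        { toLinearMap := f.hom.hom.toLinearMap ∘ₗ (phiRel P).mkQ ∘ₗ
            (TensorProduct.mk k (CompactFun k G) P.V).flip p
          isIntertwining' := fun g => by
            ext s
            exact Rep.hom_comm_apply f.hom g ((phiRel P).mkQ (s ⊗ₜ p)) }
      map_add' := fun p q => by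
        apply Representation.IntertwiningMap.ext
        ext s
        exact (congrArg (fun t => f.hom.hom ((phiRel P).mkQ t)) (TensorProduct.tmul_add s p q)).trans
          (map_add (f.hom.hom.toLinearMap ∘ₗ (phiRel P).mkQ) _ _)
      map_smul' := fun a p => by
        apply Representation.IntertwiningMap.ext
        ext s
        exact (congrArg (fun t => f.hom.hom ((phiRel P).mkQ t)) (TensorProduct.tmul_smul a s p)).trans
          (map_smul (f.hom.hom.toLinearMap ∘ₗ (phiRel P).mkQ) _ _) }
  comm μ := by
    apply Representation.IntertwiningMap.ext
    ext s
    have h : (phiRel P).mkQ (s ⊗ₜ P.act μ) = (phiRel P).mkQ (Meas.integral (phiFun P s) μ) := by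
      rw [← sub_eq_zero, ← map_sub]
      exact (Submodule.Quotient.mk_eq_zero _).2 (Submodule.subset_span ⟨s, μ, rfl⟩)
    let L : CompactFun k G ⊗[k] P.V →ₗ[k] M.obj.V := f.hom.hom.toLinearMap ∘ₗ (phiRel P).mkQ
    let F' : LocallyConstant G (P.V →ₗ[k] M.obj.V) := (phiFun P s).map fun T => L ∘ₗ T
    refine (congrArg f.hom.hom h).trans ?_
    refine (Meas.integral_comp L (phiFun P s) F' (fun _ => rfl) μ).symm.trans ?_
    exact (Meas.integral_map _ (psiFun M.obj s) F' (fun _ => rfl) μ).symm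

/-- The adjunction bijection, from right to left. -/
def adjInv {P : GContra k G} {M : GSmooth k G} (f : P ⟶ psiObj M.obj) : phiObj P ⟶ M :=
  let f' : P.V →ₗ[k] PsiV M.obj := f.lin
  let L : CompactFun k G ⊗[k] P.V →ₗ[k] M.obj.V := TensorProduct.lift
    (LinearMap.mk₂ k (fun s p => f' p s) (fun s t p => map_add (f' p) s t)
      (fun a s p => map_smul (f' p) a s) (fun s p q => by rw [map_add]; rfl)
      (fun a s p => by rw [map_smul]; rfl))
  ObjectProperty.homMk (Rep.ofHom
    { toLinearMap := (phiRel P).liftQ L (by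
        refine Submodule.span_le.2 ?_
        rintro _ ⟨s, μ, rfl⟩
        show L _ = 0
        rw [map_sub, sub_eq_zero]
        let F' : LocallyConstant G (P.V →ₗ[k] M.obj.V) := (phiFun P s).map fun T => L ∘ₗ T
        rw [← Meas.integral_comp L (phiFun P s) F' (fun _ => rfl) μ]
        have h : f' (P.act μ) = psiAct M.obj (Meas.map f' μ) := f.comm μ
        refine (congrArg (fun l : PsiV M.obj => l s) h).trans ?_
        exact Meas.integral_map _ (psiFun M.obj s) F' (fun _ => rfl) μ)
      isIntertwining' := fun g => by
        apply Submodule.linearMap_qext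
        ext s p
        exact Representation.IntertwiningMap.isIntertwining _ _ (f' p) g s })

variable (k G) in
/-- The functor `Φ_G` is left adjoint to `Ψ_G`. -/
def phiPsiAdjunction : Phi k G ⊣ Psi k G :=
  Adjunction.mkOfHomEquiv
    { homEquiv := fun P M =>
        { toFun := fun f => adjTo (M := M) f
          invFun := fun f => adjInv (M := M) f
          left_inv := fun _ => gsmooth_hom_ext fun _ _ => rfl
          right_inv := fun _ => rfl }
      homEquiv_naturality_left_symm := fun _ _ => gsmooth_hom_ext fun _ _ => rfl
      homEquiv_naturality_right := fun _ _ => rfl }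

end Functors

/-! ### Bounded and unbounded derived categories, and derived functors -/

/-- The symbols `b`, `+`, `-` and the empty symbol. -/
inductive DerivedSymbol
  | bounded
  | plus
  | minus
  | unbounded

section Derived

variable (A : Type*) [Category* A] [Abelian A] (B : Type*) [Category* B] [Abelian B]

/-- The boundedness condition on cochain complexes that corresponds to a derived
category symbol. -/
def starComplex : DerivedSymbol → ObjectProperty (CochainComplex A ℤ)
  | .bounded => fun K => (∃ n : ℤ, K.IsStrictlyGE n) ∧ ∃ n : ℤ, K.IsStrictlyLE n
  | .plus => fun K => ∃ n : ℤ, K.IsStrictlyGE n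
  | .minus => fun K => ∃ n : ℤ, K.IsStrictlyLE n
  | .unbounded => fun _ => True

lemma starComplex_shift (s : DerivedSymbol) (K : CochainComplex A ℤ) (a : ℤ)
    (h : starComplex A s K) : starComplex A s (K⟦a⟧) := by
  have hge : (∃ n : ℤ, K.IsStrictlyGE n) → ∃ n : ℤ, (K⟦a⟧).IsStrictlyGE n :=
    fun ⟨n, _⟩ => ⟨n - a, K.isStrictlyGE_shift n a (n - a) (by lia)⟩
  have hle : (∃ n : ℤ, K.IsStrictlyLE n) → ∃ n : ℤ, (K⟦a⟧).IsStrictlyLE n :=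
    fun ⟨n, _⟩ => ⟨n - a, K.isStrictlyLE_shift n a (n - a) (by lia)⟩
  cases s with
  | bounded => exact ⟨hge h.1, hle h.2⟩
  | plus => exact hge h
  | minus => exact hle h
  | unbounded => trivial

/-- The objects of the homotopy category given by complexes satisfying the boundedness
condition. -/
def starK (s : DerivedSymbol) : ObjectProperty (HomotopyCategory A (.up ℤ)) :=
  fun X => starComplex A s X.as

instance (s : DerivedSymbol) : (starK A s).IsStableUnderShift ℤ where
  isStableUnderShiftBy a := ⟨fun X hX => by
    obtain ⟨K : CochainComplex A ℤ, rfl⟩ := HomotopyCategory.quotient_obj_surjective X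
    rw [ObjectProperty.prop_shift_iff, HomotopyCategory.shift_quotient_obj]
    exact starComplex_shift A s K a hX⟩

/-- The homotopy category `K^⋆(A)`. -/
abbrev StarHomotopyCat (s : DerivedSymbol) := (starK A s).FullSubcategory

/-- The objects of the derived category whose cohomology satisfies the boundedness condition. -/
def starD [HasDerivedCategory A] : DerivedSymbol → ObjectProperty (DerivedCategory A)
  | .bounded => DerivedCategory.TStructure.t.bounded
  | .plus => DerivedCategory.TStructure.t.plus
  | .minus => DerivedCategory.TStructure.t.minus
  | .unbounded => ⊤

instance [HasDerivedCategory A] (s : DerivedSymbol) : (starD A s).IsTriangulated := by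
  cases s
  · exact inferInstanceAs (DerivedCategory.TStructure.t (C := A)).bounded.IsTriangulated
  · exact inferInstanceAs (DerivedCategory.TStructure.t (C := A)).plus.IsTriangulated
  · exact inferInstanceAs (DerivedCategory.TStructure.t (C := A)).minus.IsTriangulated
  · show (⊤ : ObjectProperty (DerivedCategory A)).IsTriangulated
    exact { toIsStableUnderShift := inferInstanceAs ((⊤ : ObjectProperty (DerivedCategory A)).IsStableUnderShift ℤ)
            toContainsZero := inferInstanceAs ((⊤ : ObjectProperty (DerivedCategory A)).ContainsZero)
            toIsTriangulatedClosed₂ := .mk' fun _ _ _ _ => trivial }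

/-- The derived category `D^⋆(A)`, a triangulated category. -/
abbrev StarDerivedCat [HasDerivedCategory A] (s : DerivedSymbol) := (starD A s).FullSubcategory

lemma starD_Qh [HasDerivedCategory A] (s : DerivedSymbol) (X : StarHomotopyCat A s) :
    starD A s (DerivedCategory.Qh.obj X.obj) := by
  obtain ⟨X, hK⟩ := X
  obtain ⟨K : CochainComplex A ℤ, rfl⟩ := HomotopyCategory.quotient_obj_surjective X
  replace hK : starComplex A s K := hK
  have hge : (∃ n : ℤ, K.IsStrictlyGE n) → DerivedCategory.TStructure.t.plus
      (DerivedCategory.Q.obj K) := fun ⟨n, _⟩ => ⟨n, inferInstance⟩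
  have hle : (∃ n : ℤ, K.IsStrictlyLE n) → DerivedCategory.TStructure.t.minus
      (DerivedCategory.Q.obj K) := fun ⟨n, _⟩ => ⟨n, inferInstance⟩
  let e : DerivedCategory.Q.obj K ≅ DerivedCategory.Qh.obj
      ((HomotopyCategory.quotient A (.up ℤ)).obj K) :=
    ((DerivedCategory.quotientCompQhIso A).app K).symm
  cases s with
  | bounded => exact ⟨ObjectProperty.prop_of_iso _ e (hge hK.1),
      ObjectProperty.prop_of_iso _ e (hle hK.2)⟩
  | plus => exact ObjectProperty.prop_of_iso DerivedCategory.TStructure.t.plus e (hge hK)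
  | minus => exact ObjectProperty.prop_of_iso DerivedCategory.TStructure.t.minus e (hle hK)
  | unbounded => trivial

/-- The localization functor `K^⋆(A) ⥤ D^⋆(A)`. -/
def starQ [HasDerivedCategory A] (s : DerivedSymbol) : StarHomotopyCat A s ⥤ StarDerivedCat A s :=
  (starD A s).lift ((starK A s).ι ⋙ DerivedCategory.Qh) (starD_Qh A s)

instance [HasDerivedCategory A] (s : DerivedSymbol) : (starQ A s).CommShift ℤ :=
  inferInstanceAs (((starD A s).lift ((starK A s).ι ⋙ DerivedCategory.Qh) _).CommShift ℤ)

variable {A B}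

lemma starComplex_map (F : A ⥤ B) [F.Additive] (s : DerivedSymbol) (K : CochainComplex A ℤ)
    (h : starComplex A s K) : starComplex B s ((F.mapHomologicalComplex _).obj K) := by
  have hge : (∃ n : ℤ, K.IsStrictlyGE n) →
      ∃ n : ℤ, CochainComplex.IsStrictlyGE ((F.mapHomologicalComplex _).obj K) n :=
    fun ⟨n, _⟩ => ⟨n, inferInstance⟩
  have hle : (∃ n : ℤ, K.IsStrictlyLE n) →
      ∃ n : ℤ, CochainComplex.IsStrictlyLE ((F.mapHomologicalComplex _).obj K) n :=
    fun ⟨n, _⟩ => ⟨n, inferInstance⟩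
  cases s with
  | bounded => exact ⟨hge h.1, hle h.2⟩
  | plus => exact hge h
  | minus => exact hle h
  | unbounded => trivial

lemma starK_map (F : A ⥤ B) [F.Additive] (s : DerivedSymbol) (X : StarHomotopyCat A s) :
    starK B s (((starK A s).ι ⋙ F.mapHomotopyCategory (.up ℤ)).obj X) :=
  starComplex_map F s X.obj.as X.property

/-- The functor `K^⋆(A) ⥤ K^⋆(B)` induced by an additive functor `A ⥤ B`. -/
def starMap (F : A ⥤ B) [F.Additive] (s : DerivedSymbol) :
    StarHomotopyCat A s ⥤ StarHomotopyCat B s :=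
  (starK B s).lift ((starK A s).ι ⋙ F.mapHomotopyCategory (.up ℤ)) (starK_map F s)

instance (F : A ⥤ B) [F.Additive] (s : DerivedSymbol) : (starMap F s).CommShift ℤ :=
  inferInstanceAs (((starK B s).lift
    ((starK A s).ι ⋙ F.mapHomotopyCategory (.up ℤ)) (starK_map F s)).CommShift ℤ)

variable [HasDerivedCategory A] [HasDerivedCategory B]

/-- `RF : D^⋆(A) ⥤ D^⋆(B)`, with its structure of a functor commuting with shifts, is
a (triangulated) right derived functor of the additive functor `F : A ⥤ B`: it is triangulated
and it is equipped with a natural transformation `Q ∘ F ⟶ RF ∘ Q` of functors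
`K^⋆(A) ⥤ D^⋆(B)` which commutes with shifts and is universal
among the natural transformations from `Q ∘ F` to functors of the form `H ∘ Q`. -/
structure IsRightDerived (F : A ⥤ B) [F.Additive] (s : DerivedSymbol)
    (RF : StarDerivedCat A s ⥤ StarDerivedCat B s) [RF.CommShift ℤ] : Prop where
  isTriangulated : RF.IsTriangulated
  exists_unit : ∃ α : starMap F s ⋙ starQ B s ⟶ starQ A s ⋙ RF,
    NatTrans.CommShift α ℤ ∧ RF.IsLeftKanExtension α

/-- `LF : D^⋆(A) ⥤ D^⋆(B)`, with its structure of a functor commuting with shifts, is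
a (triangulated) left derived functor of the additive functor `F : A ⥤ B`: it is triangulated
and it is equipped with a natural transformation `LF ∘ Q ⟶ Q ∘ F` of functors
`K^⋆(A) ⥤ D^⋆(B)` which commutes with shifts and is universal
among the natural transformations from functors of the form `H ∘ Q` to `Q ∘ F`. -/
structure IsLeftDerived (F : A ⥤ B) [F.Additive] (s : DerivedSymbol)
    (LF : StarDerivedCat A s ⥤ StarDerivedCat B s) [LF.CommShift ℤ] : Prop where
  isTriangulated : LF.IsTriangulated
  exists_counit : ∃ α : starQ A s ⋙ LF ⟶ starMap F s ⋙ starQ B s,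
    NatTrans.CommShift α ℤ ∧ LF.IsRightKanExtension α

end Derived

/-- The `k`-cohomological dimension of a profinite group `H` is finite: the abelian category of
discrete `H`-modules over `k` has finite homological dimension. -/
def FiniteCohDim (k H : Type u) [Field k] [Group H] [TopologicalSpace H]
    [IsTopologicalGroup H] : Prop :=
  ∃ n : ℕ, ∀ M : GSmooth k H, HasInjectiveDimensionLE M n

end

/-! ### Triangulated structure on K^⋆(A) and representatives of objects of D^⋆(A) -/

section StarTriangulated

open Limits Pretriangulated ZeroObject

variable {A : Type*} [Category* A] [Abelian A]

/-! Fix a compact open subgroup H whose discrete modules have homological dimension at most n. Call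
a smooth G-module adapted if it is injective over H, and a G-contramodule adapted if it is
projective over H. The theorem follows from three facts: Ψ and Φ restrict to mutually inverse
equivalences between the adapted classes, they are exact on short exact sequences of adapted
objects, and every object has an adapted resolution of length at most n.

Over the compact group H everything reduces to free objects. The coinduced modules of locally
constant functions H → V are injective, and every injective is a retract of one. Ψ takes such a
module to the free contramodule V[[H]] (`push_uncurry_toMeas`, `GContra.eq_fromFree`), which is
projective, and every projective is a retract of one. The counit at a coinduced module amounts to
the map k(H) ⊗ V → coind V, which is bijective (`isIso_counit_coind`). Retracts and the triangle
identity give the rest.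

The passage from H to G rests on k(G) being induced from k(H), on either side. Hence Ψ and Φ commute
with restriction to H (`isIso_psiRes`, `isIso_phiRes`), compatibly with unit and counit, and
invertibility and exactness over G can be checked over H, where short exact sequences of adapted
objects split. Enough adapted objects are provided by coinduced modules, which remain injective over
the open subgroup H, and by the contramodules Hom_k(coind k, P), which map onto P.

Finite homological dimension is given for modules only. It is carried to contramodules over H by the
functor Hom_k(-, P), which is exact and takes injectives to projectives
(`projective_homContra_coind`). So P = Hom_k(k, P) has projective dimension at most the injective
dimension of the trivial module k.

Derived categories enter through a formal argument (`exists_derived_equivalence_of_adapted`). The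
uniform bound n allows any complex, bounded or not, to be replaced by one with adapted terms after n
dimension shifts, and it forces the cycles of an acyclic complex of adapted objects to be adapted.
So D^⋆ is a localization of the adapted complexes, both functors preserve acyclicity there and
descend, and the equivalence of adapted classes descends with them. -/

lemma CochainComplex.isStrictlyLE_mappingCone {K L : CochainComplex A ℤ} (f : K ⟶ L)
    (n₁ n₂ n : ℤ) [K.IsStrictlyLE n₁] [L.IsStrictlyLE n₂] (hn₁ : n₁ ≤ n + 1) (hn₂ : n₂ ≤ n) :
    (mappingCone f).IsStrictlyLE n := by
  rw [isStrictlyLE_iff]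
  intro i hi
  simp only [mappingCone.isZero_X_iff]
  exact ⟨K.isZero_of_isStrictlyLE n₁ _, L.isZero_of_isStrictlyLE n₂ _⟩

lemma starComplex_mappingCone (s : DerivedSymbol) {K L : CochainComplex A ℤ} (f : K ⟶ L)
    (hK : starComplex A s K) (hL : starComplex A s L) :
    starComplex A s (CochainComplex.mappingCone f) := by
  have hge : (∃ n : ℤ, K.IsStrictlyGE n) → (∃ n : ℤ, L.IsStrictlyGE n) →
      ∃ n : ℤ, (CochainComplex.mappingCone f).IsStrictlyGE n :=
    fun ⟨n, _⟩ ⟨m, _⟩ => ⟨min (n - 1) m, CochainComplex.isStrictlyGE_mappingCone f n m _⟩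
  have hle : (∃ n : ℤ, K.IsStrictlyLE n) → (∃ n : ℤ, L.IsStrictlyLE n) →
      ∃ n : ℤ, (CochainComplex.mappingCone f).IsStrictlyLE n :=
    fun ⟨n, _⟩ ⟨m, _⟩ => ⟨max n m, CochainComplex.isStrictlyLE_mappingCone f n m _
      (by have := le_max_left n m; lia) (le_max_right n m)⟩
  cases s with
  | bounded => exact ⟨hge hK.1 hL.1, hle hK.2 hL.2⟩
  | plus => exact hge hK hL
  | minus => exact hle hK hL
  | unbounded => trivial

/-- Boundedness depends only on which terms vanish. Constructions made term by term preserve it as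
long as zero terms are resolved by zero. -/
lemma starComplex_of_isZero (s : DerivedSymbol) {K L : CochainComplex A ℤ}
    (h : ∀ n, IsZero (K.X n) → IsZero (L.X n)) (hK : starComplex A s K) :
    starComplex A s L := by
  have hge : (∃ n : ℤ, K.IsStrictlyGE n) → ∃ n : ℤ, L.IsStrictlyGE n :=
    fun ⟨n, _⟩ => ⟨n, (L.isStrictlyGE_iff n).2
      fun i hi => h i (K.isZero_of_isStrictlyGE n i)⟩
  have hle : (∃ n : ℤ, K.IsStrictlyLE n) → ∃ n : ℤ, L.IsStrictlyLE n :=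
    fun ⟨n, _⟩ => ⟨n, (L.isStrictlyLE_iff n).2
      fun i hi => h i (K.isZero_of_isStrictlyLE n i)⟩
  cases s with
  | bounded => exact ⟨hge hK.1, hle hK.2⟩
  | plus => exact hge hK
  | minus => exact hle hK
  | unbounded => trivial

/-- The first morphism lifts to a chain map, and two distinguished triangles on one morphism have
isomorphic third vertices. Conditions on terms are not invariant under homotopy equivalence, so
closure under cones is checked on this representative. -/
lemma HomotopyCategory.exists_iso_mappingCone
    {T : Triangle (HomotopyCategory A (.up ℤ))} (hT : T ∈ distTriang _) :
    ∃ f : T.obj₁.as ⟶ T.obj₂.as, Nonempty (T.obj₃ ≅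
      (HomotopyCategory.quotient A (.up ℤ)).obj (CochainComplex.mappingCone f)) := by
  obtain ⟨f : T.obj₁.as ⟶ T.obj₂.as, hf⟩ :=
    (HomotopyCategory.quotient A (.up ℤ)).map_surjective T.mor₁
  exact ⟨f, ⟨Triangle.π₃.mapIso (isoTriangleOfIso₁₂ T _ hT (mappingCone_triangleh_distinguished f)
    (Iso.refl _) (Iso.refl _)
    ((Category.comp_id _).trans (hf.symm.trans (Category.id_comp _).symm)))⟩⟩

instance (s : DerivedSymbol) : (starK A s).IsTriangulatedClosed₃ where
  ext₃' T hT h₁ h₂ := by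
    obtain ⟨f, ⟨e⟩⟩ := HomotopyCategory.exists_iso_mappingCone hT
    exact ⟨_, starComplex_mappingCone s f h₁ h₂, ⟨e⟩⟩

instance (s : DerivedSymbol) : (starK A s).ContainsZero where
  exists_zero := ⟨(HomotopyCategory.quotient A (.up ℤ)).obj 0,
    Functor.map_isZero _ (isZero_zero _), by
      have hge : ∃ n : ℤ, (0 : CochainComplex A ℤ).IsStrictlyGE n := ⟨0, inferInstance⟩
      have hle : ∃ n : ℤ, (0 : CochainComplex A ℤ).IsStrictlyLE n := ⟨0, inferInstance⟩
      cases s with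
      | bounded => exact ⟨hge, hle⟩
      | plus => exact hge
      | minus => exact hle
      | unbounded => trivial⟩

instance (s : DerivedSymbol) : (starK A s).IsTriangulated where
  toIsTriangulatedClosed₂ := .of_isTriangulatedClosed₃

variable (A) in
/-- The acyclic complexes in the homotopy category `K^⋆(A)`. -/
abbrev starAcyclic (s : DerivedSymbol) : ObjectProperty (StarHomotopyCat A s) :=
  (HomotopyCategory.subcategoryAcyclic A).inverseImage (starK A s).ι

lemma starAcyclic_trW_iff (s : DerivedSymbol) {X Y : StarHomotopyCat A s} (f : X ⟶ Y) :
    (starAcyclic A s).trW f ↔ HomotopyCategory.quasiIso A (.up ℤ) f.hom := by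
  rw [HomotopyCategory.quasiIso_eq_trW_subcategoryAcyclic]
  exact ObjectProperty.inverseImage_trW_iff _ _ f


variable [HasDerivedCategory A]

instance (s : DerivedSymbol) : (starQ A s).IsTriangulated :=
  inferInstanceAs (((starD A s).lift ((starK A s).ι ⋙ DerivedCategory.Qh) _).IsTriangulated)

instance (s : DerivedSymbol) : (starQ A s).EssSurj where
  mem_essImage := by
    rintro ⟨X, hX⟩
    suffices h : ∃ (K : CochainComplex A ℤ) (_ : starComplex A s K),
        Nonempty (DerivedCategory.Q.obj K ≅ X) by
      obtain ⟨K, hK, ⟨e⟩⟩ := h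
      exact ⟨⟨(HomotopyCategory.quotient A (.up ℤ)).obj K, hK⟩,
        ⟨(starD A s).ι.preimageIso ((DerivedCategory.quotientCompQhIso A).app K ≪≫ e)⟩⟩
    cases s with
    | unbounded => exact ⟨_, trivial, ⟨DerivedCategory.Q.objObjPreimageIso X⟩⟩
    | plus =>
      obtain ⟨n, K, e, h⟩ := hX
      exact ⟨K, ⟨n, h⟩, ⟨e.symm⟩⟩
    | minus =>
      obtain ⟨n, K, e, h⟩ := hX
      exact ⟨K, ⟨n, h⟩, ⟨e.symm⟩⟩
    | bounded =>
      obtain ⟨⟨n, hn⟩, ⟨m, hm⟩⟩ := hX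
      have := hn.ge
      have := hm.le
      obtain ⟨K, _, _, ⟨e⟩⟩ := DerivedCategory.exists_iso_Q_obj_of_isGE_of_isLE X n m
      exact ⟨K, ⟨⟨n, inferInstance⟩, ⟨m, inferInstance⟩⟩, ⟨e.symm⟩⟩


end StarTriangulated

/-! ### D^⋆(A) as the localization of K^⋆(A) at the quasi-isomorphisms -/

section StarLocalization

open Limits Pretriangulated ZeroObject

variable {A : Type*} [Category* A] [Abelian A]

/-- A map from an acyclic K to a complex in degrees ≥ n factors through the truncation of K in
degrees ≥ n, which is acyclic and bounded below. This condition makes the quotient of K^+ by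
acyclics embed fully faithfully in D(A). -/
instance : (starK A .plus).IsVerdierRightLocalizing
    (HomotopyCategory.subcategoryAcyclic A) where
  fac {K L} φ hK hL := by
    obtain ⟨K : CochainComplex _ _, rfl⟩ := HomotopyCategory.quotient_obj_surjective K
    obtain ⟨L : CochainComplex _ _, rfl⟩ := HomotopyCategory.quotient_obj_surjective L
    obtain ⟨n, hn : L.IsStrictlyGE n⟩ := hL
    obtain ⟨φ, rfl⟩ := (HomotopyCategory.quotient _ _).map_surjective φ
    rw [HomotopyCategory.quotient_obj_mem_subcategoryAcyclic_iff_acyclic] at hK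
    refine ⟨(HomotopyCategory.quotient _ _).obj (K.truncGE n),
      (HomotopyCategory.quotient _ _).map (K.πTruncGE n),
      (HomotopyCategory.quotient _ _).map (CochainComplex.truncGEMap φ n ≫ inv (L.πTruncGE n)),
      ⟨n, inferInstanceAs ((K.truncGE n).IsStrictlyGE n)⟩, ?_, by simp [← Functor.map_comp]⟩
    rw [HomotopyCategory.quotient_obj_mem_subcategoryAcyclic_iff_acyclic]
    exact hK.truncGE _

instance : (starK A .minus).IsVerdierLeftLocalizing
    (HomotopyCategory.subcategoryAcyclic A) where
  fac {K L} φ hK hL := by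
    obtain ⟨K : CochainComplex _ _, rfl⟩ := HomotopyCategory.quotient_obj_surjective K
    obtain ⟨L : CochainComplex _ _, rfl⟩ := HomotopyCategory.quotient_obj_surjective L
    obtain ⟨n, hn : K.IsStrictlyLE n⟩ := hK
    obtain ⟨φ, rfl⟩ := (HomotopyCategory.quotient _ _).map_surjective φ
    rw [HomotopyCategory.quotient_obj_mem_subcategoryAcyclic_iff_acyclic] at hL
    refine ⟨(HomotopyCategory.quotient _ _).obj (L.truncLE n),
      (HomotopyCategory.quotient _ _).map (inv (K.ιTruncLE n) ≫ CochainComplex.truncLEMap φ n),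
      (HomotopyCategory.quotient _ _).map (L.ιTruncLE n),
      ⟨n, inferInstanceAs ((L.truncLE n).IsStrictlyLE n)⟩, ?_, by simp [← Functor.map_comp]⟩
    rw [HomotopyCategory.quotient_obj_mem_subcategoryAcyclic_iff_acyclic]
    exact hL.truncLE _

instance : (starK A .unbounded).IsVerdierLeftLocalizing
    (HomotopyCategory.subcategoryAcyclic A) where
  fac φ _ hL := ⟨_, φ, 𝟙 _, trivial, hL, Category.comp_id _⟩

variable (A) in
/-- The bounded complexes among the bounded above ones. -/
abbrev starKBoundedOfMinus : ObjectProperty (StarHomotopyCat A .minus) :=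
  (starK A .plus).inverseImage (starK A .minus).ι

instance : (starKBoundedOfMinus A).IsStableUnderShift ℤ where
  isStableUnderShiftBy a := ⟨fun X hX => by
    rw [ObjectProperty.prop_shift_iff]
    with_unfolding_all exact (starK A .plus).le_shift a _ hX⟩

instance : (starKBoundedOfMinus A).ContainsZero where
  exists_zero := by
    obtain ⟨Z, hZ, h⟩ := (starK A .bounded).exists_prop_of_containsZero
    exact ⟨⟨Z, h.2⟩, IsZero.of_full_of_faithful_of_isZero (starK A .minus).ι _ hZ, h.1⟩

instance : (starKBoundedOfMinus A).IsTriangulatedClosed₃ where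
  ext₃' T hT h₁ h₂ := by
    obtain ⟨f, ⟨e⟩⟩ := HomotopyCategory.exists_iso_mappingCone
      ((starK A .minus).ι.map_distinguished T hT)
    exact ⟨⟨_, starComplex_mappingCone .minus f T.obj₁.property T.obj₂.property⟩,
      starComplex_mappingCone .plus f h₁ h₂, ⟨(starK A .minus).ι.preimageIso e⟩⟩

instance : (starKBoundedOfMinus A).IsTriangulated where
  toIsTriangulatedClosed₂ := .of_isTriangulatedClosed₃

/-- Bounded complexes are reached in two steps, K^b in K^- and K^- in K, since each truncation takes
care of one bound. The lower truncation of a bounded above complex is still bounded above, so it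
stays in K^-. -/
instance : (starKBoundedOfMinus A).IsVerdierRightLocalizing (starAcyclic A .minus) where
  fac {K L} φ hK hL := by
    obtain ⟨K, hKm⟩ := K
    obtain ⟨L, hLm⟩ := L
    obtain ⟨K : CochainComplex _ _, rfl⟩ := HomotopyCategory.quotient_obj_surjective K
    obtain ⟨L : CochainComplex _ _, rfl⟩ := HomotopyCategory.quotient_obj_surjective L
    obtain ⟨n, hn : L.IsStrictlyGE n⟩ := hL
    obtain ⟨m, hm : K.IsStrictlyLE m⟩ := hKm
    obtain ⟨φ, rfl⟩ := (starK A .minus).homMk_surjective φ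
    obtain ⟨φ, rfl⟩ := (HomotopyCategory.quotient _ _).map_surjective φ
    replace hK : HomotopyCategory.subcategoryAcyclic A
      ((HomotopyCategory.quotient _ _).obj K) := hK
    rw [HomotopyCategory.quotient_obj_mem_subcategoryAcyclic_iff_acyclic] at hK
    refine ⟨⟨(HomotopyCategory.quotient _ _).obj (K.truncGE n),
        ⟨m, inferInstanceAs ((K.truncGE n).IsStrictlyLE m)⟩⟩,
      ObjectProperty.homMk ((HomotopyCategory.quotient _ _).map (K.πTruncGE n)),
      ObjectProperty.homMk ((HomotopyCategory.quotient _ _).map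
        (CochainComplex.truncGEMap φ n ≫ inv (L.πTruncGE n))),
      ⟨n, inferInstanceAs ((K.truncGE n).IsStrictlyGE n)⟩, ?_, ?_⟩
    · show HomotopyCategory.subcategoryAcyclic A
        ((HomotopyCategory.quotient _ _).obj (K.truncGE n))
      rw [HomotopyCategory.quotient_obj_mem_subcategoryAcyclic_iff_acyclic]
      exact hK.truncGE _
    · ext
      show (HomotopyCategory.quotient _ _).map _ ≫ (HomotopyCategory.quotient _ _).map _ =
        (HomotopyCategory.quotient _ _).map φ
      simp [← Functor.map_comp]

variable [HasDerivedCategory A]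

/-- The functor between Verdier quotients is fully faithful by the factorization property, D^+ is
full in D(A), and `starQ` is essentially surjective; together these make `starQ` a localization. -/
instance : (starQ A .plus).IsLocalization (starAcyclic A .plus).trW :=
  ((starK A .plus).triangulatedLocalizerMorphism
    (HomotopyCategory.subcategoryAcyclic A)).isLocalization_of_isLocalizedFullyFaithful
      (L₁ := starQ A .plus) (L₂ := DerivedCategory.Qh) (F := (starD A .plus).ι) (Iso.refl _)

instance : (starQ A .minus).IsLocalization (starAcyclic A .minus).trW :=
  ((starK A .minus).triangulatedLocalizerMorphism
    (HomotopyCategory.subcategoryAcyclic A)).isLocalization_of_isLocalizedFullyFaithful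
      (L₁ := starQ A .minus) (L₂ := DerivedCategory.Qh) (F := (starD A .minus).ι) (Iso.refl _)

instance : (starQ A .unbounded).IsLocalization (starAcyclic A .unbounded).trW :=
  ((starK A .unbounded).triangulatedLocalizerMorphism
    (HomotopyCategory.subcategoryAcyclic A)).isLocalization_of_isLocalizedFullyFaithful
      (L₁ := starQ A .unbounded) (L₂ := DerivedCategory.Qh) (F := (starD A .unbounded).ι)
      (Iso.refl _)

variable (A) in
/-- The bounded complexes among the bounded above ones are the bounded complexes. -/
def starKBoundedOfMinusEquivalence :
    (starKBoundedOfMinus A).FullSubcategory ≌ StarHomotopyCat A .bounded where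
  functor := (starK A .bounded).lift ((starKBoundedOfMinus A).ι ⋙ (starK A .minus).ι)
    fun X => ⟨X.property, X.obj.property⟩
  inverse := (starKBoundedOfMinus A).lift ((starK A .minus).lift (starK A .bounded).ι
    fun X => X.property.2) fun X => X.property.1
  unitIso := Iso.refl _
  counitIso := Iso.refl _

/-- D^b is full in D^-, so the criterion applies to the bounded complexes inside K^-; the result is
then carried along the identification of that subcategory with K^b. -/
instance : (starQ A .bounded).IsLocalization (starAcyclic A .bounded).trW := by
  let E := starKBoundedOfMinusEquivalence A
  let L := E.functor ⋙ starQ A .bounded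
  let F : StarDerivedCat A .bounded ⥤ StarDerivedCat A .minus :=
    (starD A .minus).lift (starD A .bounded).ι fun X => X.property.2
  have : F.Faithful := ⟨fun h => ObjectProperty.hom_ext _ (congrArg (fun t => t.hom) h :)⟩
  have : F.Full := ⟨fun f => ⟨ObjectProperty.homMk f.hom, rfl⟩⟩
  have : L.IsLocalization ((starAcyclic A .minus).inverseImage (starKBoundedOfMinus A).ι).trW :=
    ((starKBoundedOfMinus A).triangulatedLocalizerMorphism
      (starAcyclic A .minus)).isLocalization_of_isLocalizedFullyFaithful
      (L₁ := L) (L₂ := starQ A .minus) (F := F) (Iso.refl _)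
  refine Functor.IsLocalization.of_equivalence_source L
    ((starAcyclic A .minus).inverseImage (starKBoundedOfMinus A).ι).trW _ _ E ?_ ?_ (Iso.refl _)
  · intro X Y f hf
    refine MorphismProperty.le_isoClosure _ _ ?_
    rw [starAcyclic_trW_iff]
    rw [ObjectProperty.inverseImage_trW_iff, starAcyclic_trW_iff] at hf
    exact hf
  · intro X Y f hf
    rw [starAcyclic_trW_iff, ← DerivedCategory.isIso_Qh_map_iff] at hf
    rw [← isIso_iff_of_reflects_iso _ (starD A .bounded).ι]
    exact hf

instance (s : DerivedSymbol) : (starQ A s).IsLocalization (starAcyclic A s).trW := by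
  cases s <;> infer_instance

end StarLocalization

/-! ### Kan extensions along a localization, computed on a class T of resolutions -/

namespace CategoryTheory

section DerivedUnit

variable {C D E : Type*} [Category* C] [Category* D] [Category* E]
  (L : C ⥤ D) (W : MorphismProperty C) [L.IsLocalization W]
  {T : ObjectProperty C} {F : C ⥤ E} {RF : D ⥤ E}
  (e : T.ι ⋙ L ⋙ RF ≅ T.ι ⋙ F)

include L in
lemma isInvertedBy_comp_of_isLocalization (G : D ⥤ E) : W.IsInvertedBy (L ⋙ G) :=
  (Localization.inverts L W).of_comp W L G

section Right

-- The candidate for the unit at X is F(s), followed by `e` inverse at Y and by the inverse of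
-- RF(L(s)). A morphism g of resolutions over f makes the candidates at X and X' compatible with f.
omit W [L.IsLocalization W] in
lemma derivedUnit_aux {X X' Y Z : C} (f : X ⟶ X') (s : X ⟶ Y) (s' : X' ⟶ Z) (hY : T Y) (hZ : T Z) (g : Y ⟶ Z) (h : s ≫ g = f ≫ s')
    [IsIso (RF.map (L.map s))] [IsIso (RF.map (L.map s'))] :
    F.map f ≫ F.map s' ≫ e.inv.app ⟨Z, hZ⟩ ≫ inv (RF.map (L.map s')) =
      F.map s ≫ e.inv.app ⟨Y, hY⟩ ≫ inv (RF.map (L.map s)) ≫ RF.map (L.map f) := by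
  have h1 : F.map g ≫ e.inv.app ⟨Z, hZ⟩ = e.inv.app ⟨Y, hY⟩ ≫ RF.map (L.map g) :=
    e.inv.naturality (X := ⟨Y, hY⟩) (Y := ⟨Z, hZ⟩) (ObjectProperty.homMk g)
  have h2 : RF.map (L.map s) ≫ RF.map (L.map g) = RF.map (L.map f) ≫ RF.map (L.map s') := by
    rw [← RF.map_comp, ← L.map_comp, h, L.map_comp, RF.map_comp]
  rw [← F.map_comp_assoc, ← h, F.map_comp, Category.assoc, reassoc_of% h1]
  congr 2
  rw [IsIso.comp_inv_eq, Category.assoc, ← h2, IsIso.inv_hom_id_assoc]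

variable [W.HasLeftCalculusOfFractions]
  (hT : ∀ X : C, ∃ (Y : C) (s : X ⟶ Y), W s ∧ T Y)

-- Resolutions are chosen without functoriality, so the point is naturality. It follows from
-- comparing the chosen resolutions of X and X' with a further resolution of X' that receives maps
-- from both.
include e hT in
lemma exists_derivedUnit : ∃ α : F ⟶ L ⋙ RF, ∀ Y : T.FullSubcategory,
    α.app Y.obj = e.inv.app Y := by
  choose r s hs hr using hT
  have hiso : ∀ {X Y : C} (s : X ⟶ Y), W s → IsIso (RF.map (L.map s)) := fun s hs => by
    have := Localization.inverts L W s hs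
    infer_instance
  have : ∀ X, IsIso (RF.map (L.map (s X))) := fun X => hiso _ (hs X)
  have key : ∀ {X X' : C} (f : X ⟶ X'), F.map f ≫ F.map (s X') ≫ e.inv.app ⟨_, hr X'⟩ ≫
        inv (RF.map (L.map (s X'))) = (F.map (s X) ≫ e.inv.app ⟨_, hr X⟩ ≫
        inv (RF.map (L.map (s X)))) ≫ RF.map (L.map f) := by
    intro X X' f
    -- The Ore condition completes `s X` and `f ≫ s X'` to a square; its corner is resolved once
    -- more so that the common target lies in T.
    obtain ⟨φ, hφ⟩ := (MorphismProperty.RightFraction.mk _ (hs X) (f ≫ s X')).exists_leftFraction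
    let t := φ.s ≫ s φ.Y'
    have hφ' : (f ≫ s X') ≫ φ.s = s X ≫ φ.f := hφ
    have ht : W (s X' ≫ t) := W.comp_mem _ _ (hs X') (W.comp_mem _ _ φ.hs (hs _))
    have := hiso _ ht
    have h1 := derivedUnit_aux L e f (s X) (s X' ≫ t) (hr X) (hr φ.Y')
      (φ.f ≫ s φ.Y') (by simp [t, ← reassoc_of% hφ'])
    -- With the identity in place of f: the candidate at X' does not change when `s X'` is prolonged
    -- by t.
    have h2 := derivedUnit_aux L e (𝟙 X') (s X') (s X' ≫ t) (hr X') (hr φ.Y') t (by simp)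
    rw [F.map_id, Category.id_comp, L.map_id, RF.map_id, Category.comp_id] at h2
    rw [← h2, h1, Category.assoc, Category.assoc]
  refine ⟨{ app := fun X => F.map (s X) ≫ e.inv.app ⟨_, hr X⟩ ≫ inv (RF.map (L.map (s X)))
            naturality := fun X X' f => key f }, ?_⟩
  rintro ⟨Y, hY⟩
  have h1 : F.map (s Y) ≫ e.inv.app ⟨_, hr Y⟩ = e.inv.app ⟨Y, hY⟩ ≫ RF.map (L.map (s Y)) :=
    e.inv.naturality (X := ⟨Y, hY⟩) (Y := ⟨_, hr Y⟩) (ObjectProperty.homMk (s Y))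
  show F.map (s Y) ≫ e.inv.app ⟨_, hr Y⟩ ≫ inv (RF.map (L.map (s Y))) = _
  rw [reassoc_of% h1, IsIso.hom_inv_id, Category.comp_id]

omit [W.HasLeftCalculusOfFractions] in
include hT in
/-- Natural transformations to a functor that inverts `W` agree if they
agree on the objects that are used to resolve. -/
lemma natTrans_ext_of_resolutions {G : C ⥤ E} (hG : W.IsInvertedBy G) {α β : F ⟶ G}
    (h : ∀ Y, T Y → α.app Y = β.app Y) : α = β := by
  ext X
  obtain ⟨Y, s, hs, hY⟩ := hT X
  have := hG s hs
  rw [← cancel_mono (G.map s), ← α.naturality, ← β.naturality, h Y hY]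

-- T already localizes to D, so a transformation out of RF is determined by its components on T.
-- There α is invertible and the factorization of β can only be α⁻¹ ≫ β; that it gives back β on all
-- of C again follows by resolving.
omit [W.HasLeftCalculusOfFractions] in
include W hT in
lemma isLeftKanExtension_of_resolutions
    [(T.ι ⋙ L).IsLocalization (W.inverseImage T.ι)]
    (α : F ⟶ L ⋙ RF) (hα : ∀ Y, T Y → IsIso (α.app Y)) : RF.IsLeftKanExtension α where
  nonempty_isUniversal := by
    let M := T.ι ⋙ L
    have hα' : ∀ Y : T.FullSubcategory, IsIso (α.app Y.obj) := fun Y => hα _ Y.property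
    let γ (G : D ⥤ E) (β : F ⟶ L ⋙ G) : RF ⟶ G :=
      Localization.liftNatTrans M (W.inverseImage T.ι) (M ⋙ RF) (M ⋙ G) RF G
        { app := fun Y => inv (α.app Y.obj) ≫ β.app Y.obj
          naturality := fun Y Z f => by
            have h1 := α.naturality f.hom
            have h2 := β.naturality f.hom
            show RF.map (L.map f.hom) ≫ inv (α.app Z.obj) ≫ β.app Z.obj =
              (inv (α.app Y.obj) ≫ β.app Y.obj) ≫ G.map (L.map f.hom)
            simp only [Functor.comp_map] at h1 h2
            rw [Category.assoc, ← h2, IsIso.eq_inv_comp, ← reassoc_of% h1,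
              IsIso.hom_inv_id_assoc] }
    have hγ : ∀ G β (Y : T.FullSubcategory),
        α.app Y.obj ≫ (γ G β).app (M.obj Y) = β.app Y.obj := fun G β Y => by
      rw [Localization.liftNatTrans_app]
      simp [M]
    refine ⟨Limits.IsInitial.ofUniqueHom (fun X => StructuredArrow.homMk (γ X.right X.hom) ?_) ?_⟩
    · refine natTrans_ext_of_resolutions W hT
        (isInvertedBy_comp_of_isLocalization L W _) fun Y hY => ?_
      exact hγ _ _ ⟨Y, hY⟩
    · intro X m
      ext1
      refine Localization.natTrans_ext M (W.inverseImage T.ι) fun Y => ?_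
      have := hα' Y
      have hm : α.app Y.obj ≫ m.right.app (M.obj Y) = X.hom.app Y.obj := by
        rw [← StructuredArrow.w m]; rfl
      refine (cancel_epi (α.app Y.obj)).1 (hm.trans (hγ _ _ Y).symm)

end Right

section Left

omit W [L.IsLocalization W] in
lemma derivedCounit_aux {X X' Y Z : C} (f : X' ⟶ X) (s : Y ⟶ X) (s' : Z ⟶ X') (hY : T Y) (hZ : T Z)
    (g : Z ⟶ Y) (h : g ≫ s = s' ≫ f)
    [IsIso (RF.map (L.map s))] [IsIso (RF.map (L.map s'))] :
    (inv (RF.map (L.map s')) ≫ e.hom.app ⟨Z, hZ⟩ ≫ F.map s') ≫ F.map f =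
      RF.map (L.map f) ≫ inv (RF.map (L.map s)) ≫ e.hom.app ⟨Y, hY⟩ ≫ F.map s := by
  have h1 : RF.map (L.map g) ≫ e.hom.app ⟨Y, hY⟩ = e.hom.app ⟨Z, hZ⟩ ≫ F.map g :=
    e.hom.naturality (X := ⟨Z, hZ⟩) (Y := ⟨Y, hY⟩) (ObjectProperty.homMk g)
  have h2 : RF.map (L.map g) ≫ RF.map (L.map s) = RF.map (L.map s') ≫ RF.map (L.map f) := by
    rw [← RF.map_comp, ← L.map_comp, h, L.map_comp, RF.map_comp]
  rw [Category.assoc, Category.assoc, ← F.map_comp, ← h, F.map_comp, ← reassoc_of% h1,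
    ← Category.assoc, ← Category.assoc (RF.map (L.map f))]
  congr 1
  rw [IsIso.eq_comp_inv, Category.assoc, h2, IsIso.inv_hom_id_assoc]

variable [W.HasRightCalculusOfFractions]
  (hT : ∀ X : C, ∃ (Y : C) (s : Y ⟶ X), W s ∧ T Y)

include e hT in
lemma exists_derivedCounit : ∃ α : L ⋙ RF ⟶ F, ∀ Y : T.FullSubcategory,
    α.app Y.obj = e.hom.app Y := by
  choose r s hs hr using hT
  have hiso : ∀ {X Y : C} (s : X ⟶ Y), W s → IsIso (RF.map (L.map s)) := fun s hs => by
    have := Localization.inverts L W s hs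
    infer_instance
  have : ∀ X, IsIso (RF.map (L.map (s X))) := fun X => hiso _ (hs X)
  have key : ∀ {X' X : C} (f : X' ⟶ X),
      RF.map (L.map f) ≫ inv (RF.map (L.map (s X))) ≫ e.hom.app ⟨_, hr X⟩ ≫ F.map (s X) =
        (inv (RF.map (L.map (s X'))) ≫ e.hom.app ⟨_, hr X'⟩ ≫ F.map (s X')) ≫ F.map f := by
    intro X' X f
    obtain ⟨φ, hφ⟩ := (MorphismProperty.LeftFraction.mk (s X' ≫ f) _ (hs X)).exists_rightFraction
    let t := s φ.X' ≫ φ.s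
    have hφ' : φ.s ≫ s X' ≫ f = φ.f ≫ s X := hφ
    have ht : W (t ≫ s X') := W.comp_mem _ _ (W.comp_mem _ _ (hs _) φ.hs) (hs X')
    have := hiso _ ht
    have h1 := derivedCounit_aux L e f (s X) (t ≫ s X') (hr X) (hr φ.X')
      (s φ.X' ≫ φ.f) (by simp [t, ← hφ'])
    have h2 := derivedCounit_aux L e (𝟙 X') (s X') (t ≫ s X') (hr X') (hr φ.X') t (by simp)
    rw [F.map_id, Category.comp_id, L.map_id, RF.map_id, Category.id_comp] at h2
    rw [← h2, ← h1]
  refine ⟨{ app := fun X => inv (RF.map (L.map (s X))) ≫ e.hom.app ⟨_, hr X⟩ ≫ F.map (s X)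
            naturality := fun X X' f => key f }, ?_⟩
  rintro ⟨Y, hY⟩
  have h1 : RF.map (L.map (s Y)) ≫ e.hom.app ⟨Y, hY⟩ = e.hom.app ⟨_, hr Y⟩ ≫ F.map (s Y) :=
    e.hom.naturality (X := ⟨_, hr Y⟩) (Y := ⟨Y, hY⟩) (ObjectProperty.homMk (s Y))
  show inv (RF.map (L.map (s Y))) ≫ e.hom.app ⟨_, hr Y⟩ ≫ F.map (s Y) = _
  rw [← h1, IsIso.inv_hom_id_assoc]

omit [W.HasRightCalculusOfFractions] in
include hT in
/-- Natural transformations from a functor that inverts `W` agree if they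
agree on the objects that are used to resolve. -/
lemma natTrans_ext_of_coresolutions {G : C ⥤ E} (hG : W.IsInvertedBy G) {α β : G ⟶ F}
    (h : ∀ Y, T Y → α.app Y = β.app Y) : α = β := by
  ext X
  obtain ⟨Y, s, hs, hY⟩ := hT X
  have := hG s hs
  rw [← cancel_epi (G.map s), α.naturality, β.naturality, h Y hY]

omit [W.HasRightCalculusOfFractions] in
include W hT in
lemma isRightKanExtension_of_resolutions
    [(T.ι ⋙ L).IsLocalization (W.inverseImage T.ι)]
    (α : L ⋙ RF ⟶ F) (hα : ∀ Y, T Y → IsIso (α.app Y)) : RF.IsRightKanExtension α where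
  nonempty_isUniversal := by
    let M := T.ι ⋙ L
    have hα' : ∀ Y : T.FullSubcategory, IsIso (α.app Y.obj) := fun Y => hα _ Y.property
    let γ (G : D ⥤ E) (β : L ⋙ G ⟶ F) : G ⟶ RF :=
      Localization.liftNatTrans M (W.inverseImage T.ι) (M ⋙ G) (M ⋙ RF) G RF
        { app := fun Y => β.app Y.obj ≫ inv (α.app Y.obj)
          naturality := fun Y Z f => by
            have h1 := α.naturality f.hom
            have h2 := β.naturality f.hom
            show G.map (L.map f.hom) ≫ β.app Z.obj ≫ inv (α.app Z.obj) =
              (β.app Y.obj ≫ inv (α.app Y.obj)) ≫ RF.map (L.map f.hom)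
            simp only [Functor.comp_map] at h1 h2
            rw [reassoc_of% h2, ← Category.assoc, IsIso.comp_inv_eq, Category.assoc, Category.assoc,
              h1, IsIso.inv_hom_id_assoc] }
    have hγ : ∀ G β (Y : T.FullSubcategory),
        (γ G β).app (M.obj Y) ≫ α.app Y.obj = β.app Y.obj := fun G β Y => by
      rw [Localization.liftNatTrans_app]
      simp [M]
    refine ⟨Limits.IsTerminal.ofUniqueHom
      (fun X => CostructuredArrow.homMk (γ X.left X.hom) ?_) ?_⟩
    · refine natTrans_ext_of_coresolutions W hT
        (isInvertedBy_comp_of_isLocalization L W _) fun Y hY => ?_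
      exact hγ _ _ ⟨Y, hY⟩
    · intro X m
      ext1
      refine Localization.natTrans_ext M (W.inverseImage T.ι) fun Y => ?_
      have := hα' Y
      have hm : m.left.app (M.obj Y) ≫ α.app Y.obj = X.hom.app Y.obj := by
        rw [← CostructuredArrow.w m]; rfl
      exact (cancel_mono (α.app Y.obj)).1 (hm.trans (hγ _ _ Y).symm)

end Left

section CommShift

open CategoryTheory.Functor

variable (Z : Type*) [AddMonoid Z] [HasShift C Z] [HasShift D Z] [HasShift E Z]
  [L.CommShift Z] [F.CommShift Z] [RF.CommShift Z] [T.IsStableUnderShift Z]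

-- Both sides of the shift compatibility map to a functor inverting W, so agreement on T is enough.
-- On T the known compatibility differs by F of the isomorphism comparing the shifts of T and of C,
-- which can be cancelled.
include W in
lemma commShift_of_resolutions (hT : ∀ X : C, ∃ (Y : C) (s : X ⟶ Y), W s ∧ T Y)
    (α : F ⟶ L ⋙ RF) [NatTrans.CommShift (whiskerLeft T.ι α) Z] : NatTrans.CommShift α Z where
  shift_comm a := by
    refine natTrans_ext_of_resolutions W hT
      (isInvertedBy_comp_of_isLocalization L W (RF ⋙ shiftFunctor E a)) fun Y hY => ?_
    have h := NatTrans.shift_app_comm (whiskerLeft T.ι α) a ⟨Y, hY⟩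
    rw [commShiftIso_comp_hom_app T.ι, commShiftIso_comp_hom_app T.ι] at h
    have h2 := α.naturality ((T.ι.commShiftIso a).hom.app ⟨Y, hY⟩)
    refine (cancel_epi (F.map ((T.ι.commShiftIso a).hom.app ⟨Y, hY⟩))).1 ?_
    refine (Category.assoc _ _ _).symm.trans (h.trans ?_)
    refine (Category.assoc _ _ _).symm.trans ?_
    refine Eq.trans ?_ (Category.assoc _ _ _)
    exact congrArg (· ≫ ((L ⋙ RF).commShiftIso a).hom.app Y) h2.symm

include W in
lemma commShift_of_coresolutions (hT : ∀ X : C, ∃ (Y : C) (s : Y ⟶ X), W s ∧ T Y)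
    (α : L ⋙ RF ⟶ F) [NatTrans.CommShift (whiskerLeft T.ι α) Z] : NatTrans.CommShift α Z where
  shift_comm a := by
    refine natTrans_ext_of_coresolutions W hT
      ((MorphismProperty.IsInvertedBy.iff_of_iso W ((L ⋙ RF).commShiftIso a)).2
        (isInvertedBy_comp_of_isLocalization L W (RF ⋙ shiftFunctor E a))) fun Y hY => ?_
    have h := NatTrans.shift_app_comm (whiskerLeft T.ι α) a ⟨Y, hY⟩
    rw [commShiftIso_comp_hom_app T.ι, commShiftIso_comp_hom_app T.ι] at h
    have h2 := α.naturality ((T.ι.commShiftIso a).hom.app ⟨Y, hY⟩)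
    refine (cancel_epi ((L ⋙ RF).map ((T.ι.commShiftIso a).hom.app ⟨Y, hY⟩))).1 ?_
    refine (Category.assoc _ _ _).symm.trans (h.trans ?_)
    refine (Category.assoc _ _ _).symm.trans ?_
    refine Eq.trans ?_ (Category.assoc _ _ _)
    exact congrArg (· ≫ (F.commShiftIso a).hom.app Y) h2.symm

end CommShift

end DerivedUnit

end CategoryTheory

-- Every arrow of D is isomorphic to the image of an arrow of C, so distinguished triangles of D
-- come from C up to isomorphism and the lift inherits exactness from H. The shift structure also
-- descends, compatibly with `e`.
open Limits Pretriangulated in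
lemma CategoryTheory.Functor.exists_triangulated_lift {C D E : Type*}
    [Category* C] [HasZeroObject C] [HasShift C ℤ] [Preadditive C]
    [∀ n : ℤ, (shiftFunctor C n).Additive] [Pretriangulated C]
    [Category* D] [HasZeroObject D] [HasShift D ℤ] [Preadditive D]
    [∀ n : ℤ, (shiftFunctor D n).Additive] [Pretriangulated D]
    [Category* E] [HasZeroObject E] [HasShift E ℤ] [Preadditive E]
    [∀ n : ℤ, (shiftFunctor E n).Additive] [Pretriangulated E]
    (L : C ⥤ D) (W : MorphismProperty C) [L.IsLocalization W] [W.IsCompatibleWithShift ℤ]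
    [W.HasLeftCalculusOfFractions] [L.CommShift ℤ] [L.IsTriangulated] (H : C ⥤ E) [H.CommShift ℤ]
    [H.IsTriangulated] (hH : W.IsInvertedBy H) :
    ∃ (R : D ⥤ E) (_ : R.CommShift ℤ) (e : L ⋙ R ≅ H),
      R.IsTriangulated ∧ NatTrans.CommShift e.hom ℤ := by
  let R := Localization.lift H hH L
  let := Functor.commShiftOfLocalization L W ℤ H R
  have : L.mapArrow.EssSurj := Localization.essSurj_mapArrow L W
  have := NatTrans.commShift_iso_hom_of_localization (A := ℤ) L W H R
  exact ⟨R, inferInstance, Localization.Lifting.iso L W H R,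
    Functor.isTriangulated_of_precomp_iso (Localization.Lifting.iso L W H R), this⟩

/-! ### Derived functors and equivalences on D^⋆ from a class of resolving complexes -/

section StarDerived

open Limits Pretriangulated

variable {A : Type*} [Category* A] [Abelian A] {B : Type*} [Category* B] [Abelian B]

instance (F : A ⥤ B) [F.Additive] (s : DerivedSymbol) : (starMap F s).IsTriangulated :=
  inferInstanceAs ((starK B s).lift
    ((starK A s).ι ⋙ F.mapHomotopyCategory (.up ℤ)) (starK_map F s)).IsTriangulated

/-- A map in question has a cone that is an acyclic object of T; its image has the image of that
cone as a cone, acyclic by `hF`. -/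
lemma starMap_comp_starQ_inverts (F : A ⥤ B) [F.Additive] (s : DerivedSymbol)
    [HasDerivedCategory B] (T : ObjectProperty (StarHomotopyCat A s)) [T.IsTriangulated]
    (hF : ∀ X, T X → starAcyclic A s X → starAcyclic B s ((starMap F s).obj X)) :
    ((starAcyclic A s).inverseImage T.ι).trW.IsInvertedBy (T.ι ⋙ starMap F s ⋙ starQ B s) := by
  intro X Y f hf
  rw [ObjectProperty.trW_iff] at hf
  obtain ⟨Z, g, h, hT, hZ⟩ := hf
  refine Localization.inverts (starQ B s) (starAcyclic B s).trW _ ?_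
  exact ObjectProperty.trW.mk _ ((T.ι ⋙ starMap F s).map_distinguished _ hT)
    (hF _ Z.property hZ)

variable [HasDerivedCategory A] [HasDerivedCategory B]

/-- Resolutions present D^⋆(A) as a localization of T. On T the functor F followed by localization
inverts quasi-isomorphisms, so it descends. The unit, built from resolutions, is invertible on T,
and this makes the lift universal. -/
theorem exists_isRightDerived (F : A ⥤ B) [F.Additive] (s : DerivedSymbol)
    (T : ObjectProperty (StarHomotopyCat A s)) [T.IsTriangulated]
    (hT : ∀ X, ∃ (Y : StarHomotopyCat A s) (f : X ⟶ Y), (starAcyclic A s).trW f ∧ T Y)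
    (hF : ∀ X, T X → starAcyclic A s X → starAcyclic B s ((starMap F s).obj X)) :
    ((T.ι ⋙ starQ A s).IsLocalization ((starAcyclic A s).trW.inverseImage T.ι)) ∧
    ∃ (RF : StarDerivedCat A s ⥤ StarDerivedCat B s) (_ : RF.CommShift ℤ)
      (_ : (T.ι ⋙ starQ A s) ⋙ RF ≅ T.ι ⋙ starMap F s ⋙ starQ B s),
      IsRightDerived F s RF := by
  have hW : ((starAcyclic A s).inverseImage T.ι).trW = (starAcyclic A s).trW.inverseImage T.ι := by
    ext X Y f
    exact ObjectProperty.inverseImage_trW_iff _ _ f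
  have : T.IsVerdierRightLocalizing (starAcyclic A s) := by
    rw [ObjectProperty.isVerdierRightLocalizing_iff]
    intro X Y f hX hf
    -- A quasi-isomorphism out of an object of T is prolonged by a resolution of its target; the
    -- cone of the composite then has a representative in T, and it is acyclic.
    obtain ⟨Z, t, ht, hZ⟩ := hT Y
    obtain ⟨U, hU, a, b, h⟩ := T.distinguished_cocone_triangle (f ≫ t) hX hZ
    exact ⟨Z, f ≫ t, t, hZ, ObjectProperty.trW.mk _ h ⟨hU,
      ((starAcyclic A s).trW_iff_of_distinguished _ h).1 (MorphismProperty.comp_mem _ _ _ hf ht)⟩,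
      rfl⟩
  have : (T.ι ⋙ starQ A s).EssSurj := ⟨fun X => by
    obtain ⟨Y, t, ht, hY⟩ := hT ((starQ A s).objPreimage X)
    have := Localization.inverts (starQ A s) _ t ht
    exact ⟨⟨Y, hY⟩, ⟨(asIso ((starQ A s).map t)).symm ≪≫ (starQ A s).objObjPreimageIso X⟩⟩⟩
  have hloc : (T.ι ⋙ starQ A s).IsLocalization ((starAcyclic A s).inverseImage T.ι).trW :=
    (T.triangulatedLocalizerMorphism
      (starAcyclic A s)).isLocalization_of_isLocalizedFullyFaithful
      (L₁ := T.ι ⋙ starQ A s) (L₂ := starQ A s) (F := 𝟭 _) (Iso.refl _)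
  obtain ⟨RF, _, e, hRF, _⟩ := Functor.exists_triangulated_lift (T.ι ⋙ starQ A s)
    ((starAcyclic A s).inverseImage T.ι).trW (T.ι ⋙ starMap F s ⋙ starQ B s)
    (starMap_comp_starQ_inverts F s T hF)
  refine ⟨hW ▸ hloc, RF, inferInstance, e, hRF, ?_⟩
  obtain ⟨α, hα⟩ := exists_derivedUnit (starQ A s) (starAcyclic A s).trW (T := T)
    (F := starMap F s ⋙ starQ B s) (RF := RF) e hT
  have : NatTrans.CommShift (Functor.whiskerLeft T.ι α) ℤ := by
    have : Functor.whiskerLeft T.ι α =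
        e.inv ≫ (Functor.associator T.ι (starQ A s) RF).hom := by
      ext1; ext1 Y; exact (hα Y).trans (Category.comp_id _).symm
    rw [this]
    infer_instance
  refine ⟨α, commShift_of_resolutions _ (starAcyclic A s).trW ℤ hT α, ?_⟩
  have : (T.ι ⋙ starQ A s).IsLocalization ((starAcyclic A s).trW.inverseImage T.ι) := hW ▸ hloc
  refine isLeftKanExtension_of_resolutions _ (starAcyclic A s).trW hT α fun Y hY => ?_
  rw [hα ⟨Y, hY⟩]
  infer_instance

theorem exists_isLeftDerived (F : A ⥤ B) [F.Additive] (s : DerivedSymbol)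
    (T : ObjectProperty (StarHomotopyCat A s)) [T.IsTriangulated]
    (hT : ∀ X, ∃ (Y : StarHomotopyCat A s) (f : Y ⟶ X), (starAcyclic A s).trW f ∧ T Y)
    (hF : ∀ X, T X → starAcyclic A s X → starAcyclic B s ((starMap F s).obj X)) :
    ((T.ι ⋙ starQ A s).IsLocalization ((starAcyclic A s).trW.inverseImage T.ι)) ∧
    ∃ (LF : StarDerivedCat A s ⥤ StarDerivedCat B s) (_ : LF.CommShift ℤ)
      (_ : (T.ι ⋙ starQ A s) ⋙ LF ≅ T.ι ⋙ starMap F s ⋙ starQ B s),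
      IsLeftDerived F s LF := by
  have hW : ((starAcyclic A s).inverseImage T.ι).trW = (starAcyclic A s).trW.inverseImage T.ι := by
    ext X Y f
    exact ObjectProperty.inverseImage_trW_iff _ _ f
  have : T.IsVerdierLeftLocalizing (starAcyclic A s) := by
    rw [ObjectProperty.isVerdierLeftLocalizing_iff]
    intro X Y f hY hf
    obtain ⟨Z, t, ht, hZ⟩ := hT X
    obtain ⟨U, hU, a, b, h⟩ := T.distinguished_cocone_triangle (t ≫ f) hZ hY
    exact ⟨Z, t ≫ f, t, hZ, ObjectProperty.trW.mk _ h ⟨hU,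
      ((starAcyclic A s).trW_iff_of_distinguished _ h).1 (MorphismProperty.comp_mem _ _ _ ht hf)⟩,
      rfl⟩
  have : (T.ι ⋙ starQ A s).EssSurj := ⟨fun X => by
    obtain ⟨Y, t, ht, hY⟩ := hT ((starQ A s).objPreimage X)
    have := Localization.inverts (starQ A s) _ t ht
    exact ⟨⟨Y, hY⟩, ⟨asIso ((starQ A s).map t) ≪≫ (starQ A s).objObjPreimageIso X⟩⟩⟩
  have hloc : (T.ι ⋙ starQ A s).IsLocalization ((starAcyclic A s).inverseImage T.ι).trW :=
    (T.triangulatedLocalizerMorphism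
      (starAcyclic A s)).isLocalization_of_isLocalizedFullyFaithful
      (L₁ := T.ι ⋙ starQ A s) (L₂ := starQ A s) (F := 𝟭 _) (Iso.refl _)
  obtain ⟨LF, _, e, hLF, _⟩ := Functor.exists_triangulated_lift (T.ι ⋙ starQ A s)
    ((starAcyclic A s).inverseImage T.ι).trW (T.ι ⋙ starMap F s ⋙ starQ B s)
    (starMap_comp_starQ_inverts F s T hF)
  refine ⟨hW ▸ hloc, LF, inferInstance, e, hLF, ?_⟩
  obtain ⟨α, hα⟩ := exists_derivedCounit (starQ A s) (starAcyclic A s).trW (T := T)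
    (F := starMap F s ⋙ starQ B s) (RF := LF) e hT
  have : NatTrans.CommShift (Functor.whiskerLeft T.ι α) ℤ := by
    have : Functor.whiskerLeft T.ι α =
        (Functor.associator T.ι (starQ A s) LF).inv ≫ e.hom := by
      ext1; ext1 Y; exact (hα Y).trans (Category.id_comp _).symm
    rw [this]
    infer_instance
  refine ⟨α, commShift_of_coresolutions _ (starAcyclic A s).trW ℤ hT α, ?_⟩
  have : (T.ι ⋙ starQ A s).IsLocalization ((starAcyclic A s).trW.inverseImage T.ι) := hW ▸ hloc
  refine isRightKanExtension_of_resolutions _ (starAcyclic A s).trW hT α fun Y hY => ?_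
  rw [hα ⟨Y, hY⟩]
  infer_instance

/-- If the adjoint functors restrict to mutually inverse equivalences between complexes with
terms adapted to them, then the derived functors are mutually inverse equivalences. -/
theorem exists_derived_equivalence (F : A ⥤ B) [F.Additive] (G : B ⥤ A) [G.Additive]
    (s : DerivedSymbol)
    (T : ObjectProperty (StarHomotopyCat A s)) [T.IsTriangulated]
    (hT : ∀ X, ∃ (Y : StarHomotopyCat A s) (f : X ⟶ Y), (starAcyclic A s).trW f ∧ T Y)
    (hF : ∀ X, T X → starAcyclic A s X → starAcyclic B s ((starMap F s).obj X))
    (T' : ObjectProperty (StarHomotopyCat B s)) [T'.IsTriangulated]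
    (hT' : ∀ X, ∃ (Y : StarHomotopyCat B s) (f : Y ⟶ X), (starAcyclic B s).trW f ∧ T' Y)
    (hG : ∀ X, T' X → starAcyclic B s X → starAcyclic A s ((starMap G s).obj X))
    (hTT' : ∀ X, T X → T' ((starMap F s).obj X)) (hT'T : ∀ X, T' X → T ((starMap G s).obj X))
    (eA : T.ι ⋙ starMap F s ⋙ starMap G s ≅ T.ι)
    (eB : T'.ι ⋙ starMap G s ⋙ starMap F s ≅ T'.ι) :
    ∃ (e : StarDerivedCat A s ≌ StarDerivedCat B s)
      (_ : e.functor.CommShift ℤ) (_ : e.inverse.CommShift ℤ),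
      IsRightDerived F s e.functor ∧ IsLeftDerived G s e.inverse := by
  obtain ⟨h₁, RF, cRF, e₁, hRF⟩ := exists_isRightDerived F s T hT hF
  obtain ⟨h₂, LG, cLG, e₂, hLG⟩ := exists_isLeftDerived G s T' hT' hG
  let f : T.FullSubcategory ⥤ T'.FullSubcategory :=
    T'.lift (T.ι ⋙ starMap F s) fun X => hTT' _ X.property
  let g : T'.FullSubcategory ⥤ T.FullSubcategory :=
    T.lift (T'.ι ⋙ starMap G s) fun X => hT'T _ X.property
  -- On resolving complexes the composites of derived functors are the composites of F and G, hence
  -- the identity by `eA` and `eB`. The isomorphisms extend because D^⋆ is a localization of these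
  -- complexes.
  let uA : (T.ι ⋙ starQ A s) ⋙ RF ⋙ LG ≅ T.ι ⋙ starQ A s :=
    (Functor.associator _ _ _).symm ≪≫ Functor.isoWhiskerRight e₁ LG ≪≫
      Functor.isoWhiskerLeft f e₂ ≪≫ Functor.isoWhiskerRight eA (starQ A s)
  let uB : (T'.ι ⋙ starQ B s) ⋙ LG ⋙ RF ≅ T'.ι ⋙ starQ B s :=
    (Functor.associator _ _ _).symm ≪≫ Functor.isoWhiskerRight e₂ RF ≪≫
      Functor.isoWhiskerLeft g e₁ ≪≫ Functor.isoWhiskerRight eB (starQ B s)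
  let uA' : RF ⋙ LG ≅ 𝟭 _ := Localization.liftNatIso (T.ι ⋙ starQ A s)
    ((starAcyclic A s).trW.inverseImage T.ι) ((T.ι ⋙ starQ A s) ⋙ RF ⋙ LG)
    (T.ι ⋙ starQ A s) _ _ uA
  let uB' : LG ⋙ RF ≅ 𝟭 _ := Localization.liftNatIso (T'.ι ⋙ starQ B s)
    ((starAcyclic B s).trW.inverseImage T'.ι) ((T'.ι ⋙ starQ B s) ⋙ LG ⋙ RF)
    (T'.ι ⋙ starQ B s) _ _ uB
  -- No triangle identity is required of the two isomorphisms: `Equivalence.mk` corrects one of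
  -- them.
  exact ⟨CategoryTheory.Equivalence.mk RF LG uA'.symm uB', cRF, cLG, hRF, hLG⟩

end StarDerived

/-! ### Complexes with terms in a given class, and dimension shifting -/

section Termwise

open Limits Pretriangulated ZeroObject CochainComplex HomComplex

variable {A : Type*} [Category* A] [Abelian A]

/-- The object of the homotopy category `K^⋆(A)` given by a complex. -/
abbrev starObj {s : DerivedSymbol} (K : CochainComplex A ℤ) (h : starComplex A s K) :
    StarHomotopyCat A s :=
  ⟨(HomotopyCategory.quotient A (.up ℤ)).obj K, h⟩

/-- The complexes whose terms satisfy a property. -/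
def starTermwise (P : ObjectProperty A) (s : DerivedSymbol) :
    ObjectProperty (StarHomotopyCat A s) :=
  fun X => ∀ n, P (X.obj.as.X n)

variable (P : ObjectProperty A) [P.IsClosedUnderIsomorphisms] [P.ContainsZero]
  [P.IsClosedUnderBinaryProducts] (s : DerivedSymbol)

omit [P.ContainsZero] in
lemma prop_mappingCone {K L : CochainComplex A ℤ} (f : K ⟶ L) (hK : ∀ n, P (K.X n))
    (hL : ∀ n, P (L.X n)) (n : ℤ) : P ((mappingCone f).X n) :=
  P.prop_of_iso (HomologicalComplex.homotopyCofiber.XIsoBiprod f n (n + 1) rfl ≪≫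
    biprod.isoProd _ _).symm (P.prop_prod _ _ (hK _) (hL _))

instance : (starTermwise P s).IsStableUnderShift ℤ where
  isStableUnderShiftBy a := ⟨fun X hX => by
    obtain ⟨X, h⟩ := X
    obtain ⟨K : CochainComplex A ℤ, rfl⟩ := HomotopyCategory.quotient_obj_surjective X
    rw [ObjectProperty.prop_shift_iff]
    intro n
    have h1 : P ((K⟦a⟧).X n) := hX (n + a)
    with_unfolding_all exact h1⟩

instance : (starTermwise P s).ContainsZero where
  exists_zero := by
    refine ⟨⟨(HomotopyCategory.quotient A (.up ℤ)).obj 0, ?_⟩, ?_, fun n => ?_⟩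
    · have hge : ∃ n : ℤ, (0 : CochainComplex A ℤ).IsStrictlyGE n := ⟨0, inferInstance⟩
      have hle : ∃ n : ℤ, (0 : CochainComplex A ℤ).IsStrictlyLE n := ⟨0, inferInstance⟩
      cases s with
      | bounded => exact ⟨hge, hle⟩
      | plus => exact hge
      | minus => exact hle
      | unbounded => trivial
    · exact IsZero.of_full_of_faithful_of_isZero (starK A s).ι _
        (Functor.map_isZero (HomotopyCategory.quotient A (.up ℤ)) (isZero_zero _))
    · exact P.prop_of_isZero (Functor.map_isZero (HomologicalComplex.eval A _ n) (isZero_zero _))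

instance : (starTermwise P s).IsTriangulatedClosed₃ where
  ext₃' T hT h₁ h₂ := by
    obtain ⟨f, ⟨e⟩⟩ := HomotopyCategory.exists_iso_mappingCone
      ((starK A s).ι.map_distinguished T hT)
    exact ⟨⟨_, starComplex_mappingCone s f T.obj₁.property T.obj₂.property⟩,
      prop_mappingCone P f h₁ h₂, ⟨(starK A s).ι.preimageIso e⟩⟩

instance : (starTermwise P s).IsTriangulated where
  toIsTriangulatedClosed₂ := .of_isTriangulatedClosed₃

omit [P.IsClosedUnderIsomorphisms] [P.ContainsZero] [P.IsClosedUnderBinaryProducts]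

variable {s}

/-- The cone of X₁ → X₂ is quasi-isomorphic to X₃ by exactness, and isomorphic to X₁[1] in the
homotopy category when X₂ is contractible. This is dimension shifting for complexes: a resolution of
X₃ gives one of X₁. -/
lemma exists_trW_shift {S : ShortComplex (CochainComplex A ℤ)} (hS : S.ShortExact)
    (h₁ : starComplex A s S.X₁) (h₂ : starComplex A s S.X₂) (h₃ : starComplex A s S.X₃)
    (hz : IsZero ((HomotopyCategory.quotient A (.up ℤ)).obj S.X₂)) :
    ∃ f : (starObj S.X₁ h₁)⟦(1 : ℤ)⟧ ⟶ starObj S.X₃ h₃, (starAcyclic A s).trW f := by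
  have hT := HomotopyCategory.mappingCone_triangleh_distinguished S.f
  have : IsIso (mappingCone.triangleh S.f).mor₃ := (Triangle.isZero₂_iff_isIso₃ _ hT).1 hz
  let e : starObj (mappingCone S.f) (starComplex_mappingCone s _ h₁ h₂) ≅
      (starObj S.X₁ h₁)⟦(1 : ℤ)⟧ :=
    (starK A s).ι.preimageIso (@asIso _ _ _ _ (mappingCone.triangleh S.f).mor₃ this ≪≫
      (((starK A s).ι.commShiftIso (1 : ℤ)).app (starObj S.X₁ h₁)).symm)
  refine ⟨e.inv ≫ ObjectProperty.homMk ((HomotopyCategory.quotient A (.up ℤ)).map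
    (mappingCone.descShortComplex S)), MorphismProperty.comp_mem _ _ _
      (ObjectProperty.trW_of_isIso _ _) ?_⟩
  rw [starAcyclic_trW_iff]
  exact (HomotopyCategory.quotient_map_mem_quasiIso_iff _).2
    (mappingCone.quasiIso_descShortComplex hS)

lemma isZero_quotient_mappingCone_id (K : CochainComplex A ℤ) :
    IsZero ((HomotopyCategory.quotient A (.up ℤ)).obj (mappingCone (𝟙 K))) := by
  refine Triangle.isZero₃_of_isIso₁ _ (HomotopyCategory.mappingCone_triangleh_distinguished (𝟙 K)) ?_
  exact inferInstanceAs (IsIso ((HomotopyCategory.quotient A (.up ℤ)).map (𝟙 K)))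

end Termwise

/-! ### Finite resolutions by complexes with terms in P -/

section Resolutions

open Limits Pretriangulated ZeroObject CochainComplex HomComplex

variable {A : Type*} [Category* A] [Abelian A]

/-- The complex with zero differential. -/
def zeroDiffComplex (J : ℤ → A) : CochainComplex A ℤ where
  X := J
  d _ _ := 0

variable (P : ObjectProperty A) [P.IsClosedUnderIsomorphisms] [P.ContainsZero]
  [P.IsClosedUnderBinaryProducts] {s : DerivedSymbol}

/-- A chain map from K to the contractible complex cone(id_L) is the same as an arbitrary family of
maps K^n → L^n. So embeddings of the single terms into objects of P, chosen independently of the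
differential, give a monomorphism of complexes. -/
lemma exists_mono_termwise
    (hP : ∀ X : A, ∃ (J : A) (i : X ⟶ J), Mono i ∧ P J)
    (K : CochainComplex A ℤ) (hK : starComplex A s K) :
    ∃ (S : ShortComplex (CochainComplex A ℤ)) (_ : starComplex A s S.X₂)
      (_ : starComplex A s S.X₃), S.ShortExact ∧ S.X₁ = K ∧ (∀ n, P (S.X₂.X n)) ∧
      IsZero ((HomotopyCategory.quotient A (.up ℤ)).obj S.X₂) := by
  -- Zero objects are embedded in zero, so that L is bounded wherever K is.
  have hP' : ∀ X : A, ∃ (J : A) (i : X ⟶ J), Mono i ∧ P J ∧ (IsZero X → IsZero J) := fun X => by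
    by_cases hX : IsZero X
    · exact ⟨0, 0, ⟨fun _ _ _ => hX.eq_of_tgt _ _⟩, P.prop_zero, fun _ => isZero_zero _⟩
    · obtain ⟨J, i, hi, hJ⟩ := hP X
      exact ⟨J, i, hi, hJ, fun h => (hX h).elim⟩
  choose J i hi hJ hz using hP'
  let L := zeroDiffComplex fun n => J (K.X n)
  have hL : starComplex A s L := starComplex_of_isZero s (fun n h => hz _ h) hK
  let β : Cochain K L 0 := Cochain.ofHoms fun n => i (K.X n)
  -- The component β in L is free; the component in L[1] is forced to be -δβ by the chain map
  -- equation.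
  let φ : K ⟶ mappingCone (𝟙 L) := mappingCone.lift (𝟙 L)
    (Cocycle.mk (-(δ 0 1 β)) 2 rfl (by simp [δ_δ])) β (by simp)
  have hφ : ∀ n, Mono (φ.f n) := fun n => by
    have h1 : φ.f n ≫ (mappingCone.snd (𝟙 L)).v n n (add_zero n) = i (K.X n) := by
      simp only [φ, mappingCone.lift_f_snd_v]
      exact Cochain.ofHoms_v _ n
    have : Mono (φ.f n ≫ (mappingCone.snd (𝟙 L)).v n n (add_zero n)) := h1 ▸ hi _
    exact mono_of_mono _ ((mappingCone.snd (𝟙 L)).v n n (add_zero n))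
  have : Mono φ := HomologicalComplex.mono_of_mono_f _ hφ
  refine ⟨ShortComplex.mk φ (cokernel.π φ) (cokernel.condition φ),
    starComplex_mappingCone s _ hL hL, ?_, ?_, rfl, prop_mappingCone P _ (fun n => hJ _)
      (fun n => hJ _), isZero_quotient_mappingCone_id L⟩
  · refine starComplex_of_isZero s (fun n h => ?_) (starComplex_mappingCone s (𝟙 L) hL hL)
    exact h.of_epi ((cokernel.π φ).f n)
  · exact { exact := ShortComplex.exact_cokernel φ }

/-- Dually, a chain map from cone(id_L) to K is an arbitrary family of maps L^{n+1} → K^n. -/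
lemma exists_epi_termwise
    (hP : ∀ X : A, ∃ (J : A) (p : J ⟶ X), Epi p ∧ P J)
    (K : CochainComplex A ℤ) (hK : starComplex A s K) :
    ∃ (S : ShortComplex (CochainComplex A ℤ)) (_ : starComplex A s S.X₁)
      (_ : starComplex A s S.X₂), S.ShortExact ∧ S.X₃ = K ∧ (∀ n, P (S.X₂.X n)) ∧
      IsZero ((HomotopyCategory.quotient A (.up ℤ)).obj S.X₂) := by
  have hP' : ∀ X : A, ∃ (J : A) (p : J ⟶ X), Epi p ∧ P J ∧ (IsZero X → IsZero J) := fun X => by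
    by_cases hX : IsZero X
    · exact ⟨0, 0, ⟨fun _ _ _ => hX.eq_of_src _ _⟩, P.prop_zero, fun _ => isZero_zero _⟩
    · obtain ⟨J, i, hi, hJ⟩ := hP X
      exact ⟨J, i, hi, hJ, fun h => (hX h).elim⟩
  choose J p hp hJ hz using hP'
  -- The shift by one makes L^{n+1}, the summand of the cone in degree n on which the map is free,
  -- the object that covers K^n.
  let L := zeroDiffComplex fun n => J (K.X (n + (-1)))
  have hL : starComplex A s L := starComplex_of_isZero (K := K⟦(-1 : ℤ)⟧) s
    (fun n h => hz _ h) (starComplex_shift A s K _ hK)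
  let α : Cochain L K (-1) := Cochain.mk fun m n h => p _ ≫ (K.XIsoOfEq h).hom
  have hα : ∀ m n h, Epi (α.v m n h) := fun m n h =>
    inferInstanceAs (Epi (p _ ≫ (K.XIsoOfEq h).hom))
  let φ : mappingCone (𝟙 L) ⟶ K := mappingCone.desc (𝟙 L) α
    (Cocycle.homOf (Cocycle.mk (δ (-1) 0 α) 1 rfl (by simp [δ_δ]))) (by simp)
  have hφ : ∀ n, Epi (φ.f n) := fun n => by
    have h1 : (mappingCone.inl (𝟙 L)).v (n + 1) n (Int.add_neg_cancel_right n 1) ≫ φ.f n = α.v (n + 1) n (Int.add_neg_cancel_right n 1) := by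
      simp [φ]
    have : Epi ((mappingCone.inl (𝟙 L)).v (n + 1) n (Int.add_neg_cancel_right n 1) ≫ φ.f n) := h1 ▸ hα _ _ _
    exact epi_of_epi ((mappingCone.inl (𝟙 L)).v (n + 1) n (Int.add_neg_cancel_right n 1)) _
  have : Epi φ := HomologicalComplex.epi_of_epi_f _ hφ
  refine ⟨ShortComplex.mk (kernel.ι φ) φ (kernel.condition φ), ?_,
    starComplex_mappingCone s _ hL hL, ?_, rfl, prop_mappingCone P _ (fun n => hJ _)
      (fun n => hJ _), isZero_quotient_mappingCone_id L⟩
  · refine starComplex_of_isZero s (fun n h => ?_) (starComplex_mappingCone s (𝟙 L) hL hL)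
    exact h.of_mono ((kernel.ι φ).f n)
  · exact { exact := ShortComplex.exact_kernel φ }

variable (s)

/-- Resolutions by complexes with terms in `P`, when all objects have finite dimension with
respect to `P`. -/
theorem exists_termwise_resolution
    (hP : ∀ X : A, ∃ (J : A) (i : X ⟶ J), Mono i ∧ P J) (D : ℕ → ObjectProperty A)
    (h0 : D 0 ≤ P) (hD : ∀ d (S : ShortComplex A), S.ShortExact → D (d + 1) S.X₁ → P S.X₂ → D d S.X₃)
    (d : ℕ) (K : CochainComplex A ℤ) (hK : starComplex A s K) (hKD : ∀ n, D d (K.X n)) :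
    ∃ (Y : StarHomotopyCat A s) (f : starObj K hK ⟶ Y),
      (starAcyclic A s).trW f ∧ starTermwise P s Y := by
  induction d generalizing K with
  | zero => exact ⟨_, 𝟙 _, MorphismProperty.id_mem _ _, fun n => h0 _ (hKD n)⟩
  | succ d ih =>
    -- All terms drop in dimension at once, so d steps suffice whatever the length of the complex,
    -- and no limit is needed in the unbounded case.
    obtain ⟨S, h₂, h₃, hS, rfl, hP₂, hz⟩ := exists_mono_termwise P hP K hK
    obtain ⟨Y, g, hg, hY⟩ := ih S.X₃ h₃ fun n =>
      hD d _ (hS.map_of_exact (HomologicalComplex.eval A _ n)) (hKD n) (hP₂ n)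
    obtain ⟨f, hf⟩ := exists_trW_shift hS hK h₂ h₃ hz
    refine ⟨Y⟦(-1 : ℤ)⟧, (shiftShiftNeg (starObj S.X₁ hK) (1 : ℤ)).inv ≫ (f ≫ g)⟦(-1 : ℤ)⟧',
      MorphismProperty.comp_mem _ _ _ (ObjectProperty.trW_of_isIso _ _)
        (MorphismProperty.shift _ (MorphismProperty.comp_mem _ _ _ hf hg) _),
      (starTermwise P s).le_shift _ _ hY⟩

theorem exists_termwise_coresolution
    (hP : ∀ X : A, ∃ (J : A) (p : J ⟶ X), Epi p ∧ P J) (D : ℕ → ObjectProperty A)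
    (h0 : D 0 ≤ P) (hD : ∀ d (S : ShortComplex A), S.ShortExact → D (d + 1) S.X₃ → P S.X₂ → D d S.X₁)
    (d : ℕ) (K : CochainComplex A ℤ) (hK : starComplex A s K) (hKD : ∀ n, D d (K.X n)) :
    ∃ (Y : StarHomotopyCat A s) (f : Y ⟶ starObj K hK),
      (starAcyclic A s).trW f ∧ starTermwise P s Y := by
  induction d generalizing K with
  | zero => exact ⟨_, 𝟙 _, MorphismProperty.id_mem _ _, fun n => h0 _ (hKD n)⟩
  | succ d ih =>
    obtain ⟨S, h₁, h₂, hS, rfl, hP₂, hz⟩ := exists_epi_termwise P hP K hK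
    obtain ⟨Y, g, hg, hY⟩ := ih S.X₁ h₁ fun n =>
      hD d _ (hS.map_of_exact (HomologicalComplex.eval A _ n)) (hKD n) (hP₂ n)
    obtain ⟨f, hf⟩ := exists_trW_shift hS h₁ h₂ hK hz
    exact ⟨Y⟦(1 : ℤ)⟧, g⟦(1 : ℤ)⟧' ≫ f,
      MorphismProperty.comp_mem _ _ _ (MorphismProperty.shift _ hg _) hf,
      (starTermwise P s).le_shift _ _ hY⟩

end Resolutions

/-! ### Acyclic complexes of adapted objects -/

section Acyclic

open Limits ZeroObject

variable {A : Type*} [Category* A] [Abelian A] {B : Type*} [Category* B] [Abelian B]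

lemma HomologicalComplex.iCycles_toCycles (K : CochainComplex A ℤ) (n m : ℤ) :
    K.iCycles n ≫ K.toCycles n m = 0 := by
  rw [← cancel_mono (K.iCycles m), Category.assoc, toCycles_i, iCycles_d, zero_comp]

/-- The short complex given by two consecutive objects of cycles. -/
noncomputable abbrev HomologicalComplex.cyclesShortComplex (K : CochainComplex A ℤ) (n m : ℤ) :
    ShortComplex A :=
  ShortComplex.mk (K.iCycles n) (K.toCycles n m) (K.iCycles_toCycles n m)

lemma HomologicalComplex.Acyclic.shortExact_cycles {K : CochainComplex A ℤ} (hK : K.Acyclic)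
    (n m : ℤ) (h : n + 1 = m) : (K.cyclesShortComplex n m).ShortExact where
  exact := by
    let S := ShortComplex.mk (K.iCycles n) (K.d n m) (by simp)
    let φ : K.cyclesShortComplex n m ⟶ S :=
      { τ₁ := 𝟙 _, τ₂ := 𝟙 _, τ₃ := K.iCycles m }
    rw [ShortComplex.exact_iff_of_epi_of_isIso_of_mono φ]
    exact S.exact_of_f_is_kernel (K.cyclesIsKernel n m (by simp [h]))
  epi_g := Preadditive.epi_of_isZero_cokernel' _
    (K.homologyIsCokernel n m (by simp [← h])) (hK m).isZero_homology

/-- The complex F(K) is spliced from the images of the sequences of cycles, so it is exact once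
these are. -/
lemma acyclic_map_of_cycles (F : A ⥤ B) [F.Additive] {K : CochainComplex A ℤ}
    (hF : ∀ n m, n + 1 = m → ((K.cyclesShortComplex n m).map F).ShortExact) :
    HomologicalComplex.Acyclic ((F.mapHomologicalComplex (.up ℤ)).obj K) := by
  intro m
  rw [HomologicalComplex.exactAt_iff' _ (m - 1) m (m + 1) (by simp) (by simp)]
  have h₁ := hF (m - 1) m (by simp)
  have h₂ := hF m (m + 1) rfl
  have h₃ := hF (m + 1) (m + 1 + 1) rfl
  let S : ShortComplex B := ShortComplex.mk (F.map (K.d (m - 1) m)) (F.map (K.d m (m + 1)))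
    (by rw [← F.map_comp, K.d_comp_d, F.map_zero])
  let S' : ShortComplex B := ShortComplex.mk (F.map (K.d (m - 1) m)) (F.map (K.toCycles m (m + 1)))
    (by rw [← F.map_comp, HomologicalComplex.d_toCycles, F.map_zero])
  -- Exactness is not affected by enlarging the target along the monomorphism F(Z^{m+1}) →
  -- F(K^{m+1}), nor by covering the source by the epimorphism F(K^{m-1}) → F(Z^m). This reduces two
  -- consecutive differentials to the sequence of cycles.
  let φ : S' ⟶ S :=
    { τ₁ := 𝟙 _, τ₂ := 𝟙 _, τ₃ := F.map (K.iCycles (m + 1))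
      comm₂₃ := by simp [S, S', ← F.map_comp] }
  let ψ : S' ⟶ (K.cyclesShortComplex m (m + 1)).map F :=
    { τ₁ := F.map (K.toCycles (m - 1) m), τ₂ := 𝟙 _, τ₃ := 𝟙 _
      comm₁₂ := (F.map_comp _ _).symm.trans
        ((congrArg F.map (K.toCycles_i (m - 1) m)).trans (Category.comp_id _).symm)
      comm₂₃ := (Category.id_comp _).trans (Category.comp_id _).symm }
  have : Epi ψ.τ₁ := h₁.epi_g
  have : Mono φ.τ₃ := h₃.mono_f
  have : IsIso φ.τ₂ := inferInstanceAs (IsIso (𝟙 _))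
  have : Epi φ.τ₁ := inferInstanceAs (Epi (𝟙 _))
  have : IsIso ψ.τ₂ := inferInstanceAs (IsIso (𝟙 _))
  have : Mono ψ.τ₃ := inferInstanceAs (Mono (𝟙 _))
  have h : S.Exact := (ShortComplex.exact_iff_of_epi_of_isIso_of_mono φ).1
    ((ShortComplex.exact_iff_of_epi_of_isIso_of_mono ψ).2 h₂.exact)
  exact h

/-- Each object of cycles is the quotient of the preceding term by the preceding cycles, which
lowers the dimension bound by one. The bound d holds in every degree, so going back d degrees leaves
dimension 0. -/
lemma prop_cycles_of_acyclic (P : ObjectProperty A) (D : ℕ → ObjectProperty A)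
    (hD : ∀ d (S : ShortComplex A), S.ShortExact → D (d + 1) S.X₁ → P S.X₂ → D d S.X₃)
    {K : CochainComplex A ℤ} (hK : K.Acyclic) (hP : ∀ n, P (K.X n)) (d : ℕ)
    (h : ∀ n, D d (K.cycles n)) (n : ℤ) : D 0 (K.cycles n) := by
  induction d generalizing n with
  | zero => exact h n
  | succ d ih =>
    exact ih (fun n => hD d _ (hK.shortExact_cycles (n - 1) n (by simp)) (h _) (hP _)) n

lemma prop_cycles_of_acyclic' (P : ObjectProperty A) (D : ℕ → ObjectProperty A)
    (hD : ∀ d (S : ShortComplex A), S.ShortExact → D (d + 1) S.X₃ → P S.X₂ → D d S.X₁)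
    {K : CochainComplex A ℤ} (hK : K.Acyclic) (hP : ∀ n, P (K.X n)) (d : ℕ)
    (h : ∀ n, D d (K.cycles n)) (n : ℤ) : D 0 (K.cycles n) := by
  induction d generalizing n with
  | zero => exact h n
  | succ d ih =>
    exact ih (fun n => hD d _ (hK.shortExact_cycles n (n + 1) rfl) (h _) (hP _)) n

lemma starAcyclic_starMap {s : DerivedSymbol} (F : A ⥤ B) [F.Additive] (P : ObjectProperty A)
    (hF : ∀ S : ShortComplex A, S.ShortExact → P S.X₁ → P S.X₂ → P S.X₃ → (S.map F).ShortExact)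
    (hP : ∀ K : CochainComplex A ℤ, K.Acyclic → (∀ n, P (K.X n)) → ∀ n, P (K.cycles n))
    (X : StarHomotopyCat A s) (hX : starTermwise P s X) (h : starAcyclic A s X) :
    starAcyclic B s ((starMap F s).obj X) := by
  obtain ⟨X, hs⟩ := X
  obtain ⟨K : CochainComplex A ℤ, rfl⟩ := HomotopyCategory.quotient_obj_surjective X
  replace h := (HomotopyCategory.quotient_obj_mem_subcategoryAcyclic_iff_acyclic K).1 h
  refine (HomotopyCategory.quotient_obj_mem_subcategoryAcyclic_iff_acyclic
    ((F.mapHomologicalComplex (.up ℤ)).obj K)).2 (acyclic_map_of_cycles F fun n m hnm => ?_)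
  exact hF _ (h.shortExact_cycles n m hnm) (hP K h hX n) (hX n) (hP K h hX m)

end Acyclic

/-! ### The formal criterion for a derived equivalence -/

section AdaptedEquivalence

open Limits

variable {A : Type*} [Category* A] [Abelian A] {B : Type*} [Category* B] [Abelian B]

/-- A natural transformation of additive functors induces isomorphisms between complexes whose
terms have isomorphisms as components. -/
noncomputable def starTermwiseIso {F G : A ⥤ A} [F.Additive] [G.Additive] (α : F ⟶ G)
    (P : ObjectProperty A) (hα : ∀ X, P X → IsIso (α.app X)) (s : DerivedSymbol) :
    (starTermwise P s).ι ⋙ starMap F s ≅ (starTermwise P s).ι ⋙ starMap G s :=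
  NatIso.ofComponents (fun X => (starK A s).isoMk
    ((HomotopyCategory.quotient A (.up ℤ)).mapIso
      (haveI (n : ℤ) : IsIso (((NatTrans.mapHomologicalComplex α (.up ℤ)).app X.obj.obj.as).f n) :=
        hα _ (X.property n)
      haveI : IsIso ((NatTrans.mapHomologicalComplex α (.up ℤ)).app X.obj.obj.as) :=
        HomologicalComplex.Hom.isIso_of_components _
      asIso ((NatTrans.mapHomologicalComplex α (.up ℤ)).app X.obj.obj.as))))
    fun {X Y} f => by
      ext1
      exact (NatTrans.mapHomotopyCategory α (.up ℤ)).naturality f.hom.hom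

/-- The functor induced by a composition of additive functors. -/
noncomputable def starMapComp (F : A ⥤ B) [F.Additive] (G : B ⥤ A) [G.Additive]
    (s : DerivedSymbol) : starMap F s ⋙ starMap G s ≅ starMap (F ⋙ G) s :=
  NatIso.ofComponents (fun X => Iso.refl _) fun {X Y} f => by
    obtain ⟨f, rfl⟩ := (starK A s).homMk_surjective f
    obtain ⟨f, rfl⟩ := (HomotopyCategory.quotient A (.up ℤ)).map_surjective f
    exact (Category.comp_id _).trans (Category.id_comp _).symm

variable (A) in
/-- The functor induced by the identity functor. -/
noncomputable def starMapId (s : DerivedSymbol) : starMap (𝟭 A) s ≅ 𝟭 _ :=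
  NatIso.ofComponents (fun X => Iso.refl _) fun {X Y} f => by
    obtain ⟨f, rfl⟩ := (starK A s).homMk_surjective f
    obtain ⟨f, rfl⟩ := (HomotopyCategory.quotient A (.up ℤ)).map_surjective f
    exact (Category.comp_id _).trans (Category.id_comp _).symm

/-- Here `D d` and `E d` stand for dimension at most d relative to P and Q; a shift in one direction
and a uniform bound are all that is used of them. The bound gives both adapted resolutions and
preservation of acyclicity, while the unit and counit give the isomorphisms of composites degree by
degree. -/
theorem exists_derived_equivalence_of_adapted [HasDerivedCategory A] [HasDerivedCategory B]
    {F : A ⥤ B} [F.Additive] {G : B ⥤ A} [G.Additive] (adj : G ⊣ F)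
    (P : ObjectProperty A) [P.IsClosedUnderIsomorphisms] [P.ContainsZero]
    [P.IsClosedUnderBinaryProducts]
    (Q : ObjectProperty B) [Q.IsClosedUnderIsomorphisms] [Q.ContainsZero]
    [Q.IsClosedUnderBinaryProducts]
    (hP : ∀ X : A, ∃ (J : A) (i : X ⟶ J), Mono i ∧ P J)
    (hQ : ∀ X : B, ∃ (J : B) (p : J ⟶ X), Epi p ∧ Q J)
    (D : ℕ → ObjectProperty A) (hD0 : D 0 ≤ P)
    (hD : ∀ d (S : ShortComplex A), S.ShortExact → D (d + 1) S.X₁ → P S.X₂ → D d S.X₃)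
    (hD' : ∃ d, ∀ X, D d X)
    (E : ℕ → ObjectProperty B) (hE0 : E 0 ≤ Q)
    (hE : ∀ d (S : ShortComplex B), S.ShortExact → E (d + 1) S.X₃ → Q S.X₂ → E d S.X₁)
    (hE' : ∃ d, ∀ X, E d X)
    (hF : ∀ S : ShortComplex A, S.ShortExact → P S.X₁ → P S.X₂ → P S.X₃ → (S.map F).ShortExact)
    (hG : ∀ S : ShortComplex B, S.ShortExact → Q S.X₁ → Q S.X₂ → Q S.X₃ → (S.map G).ShortExact)
    (hPQ : ∀ X, P X → Q (F.obj X)) (hQP : ∀ X, Q X → P (G.obj X))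
    (hcounit : ∀ X, P X → IsIso (adj.counit.app X)) (hunit : ∀ X, Q X → IsIso (adj.unit.app X))
    (s : DerivedSymbol) :
    ∃ (e : StarDerivedCat A s ≌ StarDerivedCat B s)
      (_ : e.functor.CommShift ℤ) (_ : e.inverse.CommShift ℤ),
      IsRightDerived F s e.functor ∧ IsLeftDerived G s e.inverse := by
  obtain ⟨d, hd⟩ := hD'
  obtain ⟨d', hd'⟩ := hE'
  refine exists_derived_equivalence F G s (starTermwise P s) ?_ ?_ (starTermwise Q s) ?_ ?_
    (fun X hX n => hPQ _ (hX n)) (fun X hX n => hQP _ (hX n)) ?_ ?_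
  · rintro ⟨X, hX⟩
    exact exists_termwise_resolution P s hP D hD0 hD d X.as hX fun n => hd _
  · exact starAcyclic_starMap F P hF fun K hK hKP n =>
      hD0 _ (prop_cycles_of_acyclic P D hD hK hKP d (fun n => hd _) n)
  · rintro ⟨X, hX⟩
    exact exists_termwise_coresolution Q s hQ E hE0 hE d' X.as hX fun n => hd' _
  · exact starAcyclic_starMap G Q hG fun K hK hKQ n =>
      hE0 _ (prop_cycles_of_acyclic' Q E hE hK hKQ d' (fun n => hd' _) n)
  · exact Functor.isoWhiskerLeft _ (starMapComp F G s) ≪≫ starTermwiseIso adj.counit P hcounit s ≪≫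
      Functor.isoWhiskerLeft _ (starMapId A s) ≪≫ Functor.rightUnitor _
  · exact Functor.isoWhiskerLeft _ (starMapComp G F s) ≪≫ (starTermwiseIso adj.unit Q hunit s).symm ≪≫
      Functor.isoWhiskerLeft _ (starMapId B s) ≪≫ Functor.rightUnitor _

end AdaptedEquivalence

/-! ### Densities, and measures on products -/

namespace Contra

variable {k : Type*} [Field k] {X : Type*} [TopologicalSpace X]
  {V : Type*} [AddCommGroup V] [Module k V]
  {Y : Type*} [TopologicalSpace Y] {W : Type*} [AddCommGroup W] [Module k W]
  {W' : Type*} [AddCommGroup W'] [Module k W']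

open Classical in
/-- The restriction of a locally constant function to an open-closed set, extended by zero. -/
noncomputable def restrictFun {T : Type*} [Zero T] (F : LocallyConstant X T) (A : Clopens X) :
    LocallyConstant X T where
  toFun x := if x ∈ A then F x else 0
  isLocallyConstant := by
    have h : IsLocallyConstant fun x => x ∈ A := by
      rw [IsLocallyConstant.iff_exists_open]
      intro x
      by_cases hx : x ∈ A
      · exact ⟨A, A.isClopen.2, hx, fun y hy => propext ⟨fun _ => hx, fun _ => hy⟩⟩
      · exact ⟨(A : Set X)ᶜ, A.isClopen.1.isOpen_compl, hx,
          fun y hy => propext ⟨fun h => (hy h).elim, fun h => (hx h).elim⟩⟩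
    exact (h.prodMk F.isLocallyConstant).comp fun p : Prop × T => if p.1 then p.2 else 0

open Classical in
lemma restrictFun_apply {T : Type*} [Zero T] (F : LocallyConstant X T) (A : Clopens X) (x : X) :
    restrictFun F A x = if x ∈ A then F x else 0 := rfl

namespace Meas

lemma integral_eq_zero (F : LocallyConstant X (V →ₗ[k] W)) {μ : Meas k X V} {K : Set X}
    (hμ : SupportedOn K μ.1) (hF : ∀ x ∈ K, F x = 0) : integral F μ = 0 := by
  rw [integral_eq_sum hμ F {0} (fun x hx => by simp [hF x hx]) id F fun _ => rfl]
  simp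

lemma integral_restrictFun_const (T : V →ₗ[k] W) (B : Clopens X) (μ : Meas k X V) :
    integral (restrictFun (LocallyConstant.const X T) B) μ = T (μ.1 B) := by
  classical
  obtain ⟨K, hK, hμ⟩ := μ.2.2
  let c : LocallyConstant X ℕ := restrictFun (LocallyConstant.const X 1) B
  have hc : ∀ x, c x = if x ∈ B then 1 else 0 := fun x => rfl
  rw [integral_eq_sum hμ c {0, 1} (fun x _ => by rw [hc]; split_ifs <;> simp)
    (fun n => if n = 0 then 0 else T) _ (fun x => by
      rw [restrictFun_apply, hc]; split_ifs <;> simp_all)]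
  rw [Finset.sum_pair (by simp)]
  have : fiber c 1 = B := by
    ext x
    show c x = 1 ↔ x ∈ B
    rw [hc]; split_ifs <;> simp_all
  simp [this]

lemma integral_congr_fun {F F' : LocallyConstant X (V →ₗ[k] W)} (h : ∀ x, F x = F' x)
    (μ : Meas k X V) : integral F μ = integral F' μ := by
  rw [LocallyConstant.ext h]

/-- The measure `A ↦ ∫_A F dμ`. -/
noncomputable def dens (F : LocallyConstant X (V →ₗ[k] W)) : Meas k X V →ₗ[k] Meas k X W where
  toFun μ := ⟨fun A => integral (restrictFun F A) μ, fun A B h => by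
      refine integral_add_fun _ _ _ (fun x => ?_) μ
      simp only [restrictFun_apply]
      have : x ∈ A → x ∉ B := fun h1 h2 => Set.disjoint_left.1 h h1 h2
      have h' : x ∈ A ⊔ B ↔ x ∈ A ∨ x ∈ B := Iff.rfl
      by_cases h1 : x ∈ A <;> by_cases h2 : x ∈ B <;> simp_all, by
    obtain ⟨K, hK, h⟩ := μ.2.2
    refine ⟨K, hK, fun A hA => integral_eq_zero _ h fun x hx => ?_⟩
    have : x ∉ A := fun h => Set.disjoint_left.1 hA h hx
    rw [restrictFun_apply, if_neg this]⟩
  map_add' μ ν := Meas.ext fun A => integral_add _ μ ν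
  map_smul' a μ := Meas.ext fun A => integral_smul _ a μ

lemma dens_apply (F : LocallyConstant X (V →ₗ[k] W)) (μ : Meas k X V) (A : Clopens X) :
    (dens F μ).1 A = integral (restrictFun F A) μ := rfl

lemma dens_dirac (F : LocallyConstant X (V →ₗ[k] W)) (x : X) (v : V) :
    dens F (dirac x v) = dirac x (F x v) := by
  classical
  refine Meas.ext fun A => ?_
  rw [dens_apply, integral_dirac, restrictFun_apply]
  show _ = if _ then _ else _
  split_ifs <;> rfl

lemma dens_push (φ : C(X, Y)) (F : LocallyConstant Y (V →ₗ[k] W))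
    (F' : LocallyConstant X (V →ₗ[k] W)) (h : ∀ x, F' x = F (φ x)) (μ : Meas k X V) :
    dens F (push φ μ) = push φ (dens F' μ) := by
  refine Meas.ext fun A => integral_push φ _ _ (fun x => ?_) μ
  simp only [restrictFun_apply, h]
  rfl

lemma dens_const (T : V →ₗ[k] W) (μ : Meas k X V) :
    dens (LocallyConstant.const X T) μ = map T μ :=
  Meas.ext fun A => integral_restrictFun_const T A μ

lemma map_dens (L : W →ₗ[k] W') (F : LocallyConstant X (V →ₗ[k] W))
    (F' : LocallyConstant X (V →ₗ[k] W')) (h : ∀ x, F' x = L ∘ₗ F x) (μ : Meas k X V) :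
    map L (dens F μ) = dens F' μ := by
  refine Meas.ext fun A => (integral_comp L _ _ (fun x => ?_) μ).symm
  simp only [restrictFun_apply, h]
  split_ifs <;> simp

lemma dens_map (f : V →ₗ[k] W) (F : LocallyConstant X (W →ₗ[k] W'))
    (F' : LocallyConstant X (V →ₗ[k] W')) (h : ∀ x, F' x = F x ∘ₗ f) (μ : Meas k X V) :
    dens F (map f μ) = dens F' μ := by
  refine Meas.ext fun A => integral_map f _ _ (fun x => ?_) μ
  simp only [restrictFun_apply, h]
  split_ifs <;> simp

/-- The restriction of a measure to an open-closed set. -/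
def restrict (C : Clopens X) : Meas k X V →ₗ[k] Meas k X V where
  toFun μ := ⟨fun A => μ.1 (A ⊓ C), fun A B h => by
      rw [← μ.2.1 _ _ (by exact h.mono inf_le_left inf_le_left)]
      exact congrArg μ.1 (inf_sup_right _ _ _), by
    obtain ⟨K, hK, h⟩ := μ.2.2
    exact ⟨K, hK, fun A hA => h _ (hA.mono_left Set.inter_subset_left)⟩⟩
  map_add' _ _ := rfl
  map_smul' _ _ := rfl

/-- A finitely additive function on the open-closed subsets of a compact space, as a measure. -/
def ofCompact [CompactSpace X] (m : Clopens X → V)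
    (h : ∀ A B : Clopens X, Disjoint (A : Set X) B → m (A ⊔ B) = m A + m B) : Meas k X V :=
  ⟨m, h, Set.univ, isCompact_univ, fun A hA => by
    have hA : A = ⊥ := Clopens.ext (by simpa using hA)
    subst hA
    simpa using h ⊥ ⊥ (by simp)⟩

/-- The sections of an open-closed subset of a product with a compact factor. -/
def sectionFun [CompactSpace X] (C : Clopens (X × Y)) : LocallyConstant Y (Clopens X) where
  toFun y := clopenPreimage ⟨fun x => (x, y), by fun_prop⟩ C
  isLocallyConstant := by
    rw [IsLocallyConstant.iff_isOpen_fiber]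
    intro D
    have hU : IsClopen {z : X × Y | z ∈ C ↔ z.1 ∈ D} := by
      have : {z : X × Y | z ∈ C ↔ z.1 ∈ D} = ((C : Set (X × Y)) ∩ Prod.fst ⁻¹' D) ∪
          ((C : Set (X × Y))ᶜ ∩ (Prod.fst ⁻¹' D)ᶜ) := by
        ext z
        simp only [Set.mem_ofPred_eq, Set.mem_union, Set.mem_inter_iff, SetLike.mem_coe,
          Set.mem_preimage, Set.mem_compl_iff]
        tauto
      rw [this]
      have hD : IsClopen (Prod.fst ⁻¹' (D : Set X) : Set (X × Y)) :=
        D.isClopen.preimage continuous_fst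
      exact (C.isClopen.inter hD).union (C.isClopen.compl.inter hD.compl)
    -- The sections that differ from D lie over the projection of a clopen set, and projection along
    -- the compact factor is closed.
    have h := (isClosedMap_snd_of_compactSpace (X := X) (Y := Y)) _ hU.compl.1
    convert h.isOpen_compl using 1
    ext y
    simp only [Set.mem_preimage, Set.mem_singleton_iff, Set.mem_compl_iff, Set.mem_image,
      Set.mem_ofPred_eq, not_exists, not_and]
    constructor
    · rintro rfl ⟨x, y'⟩ hz rfl
      exact hz Iff.rfl
    · intro h
      ext x
      by_contra hx
      exact h (x, y) hx rfl

/-- The evaluation of measures at an open-closed set. -/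
def eval (A : Clopens X) : Meas k X V →ₗ[k] V where
  toFun μ := μ.1 A
  map_add' _ _ := rfl
  map_smul' _ _ := rfl

@[simp] lemma eval_apply (A : Clopens X) (μ : Meas k X V) : eval A μ = μ.1 A := rfl

/-- For compact spaces, a measure with values in measures gives a measure on the product. -/
noncomputable def uncurry [CompactSpace X] [CompactSpace Y] (m : Meas k Y (Meas k X V)) :
    Meas k (X × Y) V :=
  ofCompact (fun C => integral ((sectionFun C).map fun A => eval A) m) fun C D h => by
    refine integral_add_fun _ _ _ (fun y => ?_) m
    ext μ
    show μ.1 _ = μ.1 _ + μ.1 _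
    refine (μ.2.1 (sectionFun C y) (sectionFun D y) ?_)
    exact Set.disjoint_left.2 fun x hx hx' => Set.disjoint_left.1 h hx hx'

lemma uncurry_apply [CompactSpace X] [CompactSpace Y] (m : Meas k Y (Meas k X V))
    (C : Clopens (X × Y)) :
    (uncurry m).1 C = integral ((sectionFun C).map fun A => eval A) m := rfl

/-- The section of a rectangle A × B over y is A or empty according to whether y ∈ B. By this lemma
contraassociativity applies to any measure with values in measures on a compact group. -/
lemma curry_uncurry [CompactSpace X] [CompactSpace Y] (m : Meas k Y (Meas k X V)) :
    curry (uncurry m) = m := by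
  refine Meas.ext fun B => Meas.ext fun A => ?_
  rw [curry_apply, uncurry_apply, ← eval_apply, ← integral_restrictFun_const]
  refine integral_congr_fun (fun y => ?_) m
  rw [restrictFun_apply]
  ext μ
  show μ.1 _ = _
  split_ifs with hy
  · refine congrArg μ.1 (Clopens.ext (Set.ext fun x => ?_))
    exact and_iff_left hy
  · refine Eq.trans (congrArg μ.1 (Clopens.ext (Set.ext fun x => ?_))) (apply_bot μ)
    exact iff_of_false (fun h => hy h.2) (fun h => h)

end Meas

end Contra

/-! ### Exact sequences of smooth modules and of contramodules -/

namespace GSmooth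

variable {k G : Type u} [Field k] [Group G] [TopologicalSpace G]

/-- The linear map underlying a morphism of smooth modules. -/
def lin {M N : GSmooth k G} (f : M ⟶ N) : M.obj.V →ₗ[k] N.obj.V := f.hom.hom.toLinearMap

variable {M N K : GSmooth k G}

lemma lin_comm (f : M ⟶ N) (g : G) (m : M.obj.V) : lin f (M.obj.ρ g m) = N.obj.ρ g (lin f m) :=
  Rep.hom_comm_apply f.hom g m

lemma hom_ext' {f g : M ⟶ N} (h : ∀ m, lin f m = lin g m) : f = g := by
  apply ObjectProperty.hom_ext
  apply Rep.hom_ext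
  apply Representation.IntertwiningMap.ext
  exact LinearMap.ext h

/-- A smooth representation as an object of the category of smooth modules. -/
def of {V : Type u} [AddCommGroup V] [Module k V] (ρ : Representation k G V)
    (h : IsSmoothRep ρ) : GSmooth k G := ⟨Rep.of ρ, h⟩

/-- A morphism of smooth modules given by an equivariant linear map. -/
def homOf (f : M.obj.V →ₗ[k] N.obj.V) (h : ∀ g m, f (M.obj.ρ g m) = N.obj.ρ g (f m)) : M ⟶ N :=
  ObjectProperty.homMk (Rep.ofHom { toLinearMap := f, isIntertwining' := fun g => LinearMap.ext (h g) })

lemma mono_of_injective (f : M ⟶ N) (h : Function.Injective (lin f)) : Mono f where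
  right_cancellation a b hab := hom_ext' fun m => h (by
    have := congrArg (fun t => lin t m) hab
    exact this)

lemma epi_of_surjective (f : M ⟶ N) (h : Function.Surjective (lin f)) : Epi f where
  left_cancellation a b hab := hom_ext' fun n => by
    obtain ⟨m, rfl⟩ := h n
    exact congrArg (fun t => lin t m) hab

lemma ker_stable (f : M ⟶ N) (g : G) (m : M.obj.V) (hm : m ∈ LinearMap.ker (lin f)) :
    M.obj.ρ g m ∈ LinearMap.ker (lin f) := by
  rw [LinearMap.mem_ker] at *
  rw [lin_comm, hm, map_zero]

lemma range_stable (f : M ⟶ N) (g : G) :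
    LinearMap.range (lin f) ≤ (LinearMap.range (lin f)).comap (N.obj.ρ g) := by
  rintro _ ⟨m, rfl⟩
  exact ⟨M.obj.ρ g m, lin_comm f g m⟩

lemma exists_lift_of_injective (f : M ⟶ N) (hf : Function.Injective (lin f)) (t : K ⟶ N)
    (ht : ∀ x, lin t x ∈ LinearMap.range (lin f)) : ∃ l : K ⟶ M, l ≫ f = t := by
  let l : K.obj.V →ₗ[k] M.obj.V := (LinearEquiv.ofInjective (lin f) hf).symm.toLinearMap ∘ₗ
    (lin t).codRestrict (LinearMap.range (lin f)) ht
  have hl : ∀ x, lin f (l x) = lin t x := fun x =>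
    congrArg Subtype.val ((LinearEquiv.ofInjective (lin f) hf).apply_symm_apply ⟨lin t x, ht x⟩)
  exact ⟨homOf l fun g x => hf (by rw [hl, lin_comm, lin_comm, hl]), hom_ext' hl⟩

variable [IsTopologicalGroup G]

/-- The subrepresentation on an invariant subspace of a smooth module. -/
def sub (M : GSmooth k G) (S : Submodule k M.obj.V) (hS : ∀ g, ∀ m ∈ S, M.obj.ρ g m ∈ S) :
    GSmooth k G :=
  of (V := S)
    { toFun := fun g => (M.obj.ρ g).restrict (hS g)
      map_one' := by ext; simp
      map_mul' := fun a b => by ext; simp }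
    (fun v => isOpen_stab_of_le _ v (vecStab M.obj.ρ v.1) (M.property v.1)
      fun g hg => Subtype.ext hg)

/-- The inclusion of a subrepresentation. -/
def subι (M : GSmooth k G) (S : Submodule k M.obj.V) (hS : ∀ g, ∀ m ∈ S, M.obj.ρ g m ∈ S) :
    M.sub S hS ⟶ M :=
  homOf S.subtype fun _ _ => rfl

/-- The quotient representation by an invariant subspace of a smooth module. -/
def quot (M : GSmooth k G) (S : Submodule k M.obj.V) (hS : ∀ g, S ≤ S.comap (M.obj.ρ g)) :
    GSmooth k G :=
  of (V := M.obj.V ⧸ S)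
    { toFun := fun g => S.mapQ S (M.obj.ρ g) (hS g)
      map_one' := by apply Submodule.linearMap_qext; ext; simp
      map_mul' := fun a b => by apply Submodule.linearMap_qext; ext; simp }
    (fun v => by
      obtain ⟨v, rfl⟩ := S.mkQ_surjective v
      exact isOpen_stab_map M.obj.ρ _ S.mkQ (fun g v => rfl) (M.property v))

/-- The projection to a quotient representation. -/
def quotπ (M : GSmooth k G) (S : Submodule k M.obj.V) (hS : ∀ g, S ≤ S.comap (M.obj.ρ g)) :
    M ⟶ M.quot S hS :=
  homOf S.mkQ fun _ _ => rfl

lemma injective_of_mono (f : M ⟶ N) [Mono f] : Function.Injective (lin f) := by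
  rw [← LinearMap.ker_eq_bot, eq_bot_iff]
  intro x hx
  have h : M.subι (LinearMap.ker (lin f)) (ker_stable f) = 0 := by
    rw [← cancel_mono f, Limits.zero_comp]
    exact hom_ext' fun x => x.2
  exact congrArg (fun h : M.sub _ (ker_stable f) ⟶ M => lin h ⟨x, hx⟩) h

lemma surjective_of_epi (f : M ⟶ N) [Epi f] : Function.Surjective (lin f) := by
  have h : N.quotπ (LinearMap.range (lin f)) (range_stable f) = 0 := by
    rw [← cancel_epi f, Limits.comp_zero]
    exact hom_ext' fun x => (Submodule.Quotient.mk_eq_zero _).2 ⟨x, rfl⟩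
  intro x
  have := congrArg (fun h => lin h x) h
  exact (Submodule.Quotient.mk_eq_zero _).1 this

lemma isIso_of_bijective (f : M ⟶ N) (h : Function.Bijective (lin f)) : IsIso f := by
  have := mono_of_injective f h.1
  have := epi_of_surjective f h.2
  exact isIso_of_mono_of_epi f

lemma bijective_of_isIso (f : M ⟶ N) [IsIso f] : Function.Bijective (lin f) :=
  ⟨injective_of_mono f, surjective_of_epi f⟩

-- Kernels and cokernels are those of the underlying vector spaces. Only one inclusion is listed,
-- the other being part of `S`.
open Limits in
lemma shortExact_iff (S : ShortComplex (GSmooth k G)) :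
    S.ShortExact ↔ Function.Injective (lin S.f) ∧ Function.Surjective (lin S.g) ∧
      LinearMap.ker (lin S.g) ≤ LinearMap.range (lin S.f) := by
  constructor
  · intro h
    have := h.mono_f
    have := h.epi_g
    refine ⟨injective_of_mono _, surjective_of_epi _, fun x hx => ?_⟩
    have h0 : S.X₂.subι (LinearMap.ker (lin S.g)) (ker_stable S.g) ≫ S.g = 0 :=
      hom_ext' fun x => x.2
    have h1 := h.exact.lift_f _ h0
    exact ⟨_, congrArg (fun t : S.X₂.sub _ (ker_stable S.g) ⟶ S.X₂ => lin t ⟨x, hx⟩) h1⟩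
  · rintro ⟨h1, h2, h3⟩
    have := mono_of_injective _ h1
    have := epi_of_surjective _ h2
    have lift : ∀ {T : GSmooth k G} (t : T ⟶ S.X₂), t ≫ S.g = 0 → ∃ l : T ⟶ S.X₁, l ≫ S.f = t :=
      fun t ht => exists_lift_of_injective _ h1 t fun x => h3 (congrArg (fun t => lin t x) ht)
    exact .mk' (S.exact_of_f_is_kernel (KernelFork.IsLimit.ofι _ _
      (fun t ht => (lift t ht).choose) (fun t ht => (lift t ht).choose_spec)
      (fun t ht m hm => by rw [← cancel_mono S.f, hm, (lift t ht).choose_spec]))) ‹_› ‹_›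

end GSmooth

namespace GContra

variable {k G : Type u} [Field k] [Group G] [TopologicalSpace G] [IsTopologicalGroup G]
  {P Q R : GContra k G}

lemma mono_of_injective (f : P ⟶ Q) (h : Function.Injective f.lin) : Mono f where
  right_cancellation a b hab := hom_ext (LinearMap.ext fun m => h (by
    have := congrArg (fun t => Hom.lin t m) hab
    exact this))

lemma isIso_of_bijective (f : P ⟶ Q) (h : Function.Bijective f.lin) : IsIso f := by
  have := mono_of_injective f h.1
  have := epi_of_surj f h.2
  exact isIso_of_mono_of_epi f

lemma bijective_of_isIso (f : P ⟶ Q) [IsIso f] : Function.Bijective f.lin :=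
  ⟨injective_of_mono f, surjective_of_epi f⟩

open Limits in
lemma shortExact_iff (S : ShortComplex (GContra k G)) :
    S.ShortExact ↔ Function.Injective S.f.lin ∧ Function.Surjective S.g.lin ∧
      LinearMap.ker S.g.lin ≤ LinearMap.range S.f.lin := by
  constructor
  · intro h
    have := h.mono_f
    have := h.epi_g
    refine ⟨injective_of_mono _, surjective_of_epi _, fun x hx => ?_⟩
    have h0 : S.X₂.subι _ (ker_stable S.g) ≫ S.g = 0 := by ext x; exact x.2
    have h1 := h.exact.lift_f _ h0
    exact ⟨_, congrArg (fun t : S.X₂.sub _ (ker_stable S.g) ⟶ S.X₂ => t.lin ⟨x, hx⟩) h1⟩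
  · rintro ⟨h1, h2, h3⟩
    have := mono_of_injective _ h1
    have := epi_of_surj _ h2
    exact .mk' (S.exact_of_f_is_kernel (isLimitOfInj _ _ S.zero h1 h3)) ‹_› ‹_›

end GContra

/-! ### Restriction to a subgroup -/

section Restriction

variable {k G : Type u} [Field k] [Group G] [TopologicalSpace G] [IsTopologicalGroup G]
  (H : Subgroup G)

variable (k) in
/-- The restriction of smooth modules to a subgroup. -/
def GSmooth.res : GSmooth k G ⥤ GSmooth k H where
  obj M := GSmooth.of (M.obj.ρ.comp H.subtype) fun v =>
    (M.property v).preimage continuous_subtype_val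
  map f := GSmooth.homOf (M := GSmooth.of _ _) (N := GSmooth.of _ _)
    (GSmooth.lin f :)
    fun g m => GSmooth.lin_comm f g m
  map_id _ := rfl
  map_comp _ _ := rfl

instance : (GSmooth.res k H).Additive where
  map_add := rfl

lemma GSmooth.shortExact_res {S : ShortComplex (GSmooth k G)} (hS : S.ShortExact) :
    (S.map (GSmooth.res k H)).ShortExact :=
  (GSmooth.shortExact_iff _).2 (by exact (GSmooth.shortExact_iff S).1 hS)

namespace Contra

/-- The inclusion of a subgroup as a continuous map. -/
def inclMap : C(H, G) := ⟨Subtype.val, continuous_subtype_val⟩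

variable {H} in
lemma push_mul_incl {V : Type*} [AddCommGroup V] [Module k V] (μ : Meas k (H × H) V) :
    Meas.push (inclMap H) (Meas.push (mulMap H) μ) =
      Meas.push (mulMap G) (Meas.push ((inclMap H).prodMap (inclMap H)) μ) := rfl

end Contra

variable (k) in
/-- The restriction of contramodules to a subgroup. -/
def GContra.res : GContra k G ⥤ GContra k H where
  obj P :=
    { V := P.V
      act := P.act ∘ₗ Contra.Meas.push (Contra.inclMap H)
      act_assoc := fun μ => by
        show P.act (Contra.Meas.push _ (Contra.Meas.push _ μ)) = _
        rw [Contra.push_mul_incl, P.act_assoc]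
        rfl
      act_unit := fun x => by
        rw [LinearMap.comp_apply]
        have : Contra.Meas.push (Contra.inclMap H) (Contra.Meas.dirac (k := k) 1 x) =
          Contra.Meas.dirac 1 x := rfl
        rw [this, P.act_unit] }
  map f := ⟨f.lin, fun μ => f.comm _⟩
  map_id _ := rfl
  map_comp _ _ := rfl

instance : (GContra.res k H).Additive where
  map_add := rfl

lemma GContra.shortExact_res {S : ShortComplex (GContra k G)} (hS : S.ShortExact) :
    (S.map (GContra.res k H)).ShortExact :=
  (GContra.shortExact_iff _).2 (by exact (GContra.shortExact_iff S).1 hS)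

end Restriction

/-! ### Coinduced modules -/

namespace GSmooth

/-- Inverting representatives of left cosets decomposes G into the right cosets H c⁻¹, as needed for
functions under left translation by H. -/
lemma inv_out_mul_mem {G : Type*} [Group G] {H : Subgroup G} (x : G) : x * (QuotientGroup.mk x⁻¹ : G ⧸ H).out ∈ H := by
  have := QuotientGroup.eq.1 (QuotientGroup.out_eq' (QuotientGroup.mk x⁻¹ : G ⧸ H)).symm
  simpa using this

variable (k G : Type u) [Field k] [Group G] [TopologicalSpace G]

/-- The left translation action of `G` on all functions on `G`. -/
def funRep (V : Type u) [AddCommGroup V] [Module k V] : Representation k G (G → V) where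
  toFun g :=
    { toFun := fun f x => f (g⁻¹ * x)
      map_add' := fun _ _ => rfl
      map_smul' := fun _ _ => rfl }
  map_one' := by ext; simp
  map_mul' a b := by ext; simp [mul_assoc]

variable [IsTopologicalGroup G]

/-- The subspace of functions on `G` with open stabilizers with respect to left translations. -/
def smoothFun (V : Type u) [AddCommGroup V] [Module k V] : Submodule k (G → V) where
  carrier := {f | IsOpen {g : G | funRep k G V g f = f}}
  add_mem' := isOpen_stab_add _
  zero_mem' := by simp
  smul_mem' c f hf := isOpen_stab_map (funRep k G V) _ (fun f => c • f)
    (fun g f => (map_smul _ c f).symm) hf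

/-- The smooth module of functions `G → V` with open stabilizers with respect to left
translations. It is the smooth module coinduced from the trivial subgroup. -/
def coind (V : Type u) [AddCommGroup V] [Module k V] : GSmooth k G :=
  of (V := smoothFun k G V)
    { toFun := fun g => (funRep k G V g).restrict fun f hf => by
        -- The stabilizer of the translate by g is the conjugate by g of the stabilizer.
        have h := Homeomorph.isOpen_preimage
          ((Homeomorph.mulLeft g⁻¹).trans (Homeomorph.mulRight g)) |>.2 hf
        refine isOpen_stab_of_le _ _ ((vecStab (funRep k G V) f).map (MulAut.conj g).toMonoidHom)
          ?_ ?_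
        · convert h using 1
          ext x
          simp only [Subgroup.coe_map, Set.mem_image, Set.mem_preimage]
          constructor
          · rintro ⟨y, hy, rfl⟩
            simp only [MulEquiv.coe_toMonoidHom]
            have hy : funRep k G V y f = f := hy
            simpa [mul_assoc] using hy
          · intro hx
            exact ⟨_, hx, by simp [mul_assoc]⟩
        · rintro _ ⟨y, hy, rfl⟩
          have hy : funRep k G V y f = f := hy
          conv_rhs => rw [← hy]
          rw [← Module.End.mul_apply, ← Module.End.mul_apply, ← map_mul, ← map_mul]
          simp
      map_one' := by ext; simp
      map_mul' := fun a b => LinearMap.ext fun f => Subtype.ext (by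
        show funRep k G V (a * b) f.1 = _
        rw [map_mul]
        rfl) }
    (fun v => isOpen_stab_of_le _ v (vecStab (funRep k G V) v.1) v.2 fun g hg => Subtype.ext hg)

variable {k G} {V : Type u} [AddCommGroup V] [Module k V]

lemma coind_rho_apply (g : G) (f : (coind k G V).obj.V) (x : G) :
    ((coind k G V).obj.ρ g f).1 x = f.1 (g⁻¹ * x) := rfl

/-- The morphism to a coinduced module that corresponds to a linear map. -/
def toCoind {N : GSmooth k G} (l : N.obj.V →ₗ[k] V) : N ⟶ coind k G V :=
  homOf (N := coind k G V)
    (LinearMap.codRestrict (smoothFun k G V) (LinearMap.pi fun x => l ∘ₗ N.obj.ρ x⁻¹)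
      fun n => isOpen_stab_map N.obj.ρ (funRep k G V)
        (LinearMap.pi fun x => l ∘ₗ N.obj.ρ x⁻¹) (fun g v => by
          ext x
          show l (N.obj.ρ x⁻¹ (N.obj.ρ g v)) = l (N.obj.ρ (g⁻¹ * x)⁻¹ v)
          simp) (N.property n))
    (fun g v => by
      refine Subtype.ext (funext fun x => ?_)
      show l (N.obj.ρ x⁻¹ (N.obj.ρ g v)) = l (N.obj.ρ (g⁻¹ * x)⁻¹ v)
      simp)

lemma toCoind_apply {N : GSmooth k G} (l : N.obj.V →ₗ[k] V) (n : N.obj.V) (x : G) :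
    (lin (toCoind l) n).1 x = l (N.obj.ρ x⁻¹ n) := rfl

variable (k G V) in
/-- The evaluation at the unit. -/
def coindEval : (coind k G V).obj.V →ₗ[k] V where
  toFun f := f.1 1
  map_add' _ _ := rfl
  map_smul' _ _ := rfl

lemma coindEval_apply (f : (coind k G V).obj.V) : coindEval k G V f = f.1 1 := rfl

/-- Frobenius reciprocity: f(n)(x) is the value at 1 of x⁻¹f(n) = f(x⁻¹n), so evaluation at 1 loses
nothing. -/
lemma toCoind_coindEval {N : GSmooth k G} (f : N ⟶ coind k G V) :
    toCoind (coindEval k G V ∘ₗ lin f) = f := by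
  refine hom_ext' fun n => Subtype.ext (funext fun x => ?_)
  rw [toCoind_apply, LinearMap.comp_apply, lin_comm, coindEval_apply, coind_rho_apply]
  simp

/-- By reciprocity, morphisms to a coinduced module are linear maps to V, and linear maps extend
along injections of vector spaces. -/
instance injective_coind : Injective (coind k G V) where
  factors {X Y} g f _ := by
    obtain ⟨r, hr⟩ := (lin f).exists_leftInverse_of_injective
      (LinearMap.ker_eq_bot.2 (injective_of_mono f))
    refine ⟨toCoind (coindEval k G V ∘ₗ lin g ∘ₗ r), ?_⟩
    conv_rhs => rw [← toCoind_coindEval g]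
    refine hom_ext' fun n => Subtype.ext (funext fun x => ?_)
    show (lin (toCoind (N := Y) _) (lin f n)).1 x = _
    rw [toCoind_apply, toCoind_apply, ← lin_comm]
    have := congrArg (fun t => t (X.obj.ρ x⁻¹ n)) hr
    simp only [LinearMap.comp_apply] at this ⊢
    rw [this]
    rfl

/-- Every smooth module embeds into a coinduced module. -/
instance mono_toCoind_id (N : GSmooth k G) : Mono (toCoind (LinearMap.id : N.obj.V →ₗ[k] _)) := by
  refine mono_of_injective _ fun a b h => ?_
  have := congrArg (fun f : (coind k G N.obj.V).obj.V => f.1 1) h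
  simpa [toCoind_apply] using this

section Restriction

variable {H : Subgroup G}

variable (k V H) in
/-- The comparison of the restriction of a coinduced module with a coinduced module. -/
noncomputable def resCoind :
    (res k H).obj (coind k G V) ⟶ coind k H (G ⧸ H → V) :=
  homOf (M := (res k H).obj (coind k G V)) (N := coind k H (G ⧸ H → V))
    (LinearMap.codRestrict (smoothFun k H (G ⧸ H → V))
      (LinearMap.pi fun h : H => LinearMap.pi fun c : G ⧸ H =>
        LinearMap.proj (h * c.out⁻¹ : G) ∘ₗ (smoothFun k G V).subtype) fun f =>
          isOpen_stab_of_le (funRep k H (G ⧸ H → V)) _ (vecStab ((res k H).obj (coind k G V)).obj.ρ f)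
            (((res k H).obj (coind k G V)).property f) fun g hg => by
              have hg : (coind k G V).obj.ρ g f = f := hg
              ext h c
              refine Eq.trans (b := f.1 ((g : G)⁻¹ * (h * c.out⁻¹)))
                (congrArg f.1 (by simp [mul_assoc])) ?_
              exact congrArg (fun f : (coind k G V).obj.V => f.1 (h * c.out⁻¹)) hg)
    (fun g f => by
      refine Subtype.ext (funext fun h => funext fun c => ?_)
      show f.1 ((g : G)⁻¹ * (h * c.out⁻¹)) = f.1 ((g⁻¹ * h : H) * c.out⁻¹)
      simp [mul_assoc])

lemma resCoind_apply (f : (coind k G V).obj.V) (h : H) (c : G ⧸ H) :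
    (lin (resCoind k V H) f).1 h c = f.1 (h * c.out⁻¹) := rfl

/-- G is the disjoint union of the sets H c⁻¹, so a function on G is a function on H with values in
families indexed by G/H. For surjectivity, a stabilizer that is open in H has to be open in G, which
holds as H is open. -/
lemma isIso_resCoind (hH : IsOpen (H : Set G)) : IsIso (resCoind k V H) := by
  refine isIso_of_bijective _ ⟨fun f f' hf => ?_, fun F => ?_⟩
  · change (coind k G V).obj.V at f f'
    refine Subtype.ext (funext fun x => ?_)
    have : f.1 (x * (QuotientGroup.mk x⁻¹ : G ⧸ H).out * (QuotientGroup.mk x⁻¹ : G ⧸ H).out⁻¹) =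
        f'.1 (x * (QuotientGroup.mk x⁻¹ : G ⧸ H).out * (QuotientGroup.mk x⁻¹ : G ⧸ H).out⁻¹) :=
      congrArg (fun f : (coind k H (G ⧸ H → V)).obj.V =>
        f.1 ⟨_, inv_out_mul_mem x⟩ (QuotientGroup.mk x⁻¹)) hf
    simpa only [mul_inv_cancel_right] using this
  · let f : G → V := fun x => F.1 ⟨_, inv_out_mul_mem x⟩ (QuotientGroup.mk x⁻¹)
    have hf : f ∈ smoothFun k G V := by
      refine isOpen_stab_of_le _ _ ((vecStab (coind k H (G ⧸ H → V)).obj.ρ F).map H.subtype)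
        (hH.isOpenMap_subtype_val _ ((coind k H (G ⧸ H → V)).property F)) ?_
      rintro _ ⟨h, hh, rfl⟩
      have hh : (coind k H (G ⧸ H → V)).obj.ρ h F = F := hh
      ext x
      show F.1 ⟨_, inv_out_mul_mem ((h : G)⁻¹ * x)⟩ (QuotientGroup.mk ((h : G)⁻¹ * x)⁻¹) =
        F.1 ⟨_, inv_out_mul_mem x⟩ (QuotientGroup.mk x⁻¹)
      have hq : (QuotientGroup.mk ((h : G)⁻¹ * x)⁻¹ : G ⧸ H) = QuotientGroup.mk x⁻¹ := by
        rw [QuotientGroup.eq]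
        simp
      conv_rhs => rw [← hh, coind_rho_apply]
      have h2 : (⟨_, inv_out_mul_mem ((h : G)⁻¹ * x)⟩ : H) = h⁻¹ * ⟨_, inv_out_mul_mem x⟩ := by
        apply Subtype.ext
        simp only [hq, Subgroup.coe_mul, Subgroup.coe_inv, mul_assoc]
      rw [h2, hq]
    refine ⟨⟨f, hf⟩, Subtype.ext (funext fun h => funext fun c => ?_)⟩
    refine (resCoind_apply (H := H) ⟨f, hf⟩ h c).trans ?_
    show F.1 ⟨_, inv_out_mul_mem ((h : G) * c.out⁻¹)⟩ (QuotientGroup.mk ((h : G) * c.out⁻¹)⁻¹) = _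
    have hq : (QuotientGroup.mk ((h : G) * c.out⁻¹)⁻¹ : G ⧸ H) = c := by
      conv_rhs => rw [← QuotientGroup.out_eq' c]
      rw [QuotientGroup.eq]
      simp
    have h2 : (⟨_, inv_out_mul_mem ((h : G) * c.out⁻¹)⟩ : H) = h := by
      apply Subtype.ext
      simp only [hq]
      simp
    rw [h2, hq]

lemma injective_res_coind (hH : IsOpen (H : Set G)) :
    Injective ((res k H).obj (coind k G V)) :=
  have := isIso_resCoind (k := k) (V := V) hH
  Injective.of_iso (asIso (resCoind k V H)).symm inferInstance

end Restriction

end GSmooth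

/-! ### Free contramodules over a compact group -/

section CompactGroup

open Contra Contra.Meas GSmooth

variable {k G : Type u} [Field k] [Group G] [TopologicalSpace G] [IsTopologicalGroup G]
  {V : Type u} [AddCommGroup V] [Module k V]

lemma CompactFun.sum_apply {G : Type u} [TopologicalSpace G] {ι : Type*} (t : Finset ι)
    (f : ι → CompactFun k G) (x : G) :
    (∑ i ∈ t, f i).1 x = ∑ i ∈ t, (f i).1 x := by
  let L : CompactFun k G →+ k := ⟨⟨fun s => s.1 x, rfl⟩, fun _ _ => rfl⟩
  exact map_sum L f t

/-- By equivariance (f s)(x) is the value at 1 of f(x⁻¹s), so f amounts to the linear map s ↦ (f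
s)(1) on k(G). -/
lemma psiV_coind_ext {f f' : PsiV (coind k G V).obj}
    (h : ∀ s, coindEval k G V (f s) = coindEval k G V (f' s)) : f = f' := by
  apply Representation.IntertwiningMap.ext
  refine LinearMap.ext fun s => Subtype.ext (funext fun x => ?_)
  have key : ∀ f : PsiV (coind k G V).obj,
      (f s).1 x = coindEval k G V (f (CompactFun.left k G x⁻¹ s)) := fun f => by
    rw [f.isIntertwining, coindEval_apply, coind_rho_apply]
    simp
  exact (key f).trans ((h _).trans (key f').symm)

variable (k G V) in
/-- The generators of `Ψ` of a coinduced module. -/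
def deltaMap : V →ₗ[k] PsiV (coind k G V).obj where
  toFun v :=
    { toFun := fun s => (⟨fun x => s.1 x • v,
        isOpen_stab_map (CompactFun.left k G) (funRep k G V) (fun s x => s.1 x • v)
          (fun _ _ => rfl) (CompactFun.isOpen_stab_left s)⟩ : smoothFun k G V)
      map_add' := fun s t => Subtype.ext (funext fun x => add_smul _ _ _)
      map_smul' := fun a s => Subtype.ext (funext fun x => mul_smul _ _ _)
      isIntertwining' := fun g => rfl }
  map_add' v w := by
    apply Representation.IntertwiningMap.ext
    exact LinearMap.ext fun s => Subtype.ext (funext fun x => smul_add _ _ _)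
  map_smul' a v := by
    apply Representation.IntertwiningMap.ext
    exact LinearMap.ext fun s => Subtype.ext (funext fun x => smul_comm _ _ _)

variable [CompactSpace G]

namespace CompactFun

/-- The locally constant function underlying an element of `k(G)`. -/
def toLC (s : CompactFun k G) : LocallyConstant G k := ⟨s.1, s.2.1⟩

variable (k) in
/-- The indicator function of an open-closed subset of a compact group. -/
noncomputable def indic (A : Clopens G) : CompactFun k G :=
  ⟨restrictFun (LocallyConstant.const G (1 : k)) A,
    (restrictFun (LocallyConstant.const G (1 : k)) A).isLocallyConstant,
    HasCompactSupport.of_compactSpace _⟩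

open Classical in
lemma indic_apply {G : Type u} [TopologicalSpace G] [CompactSpace G] (A : Clopens G) (x : G) : (indic k A).1 x = if x ∈ A then 1 else 0 := rfl

lemma indic_sup (A B : Clopens G) (h : Disjoint (A : Set G) B) :
    indic k (A ⊔ B) = indic k A + indic k B := by
  classical
  refine CompactFun.ext fun x => ?_
  show _ = (indic k A).1 x + (indic k B).1 x
  simp only [indic_apply]
  have : x ∈ A → x ∉ B := fun h1 h2 => Set.disjoint_left.1 h h1 h2
  have h' : x ∈ A ⊔ B ↔ x ∈ A ∨ x ∈ B := Iff.rfl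
  by_cases h1 : x ∈ A <;> by_cases h2 : x ∈ B <;> simp_all

lemma eq_sum_indic (s : CompactFun k G) (t : Finset k) (ht : ∀ x, s.1 x ∈ t) :
    s = ∑ a ∈ t, a • indic k (fiber (toLC s) a) := by
  classical
  refine CompactFun.ext fun x => ?_
  rw [sum_apply, Finset.sum_eq_single_of_mem (s.1 x) (ht x)]
  · show _ = s.1 x * (indic k _).1 x
    rw [indic_apply, if_pos, mul_one]
    exact rfl
  · intro a _ ha
    show a * (indic k _).1 x = 0
    rw [indic_apply, if_neg fun h => ha h.symm, mul_zero]

end CompactFun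

open CompactFun

/-- The measure on a compact group that corresponds to an element of `Ψ` of
a coinduced module. -/
noncomputable def toMeas : PsiV (coind k G V).obj →ₗ[k] Meas k G V where
  toFun f := ofCompact (fun A => coindEval k G V (f (indic k A))) fun A B h => by
    rw [indic_sup A B h]
    exact (congrArg _ (map_add f _ _)).trans (map_add _ _ _)
  map_add' _ _ := rfl
  map_smul' _ _ := rfl

lemma toMeas_apply (f : PsiV (coind k G V).obj) (A : Clopens G) :
    (toMeas f).1 A = coindEval k G V (f (indic k A)) := rfl

/-- Integration of a scalar function with respect to a vector valued measure. -/
def scalarFun (s : CompactFun k G) : LocallyConstant G (V →ₗ[k] V) :=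
  (toLC s).map fun a => a • LinearMap.id

/-- Indicators span k(G) on a compact group, and for an indicator both sides are the value of the
measure. -/
lemma integral_toMeas (f : PsiV (coind k G V).obj) (s : CompactFun k G) :
    integral (scalarFun s) (toMeas f) = coindEval k G V (f s) := by
  obtain ⟨t, ht⟩ := exists_finset (toLC s) (isCompact_univ (X := G))
  have hs : SupportedOn Set.univ (toMeas f).1 := fun A hA => by
    have hA : A = ⊥ := Clopens.ext (by simpa using hA)
    rw [hA, apply_bot]
  rw [integral_eq_sum hs (toLC s) t ht (fun a => a • LinearMap.id) _ fun _ => rfl]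
  let L : CompactFun k G →ₗ[k] V := coindEval k G V ∘ₗ f.toLinearMap
  have : coindEval k G V (f s) = L (∑ a ∈ t, a • indic k (fiber (toLC s) a)) :=
    congrArg L (eq_sum_indic s t fun x => ht x trivial)
  rw [this, map_sum]
  refine Finset.sum_congr rfl fun a _ => ?_
  rw [map_smul]
  rfl

/-- The maps s ↦ s·v are generators: f is recovered by the contraaction from its own measure, with
the values v replaced by these maps. -/
lemma psiAct_map_deltaMap (f : PsiV (coind k G V).obj) :
    psiAct _ (Meas.map (deltaMap k G V) (toMeas f)) = f := by
  refine psiV_coind_ext fun s => ?_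
  rw [psiAct_apply, ← integral_toMeas]
  let F' : LocallyConstant G (PsiV (coind k G V).obj →ₗ[k] V) :=
    (psiFun (coind k G V).obj s).map fun T => coindEval k G V ∘ₗ T
  refine (integral_comp (coindEval k G V) _ F' (fun _ => rfl) _).symm.trans ?_
  refine integral_map (deltaMap k G V) F' (scalarFun s) (fun g => ?_) _
  ext v
  show s.1 g • v = (CompactFun.right k G g s).1 1 • v
  simp

lemma toMeas_deltaMap (v : V) : toMeas (deltaMap k G V v) = dirac 1 v := by
  classical
  refine Meas.ext fun A => ?_
  show (indic k A).1 1 • v = if _ then _ else _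
  rw [indic_apply, ite_smul, one_smul, zero_smul]

/-- The indicator of A translated by g is the indicator of the section {x | xg ∈ A}. Hence `toMeas`
turns the contraaction into convolution V[[G]][[G]] → V[[G]], and Ψ of a coinduced module is the
free contramodule. -/
lemma push_uncurry_toMeas (M : Meas k G (PsiV (coind k G V).obj)) :
    push (mulMap G) (uncurry (Meas.map toMeas M)) = toMeas (psiAct _ M) := by
  refine Meas.ext fun A => ?_
  rw [push_apply, uncurry_apply, toMeas_apply, psiAct_apply]
  let F' : LocallyConstant G (PsiV (coind k G V).obj →ₗ[k] V) :=
    (psiFun (coind k G V).obj (indic k A)).map fun T => coindEval k G V ∘ₗ T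
  refine (integral_map toMeas _ F' (fun g => ?_) M).trans
    (integral_comp (coindEval k G V) _ F' (fun _ => rfl) _)
  rfl

namespace GContra

variable {P Q : GContra k G}

/-- The morphism from `Ψ` of a coinduced module that corresponds to a linear map. -/
noncomputable def fromFree (φ : V →ₗ[k] P.V) : psiObj (coind k G V).obj ⟶ P where
  lin := P.act ∘ₗ Meas.map φ ∘ₗ toMeas
  comm M := by
    change Meas k G (PsiV (coind k G V).obj) at M
    show P.act (Meas.map φ (toMeas (psiAct _ M))) =
      P.act (Meas.map P.act (Meas.map (Meas.map φ) (Meas.map toMeas M)))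
    rw [← push_uncurry_toMeas, map_push, P.act_assoc, ← map_curry, curry_uncurry]

lemma fromFree_lin (φ : V →ₗ[k] P.V) (f : PsiV (coind k G V).obj) :
    (fromFree φ).lin f = P.act (Meas.map φ (toMeas f)) := rfl

lemma fromFree_deltaMap (φ : V →ₗ[k] P.V) (v : V) :
    (fromFree φ).lin (deltaMap k G V v) = φ v := by
  rw [fromFree_lin, toMeas_deltaMap, map_dirac, P.act_unit]

/-- Every element is the contraaction of a measure valued in the generators, and g commutes with
contraactions. -/
lemma eq_fromFree (g : psiObj (coind k G V).obj ⟶ P) :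
    g = fromFree (g.lin ∘ₗ deltaMap k G V) := by
  refine hom_ext (LinearMap.ext fun f => ?_)
  exact (congrArg g.lin (psiAct_map_deltaMap f).symm).trans (g.comm _)

lemma fromFree_comp (φ : V →ₗ[k] P.V) (q : P ⟶ Q) :
    fromFree φ ≫ q = fromFree (q.lin ∘ₗ φ) := by
  refine hom_ext (LinearMap.ext fun f => ?_)
  exact q.comm _

lemma fromFree_hom_ext {g g' : psiObj (coind k G V).obj ⟶ P}
    (h : ∀ v, g.lin (deltaMap k G V v) = g'.lin (deltaMap k G V v)) : g = g' := by
  rw [eq_fromFree g, eq_fromFree g', LinearMap.ext (f := g.lin ∘ₗ _) (g := g'.lin ∘ₗ _) h]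

/-- Free objects are projective: the images of generators are lifted by a linear section of the
epimorphism. -/
instance projective_psi_coind : Projective (psiObj (coind k G V).obj) where
  factors {P Q} g q _ := by
    obtain ⟨r, hr⟩ := q.lin.exists_rightInverse_of_surjective
      (LinearMap.range_eq_top.2 (surjective_of_epi q))
    refine ⟨fromFree (r ∘ₗ g.lin ∘ₗ deltaMap k G V), ?_⟩
    rw [fromFree_comp]
    refine fromFree_hom_ext fun v => ?_
    refine (fromFree_deltaMap _ _).trans ?_
    exact congrArg (fun t => t (g.lin (deltaMap k G V v))) hr

variable (P) in
instance epi_fromFree_id : Epi (fromFree (LinearMap.id : P.V →ₗ[k] P.V)) :=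
  epi_of_surj _ fun p => ⟨deltaMap k G P.V p, fromFree_deltaMap _ _⟩

end GContra

end CompactGroup

/-! ### Unit and counit over a compact group -/

section Counit

open Contra Contra.Meas GSmooth

variable {k G : Type u} [Field k] [Group G] [TopologicalSpace G] [IsTopologicalGroup G]

lemma phi_mk_act (P : GContra k G) (s : CompactFun k G) (μ : Meas k G P.V) :
    (phiRel P).mkQ (s ⊗ₜ P.act μ) = (phiRel P).mkQ (integral (phiFun P s) μ) := by
  rw [← sub_eq_zero, ← map_sub]
  exact (Submodule.Quotient.mk_eq_zero _).2 (Submodule.subset_span ⟨s, μ, rfl⟩)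

variable {V : Type u} [AddCommGroup V] [Module k V]

lemma isLocallyConstant_coind (f : (coind k G V).obj.V) : IsLocallyConstant f.1 := by
  have h := (orbitMap _ f ((coind k G V).property f)).isLocallyConstant.comp
    fun f : (coind k G V).obj.V => f.1 1
  have e : f.1 = (fun g : G => ((coind k G V).obj.ρ g f).1 1) ∘ fun x : G => x⁻¹ := funext fun x => by
    show f.1 x = f.1 (x⁻¹⁻¹ * 1)
    simp
  rw [e]
  exact h.comp_continuous continuous_inv

variable (k G V) in
/-- The map `k(G) ⊗ V → Φ(Ψ(coind V))`. -/
noncomputable def tensorToPhi :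
    CompactFun k G ⊗[k] V →ₗ[k] PhiV (psiObj (coind k G V).obj) :=
  (phiRel (psiObj (coind k G V).obj)).mkQ ∘ₗ
    (deltaMap k G V : V →ₗ[k] (psiObj (coind k G V).obj).V).lTensor (CompactFun k G)

variable [CompactSpace G]

/-- Every f is the contraaction of a measure valued in generators; the relation defining Φ moves the
contraaction over to s, which leaves a finite sum of tensors with generators. -/
lemma tensorToPhi_surjective : Function.Surjective (tensorToPhi k G V) := by
  rw [← LinearMap.range_eq_top, eq_top_iff]
  rintro x -
  obtain ⟨x, rfl⟩ := Submodule.mkQ_surjective _ x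
  induction x using TensorProduct.induction_on with
  | zero => simp
  | add x y hx hy => rw [map_add]; exact Submodule.add_mem _ hx hy
  | tmul s f =>
    change PsiV (coind k G V).obj at f
    have h : f = (psiObj (coind k G V).obj).act (Meas.map (deltaMap k G V) (toMeas f)) :=
      (psiAct_map_deltaMap f).symm
    let F : LocallyConstant G (V →ₗ[k] CompactFun k G ⊗[k] V) :=
      (orbitMap (CompactFun.right k G) s (CompactFun.isOpen_stab_right s)).map
        (TensorProduct.mk k (CompactFun k G) V)
    let F' : LocallyConstant G (V →ₗ[k] PhiV (psiObj (coind k G V).obj)) :=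
      F.map fun T => tensorToPhi k G V ∘ₗ T
    let F'' : LocallyConstant G ((psiObj (coind k G V).obj).V →ₗ[k] PhiV (psiObj (coind k G V).obj)) :=
      (phiFun _ s).map fun T => (phiRel (psiObj (coind k G V).obj)).mkQ ∘ₗ T
    refine ⟨integral F (toMeas f), ?_⟩
    refine (integral_comp (tensorToPhi k G V) F F' (fun _ => rfl) _).symm.trans ?_
    refine Eq.trans ?_ ((congrArg (fun z => (phiRel (psiObj (coind k G V).obj)).mkQ (s ⊗ₜ z)) h).trans
      (phi_mk_act (psiObj (coind k G V).obj) s _)).symm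
    refine Eq.trans ?_ (integral_comp _ (phiFun _ s) F'' (fun _ => rfl) _)
    exact (integral_map (deltaMap k G V : V →ₗ[k] (psiObj (coind k G V).obj).V) F'' F'
      (fun g => rfl) _).symm

/-- The composite k(G) ⊗ V → Φ(Ψ(coind V)) → coind V sends s ⊗ v to s·v. It is injective by
coordinates in a basis of V, and surjective because a locally constant function on a compact group
has finitely many values. As the first map is onto, the counit is bijective. -/
lemma isIso_counit_coind : IsIso ((phiPsiAdjunction k G).counit.app (coind k G V)) := by
  let ε : PhiV (psiObj (coind k G V).obj) →ₗ[k] smoothFun k G V :=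
    lin ((phiPsiAdjunction k G).counit.app (coind k G V))
  have hεδ : ∀ s v, ε (tensorToPhi k G V (s ⊗ₜ v)) = deltaMap k G V v s := fun _ _ => rfl
  refine GSmooth.isIso_of_bijective _ ⟨?_, ?_⟩
  · classical
    suffices h : Function.Injective (ε ∘ₗ tensorToPhi k G V) by
      intro a b hab
      obtain ⟨a, rfl⟩ := tensorToPhi_surjective a
      obtain ⟨b, rfl⟩ := tensorToPhi_surjective b
      rw [h hab]
    rw [← LinearMap.ker_eq_bot, eq_bot_iff]
    intro t ht
    let b := Module.Basis.ofVectorSpace k V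
    have key : ∀ t x i, b.repr ((ε (tensorToPhi k G V t)).1 x) i =
        (TensorProduct.equivFinsuppOfBasisRight b t i).1 x := by
      intro t x i
      induction t using TensorProduct.induction_on with
      | zero => simp; rfl
      | add t t' h h' =>
        rw [map_add, map_add, map_add]
        refine Eq.trans ?_ (congrArg₂ (· + ·) h h')
        exact congrArg (fun c => c i) (map_add b.repr _ _)
      | tmul s v =>
        rw [hεδ, TensorProduct.equivFinsuppOfBasisRight_apply_tmul_apply]
        show b.repr (s.1 x • v) i = b.repr v i * s.1 x
        rw [map_smul, Finsupp.smul_apply, smul_eq_mul, mul_comm]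
    have ht : ε (tensorToPhi k G V t) = 0 := ht
    refine (TensorProduct.equivFinsuppOfBasisRight b).injective ?_
    rw [map_zero]
    refine Finsupp.ext fun i => CompactFun.ext fun x => ?_
    rw [← key, ht]
    simp
    rfl
  · intro f
    change smoothFun k G V at f
    let c : LocallyConstant G V := ⟨f.1, isLocallyConstant_coind f⟩
    obtain ⟨t, ht⟩ := exists_finset c (isCompact_univ (X := G))
    refine ⟨∑ v ∈ t, tensorToPhi k G V (CompactFun.indic k (fiber c v) ⊗ₜ v), ?_⟩
    refine (map_sum ε _ _).trans (Subtype.ext (funext fun x => ?_))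
    have : ∀ (g : V → smoothFun k G V) (x : G), (∑ v ∈ t, g v).1 x = ∑ v ∈ t, (g v).1 x := by
      intro g x
      simp
    rw [this, Finset.sum_eq_single_of_mem (f.1 x) (ht x trivial)]
    · show (CompactFun.indic k (fiber c (f.1 x))).1 x • f.1 x = f.1 x
      rw [CompactFun.indic_apply, if_pos (show x ∈ fiber c (f.1 x) from rfl), one_smul]
    · intro v _ hv
      show (CompactFun.indic k (fiber c v)).1 x • v = 0
      rw [CompactFun.indic_apply, if_neg fun h : x ∈ fiber c v => hv (show f.1 x = v from h).symm,
        zero_smul]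

/-- Every injective smooth module over a compact group is a retract of a coinduced module. -/
noncomputable def GSmooth.retractCoind (N : GSmooth k G) [Injective N] :
    Retract N (coind k G N.obj.V) where
  i := toCoind LinearMap.id
  r := Injective.factorThru (𝟙 N) (toCoind LinearMap.id)
  retract := Injective.comp_factorThru _ _

/-- Every projective contramodule over a compact group is a retract of a free one. -/
noncomputable def GContra.retractFree (P : GContra k G) [Projective P] :
    Retract P (psiObj (coind k G P.V).obj) where
  i := Projective.factorThru (𝟙 P) (GContra.fromFree LinearMap.id)
  r := GContra.fromFree LinearMap.id
  retract := Projective.factorThru_comp _ _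

/-- Invertibility of the components of a natural transformation passes to retracts. -/
lemma isIso_counit_of_injective (N : GSmooth k G) [Injective N] :
    IsIso ((phiPsiAdjunction k G).counit.app N) := by
  have := isIso_counit_coind (k := k) (G := G) (V := N.obj.V)
  let r := GSmooth.retractCoind N
  let h : RetractArrow ((phiPsiAdjunction k G).counit.app N)
      ((phiPsiAdjunction k G).counit.app (coind k G N.obj.V)) :=
    { i := Arrow.homMk ((Psi k G ⋙ Phi k G).map r.i) r.i
      r := Arrow.homMk ((Psi k G ⋙ Phi k G).map r.r) r.r
      retract := by
        ext
        · simp [← Functor.map_comp]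
        · simp }
  exact (MorphismProperty.isomorphisms _).of_retract h this

lemma projective_psi (N : GSmooth k G) [Injective N] : Projective ((Psi k G).obj N) :=
  have : Projective ((Psi k G).obj (coind k G N.obj.V)) := GContra.projective_psi_coind
  ((GSmooth.retractCoind N).map (Psi k G)).projective

/-- By the triangle identity the unit at Ψ of a coinduced module is inverse to Ψ of the counit, and
a projective is a retract of such an object. -/
lemma isIso_unit_of_projective (P : GContra k G) [Projective P] :
    IsIso ((phiPsiAdjunction k G).unit.app P) := by
  have := isIso_counit_coind (k := k) (G := G) (V := P.V)
  have : IsIso ((phiPsiAdjunction k G).unit.app ((Psi k G).obj (coind k G P.V))) :=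
    have h := (phiPsiAdjunction k G).right_triangle_components (coind k G P.V)
    have : IsIso ((phiPsiAdjunction k G).unit.app ((Psi k G).obj (coind k G P.V)) ≫
        (Psi k G).map ((phiPsiAdjunction k G).counit.app (coind k G P.V))) := by
      rw [h]; infer_instance
    IsIso.of_isIso_comp_right _ ((Psi k G).map ((phiPsiAdjunction k G).counit.app (coind k G P.V)))
  let r : Retract P ((Psi k G).obj (coind k G P.V)) := GContra.retractFree P
  let h : RetractArrow ((phiPsiAdjunction k G).unit.app P)
      ((phiPsiAdjunction k G).unit.app ((Psi k G).obj (coind k G P.V))) :=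
    { i := Arrow.homMk r.i ((Phi k G ⋙ Psi k G).map r.i)
      r := Arrow.homMk r.r ((Phi k G ⋙ Psi k G).map r.r)
      retract := by
        ext
        · simp
        · simp [← Functor.map_comp] }
  exact (MorphismProperty.isomorphisms _).of_retract h this

lemma injective_phi (P : GContra k G) [Projective P] : Injective ((Phi k G).obj P) := by
  have := isIso_counit_coind (k := k) (G := G) (V := P.V)
  have : Injective ((Phi k G).obj ((Psi k G).obj (coind k G P.V))) :=
    Injective.of_iso (asIso ((phiPsiAdjunction k G).counit.app (coind k G P.V))).symm inferInstance
  let r : Retract P ((Psi k G).obj (coind k G P.V)) := GContra.retractFree P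
  exact (r.map (Phi k G)).injective

end Counit

/-! ### The contramodule Hom_k(M, P) -/

namespace Contra.Meas

variable {k : Type*} [Field k] {X : Type*} [TopologicalSpace X]
  {V : Type*} [AddCommGroup V] [Module k V]
  {Y : Type*} [TopologicalSpace Y] {W : Type*} [AddCommGroup W] [Module k W]

/-- Fubini's theorem on each rectangle A × B. It serves for contraassociativity on Hom_k(M, P),
where the density T ↦ T(gm) is formed before the contraaction of P. -/
lemma curry_dens {D : Type*} (d : LocallyConstant Y D)
    (E : D → LocallyConstant X (V →ₗ[k] W)) (F : LocallyConstant (X × Y) (V →ₗ[k] W))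
    (hF : ∀ x y, F (x, y) = E (d y) x) (μ : Meas k (X × Y) V) :
    curry (dens F μ) = dens (d.map fun δ => dens (E δ)) (curry μ) := by
  classical
  refine Meas.ext fun B => Meas.ext fun A => ?_
  rw [curry_apply, dens_apply, dens_apply, ← eval_apply A]
  let G : LocallyConstant Y (Meas k X V →ₗ[k] W) :=
    (restrictFun (d.map fun δ => dens (E δ)) B).map fun T => eval A ∘ₗ T
  rw [← integral_comp (eval A) _ G fun _ => rfl]
  -- The indicator of B is recorded together with d, so that the restricted integrand depends on y
  -- through d' only.
  let d' : LocallyConstant Y (D × ℕ) :=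
    ⟨fun y => (d y, restrictFun (LocallyConstant.const Y 1) B y),
      d.isLocallyConstant.prodMk (restrictFun (LocallyConstant.const Y 1) B).isLocallyConstant⟩
  have hd' : ∀ y, d' y = (d y, if y ∈ B then 1 else 0) := fun _ => rfl
  refine (integral_curry d' (fun p => if p.2 = 1 then restrictFun (E p.1) A else 0)
    (restrictFun F (A ×ˢ B)) (fun x y => ?_) G (fun y => ?_) μ).symm
  · have h : (x, y) ∈ A ×ˢ B ↔ x ∈ A ∧ y ∈ B := Iff.rfl
    rw [restrictFun_apply, hd']
    simp only [h, hF]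
    by_cases hy : y ∈ B <;> by_cases hx : x ∈ A <;> simp [hx, hy, restrictFun_apply]
  · show eval A ∘ₗ restrictFun _ B y = _
    rw [restrictFun_apply, hd']
    by_cases hy : y ∈ B
    · simp only [hy, if_true]
      rfl
    · simp only [hy, if_false, LinearMap.comp_zero, zero_ne_one]
      ext μ
      exact (integral_eq_zero (K := Set.univ) _ (fun A hA => by
        rw [show A = ⊥ from Clopens.ext (by simpa using hA), apply_bot]) fun _ _ => rfl).symm

end Contra.Meas

section HomContra

open Contra Contra.Meas GSmooth

variable {k G : Type u} [Field k] [Group G] [TopologicalSpace G] [IsTopologicalGroup G]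
  (M N : GSmooth k G) (P : GContra k G)

/-- The locally constant function `g ↦ (T ↦ T (g m))`. -/
def homFun (m : M.obj.V) : LocallyConstant G ((M.obj.V →ₗ[k] P.V) →ₗ[k] P.V) :=
  (orbitMap M.obj.ρ m (M.property m)).map LinearMap.applyₗ

lemma homFun_apply (m : M.obj.V) (g : G) (T : M.obj.V →ₗ[k] P.V) :
    homFun M P m g T = T (M.obj.ρ g m) := rfl

/-- The contraaction on the space of linear maps from a smooth module to a contramodule. -/
noncomputable def homAct : Meas k G (M.obj.V →ₗ[k] P.V) →ₗ[k] (M.obj.V →ₗ[k] P.V) where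
  toFun μ :=
    { toFun := fun m => P.act (dens (homFun M P m) μ)
      map_add' := fun m m' => by
        rw [← map_add]
        congr 1
        refine Meas.ext fun A => integral_add_fun _ _ _ (fun g => ?_) μ
        classical
        simp only [restrictFun_apply]
        split_ifs
        · ext T; simp [homFun_apply]
        · simp
      map_smul' := fun a m => by
        rw [← map_smul]
        congr 1
        refine Meas.ext fun A => integral_smul_fun a _ _ (fun g => ?_) μ
        classical
        simp only [restrictFun_apply]
        split_ifs
        · ext T; simp [homFun_apply]
        · simp }
  map_add' μ ν := LinearMap.ext fun m => by
    show P.act (dens (homFun M P m) (μ + ν)) = _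
    rw [map_add, map_add]
    rfl
  map_smul' a μ := LinearMap.ext fun m => by
    show P.act (dens (homFun M P m) (a • μ)) = _
    rw [map_smul, map_smul]
    rfl

lemma homAct_apply (μ : Meas k G (M.obj.V →ₗ[k] P.V)) (m : M.obj.V) :
    homAct M P μ m = P.act (dens (homFun M P m) μ) := rfl

/-- The contramodule of linear maps from a smooth module to a contramodule. -/
noncomputable def homContra : GContra k G where
  V := M.obj.V →ₗ[k] P.V
  act := homAct M P
  act_assoc μ := by
    refine LinearMap.ext fun m => ?_
    let F : LocallyConstant (G × G) ((M.obj.V →ₗ[k] P.V) →ₗ[k] P.V) :=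
      ⟨fun z => homFun M P m (z.1 * z.2),
        (homFun M P m).isLocallyConstant.comp_continuous (mulMap G).continuous⟩
    let d := orbitMap M.obj.ρ m (M.property m)
    rw [homAct_apply, homAct_apply, dens_push (mulMap G) _ F (fun _ => rfl), P.act_assoc,
      curry_dens d (homFun M P) F (fun x y => by
        ext T
        show T (M.obj.ρ (x * y) m) = T (M.obj.ρ x (M.obj.ρ y m))
        rw [map_mul]; rfl)]
    rw [map_dens P.act _ (d.map fun n => P.act ∘ₗ dens (homFun M P n)) fun _ => rfl,
      dens_map (homAct M P) _ (d.map fun n => P.act ∘ₗ dens (homFun M P n)) fun _ => rfl]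
  act_unit T := LinearMap.ext fun m => by
    rw [homAct_apply, dens_dirac, P.act_unit, homFun_apply, map_one]
    rfl

variable {M N}

/-- The contravariant functoriality of the contramodule of linear maps. -/
noncomputable def homContraMap (f : M ⟶ N) : homContra N P ⟶ homContra M P where
  lin := LinearMap.lcomp k P.V (lin f)
  comm μ := LinearMap.ext fun m => by
    refine congrArg P.act (dens_map (LinearMap.lcomp k P.V (lin f)) (homFun M P m)
      (homFun N P (lin f m)) (fun g => ?_) μ).symm
    ext T
    show T (N.obj.ρ g (lin f m)) = T (lin f (M.obj.ρ g m))
    rw [lin_comm]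

lemma homContraMap_id : homContraMap P (𝟙 M) = 𝟙 _ := rfl

lemma homContraMap_comp {K : GSmooth k G} (f : M ⟶ N) (g : N ⟶ K) :
    homContraMap P (f ≫ g) = homContraMap P g ≫ homContraMap P f := rfl

variable (M) in
/-- Restriction to a subgroup commutes with the formation of the contramodule of linear maps. -/
noncomputable def resHomContra (H : Subgroup G) :
    (GContra.res k H).obj (homContra M P) ≅
      homContra ((GSmooth.res k H).obj M) ((GContra.res k H).obj P) :=
  let f : (GContra.res k H).obj (homContra M P) ⟶
      homContra ((GSmooth.res k H).obj M) ((GContra.res k H).obj P) :=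
    ⟨LinearMap.id, fun μ => LinearMap.ext fun m => congrArg P.act
      (dens_push (inclMap H) (homFun M P m)
        (homFun ((GSmooth.res k H).obj M) ((GContra.res k H).obj P) m) (fun _ => rfl) μ)⟩
  have : IsIso f := GContra.isIso_of_bijective f Function.bijective_id
  asIso f

lemma shortExact_homContra {S : ShortComplex (GSmooth k G)} (hS : S.ShortExact) :
    (ShortComplex.mk (homContraMap P S.g) (homContraMap P S.f) (by
      rw [← homContraMap_comp, S.zero]
      exact GContra.hom_ext (LinearMap.ext fun T => LinearMap.ext fun _ =>
        (show S.X₃.obj.V →ₗ[k] P.V from T).map_zero))).ShortExact := by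
  obtain ⟨h1, h2, h3⟩ := (GSmooth.shortExact_iff S).1 hS
  refine (GContra.shortExact_iff _).2 ⟨fun T T' h => ?_, fun T => ?_, fun T hT => ?_⟩
  · refine LinearMap.ext fun m => ?_
    obtain ⟨m, rfl⟩ := h2 m
    exact congrArg (fun t : S.X₂.obj.V →ₗ[k] P.V => t m) h
  · obtain ⟨r, hr⟩ := (lin S.f).exists_leftInverse_of_injective (LinearMap.ker_eq_bot.2 h1)
    change S.X₁.obj.V →ₗ[k] P.V at T
    refine ⟨T ∘ₗ r, LinearMap.ext fun m => ?_⟩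
    exact congrArg T (congrArg (fun t => t m) hr)
  · change S.X₂.obj.V →ₗ[k] P.V at T
    obtain ⟨r, hr⟩ := (lin S.g).exists_rightInverse_of_surjective (LinearMap.range_eq_top.2 h2)
    refine ⟨T ∘ₗ r, LinearMap.ext fun m => ?_⟩
    show T (r (lin S.g m)) = T m
    have : r (lin S.g m) - m ∈ LinearMap.ker (lin S.g) := by
      rw [LinearMap.mem_ker, map_sub, sub_eq_zero]
      exact congrArg (fun t => t (lin S.g m)) hr
    obtain ⟨m', hm'⟩ := h3 this
    rw [← sub_eq_zero, ← map_sub, ← hm']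
    exact congrArg (fun t : S.X₁.obj.V →ₗ[k] P.V => t m') hT

/-- The trivial one-dimensional smooth module. -/
def trivialModule (k G : Type u) [Field k] [Group G] [TopologicalSpace G]
    [IsTopologicalGroup G] : GSmooth k G :=
  GSmooth.of (Representation.trivial k G k) fun v => by simp

/-- Linear maps from the trivial module. -/
noncomputable def homContraTrivial : homContra (trivialModule k G) P ≅ P :=
  let e : ((trivialModule k G).obj.V →ₗ[k] P.V) →ₗ[k] P.V := LinearMap.applyₗ (1 : k)
  let f : homContra (trivialModule k G) P ⟶ P :=
    ⟨e, fun μ => by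
      refine congrArg P.act (Eq.trans ?_ (dens_const e μ))
      refine congrArg (fun F => dens F μ) (LocallyConstant.ext fun g => ?_)
      rfl⟩
  have : IsIso f := GContra.isIso_of_bijective f ⟨fun T T' h => LinearMap.ext_ring h,
    fun p => ⟨LinearMap.toSpanSingleton k P.V p, by
      show LinearMap.toSpanSingleton k P.V p 1 = p
      simp⟩⟩
  asIso f

end HomContra

/-! ### Projectivity of Hom_k(coind V, P), and projective dimension -/

section HomCoind

open Contra Contra.Meas GSmooth CompactFun

variable {k G : Type u} [Field k] [Group G] [TopologicalSpace G] [IsTopologicalGroup G]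

/-- The inverse of an open-closed subset of a topological group. -/
def invClopen (A : Clopens G) : Clopens G := clopenPreimage ⟨fun x => x⁻¹, continuous_inv⟩ A

variable [CompactSpace G] (P : GContra k G)

/-- The involution `ν ↦ (A ↦ π(ν|_{A⁻¹}))` of the space of measures with values in
a contramodule. -/
def invol : Meas k G P.V →ₗ[k] Meas k G P.V where
  toFun ν := ofCompact (fun A => P.act (restrict (invClopen A) ν)) fun A B h => by
    rw [← map_add]
    refine congrArg P.act (Meas.ext fun C => ?_)
    refine Eq.trans (congrArg ν.1 ?_) (ν.2.1 (C ⊓ invClopen A) (C ⊓ invClopen B) ?_)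
    · exact Clopens.ext (Set.inter_union_distrib_left _ _ _)
    · exact Set.disjoint_left.2 fun x hx hx' => Set.disjoint_left.1 h hx.2 hx'.2
  map_add' ν ν' := Meas.ext fun A => by
    show P.act (restrict _ (ν + ν')) = _
    rw [map_add, map_add]; rfl
  map_smul' a ν := Meas.ext fun A => by
    show P.act (restrict _ (a • ν)) = _
    rw [map_smul, map_smul]; rfl

lemma invol_apply (ν : Meas k G P.V) (A : Clopens G) :
    (invol P ν).1 A = P.act (restrict (invClopen A) ν) := rfl

/-- The double application involves the image of ν|_C under x ↦ (x, x⁻¹). Contraassociativity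
replaces it by the image under x ↦ x x⁻¹ = 1, the point measure with value ν(C) at the unit, and
contraunitality concludes. -/
lemma invol_invol (ν : Meas k G P.V) : invol P (invol P ν) = ν := by
  refine Meas.ext fun C => ?_
  let φ : C(G, G × G) := ⟨fun x => (x, x⁻¹), by fun_prop⟩
  have h1 : restrict (invClopen C) (invol P ν) =
      Meas.map P.act (curry (push φ (restrict C ν))) := by
    refine Meas.ext fun A => congrArg P.act (Meas.ext fun B => congrArg ν.1 (Clopens.ext ?_))
    ext x
    show (x ∈ B ∧ x⁻¹ ∈ A ∧ x⁻¹⁻¹ ∈ C) ↔ ((x ∈ B ∧ x⁻¹ ∈ A) ∧ x ∈ C)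
    rw [inv_inv, and_assoc]
  rw [invol_apply, h1, ← P.act_assoc]
  have h2 : push (mulMap G) (push φ (restrict C ν)) = dirac 1 (ν.1 C) := by
    classical
    refine Meas.ext fun A => ?_
    show ν.1 _ = if _ then _ else _
    split_ifs with h
    · refine congrArg ν.1 (Clopens.ext ?_)
      ext x
      show (x * x⁻¹ ∈ A ∧ x ∈ C) ↔ x ∈ C
      rw [mul_inv_cancel]
      exact and_iff_right h
    · refine Eq.trans (congrArg ν.1 (Clopens.ext ?_)) (apply_bot ν)
      ext x
      show (x * x⁻¹ ∈ A ∧ x ∈ C) ↔ False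
      rw [mul_inv_cancel]
      exact iff_of_false (fun h' => h h'.1) id
  rw [h2, P.act_unit]

variable {V : Type u} [AddCommGroup V] [Module k V]

lemma toMeas_surjective : Function.Surjective (toMeas (k := k) (G := G) (V := V)) := by
  intro ν
  refine ⟨psiAct _ (Meas.map (deltaMap k G V) ν), Meas.ext fun A => ?_⟩
  rw [toMeas_apply, psiAct_apply]
  let F' : LocallyConstant G (PsiV (coind k G V).obj →ₗ[k] V) :=
    (psiFun (coind k G V).obj (indic k A)).map fun T => coindEval k G V ∘ₗ T
  refine (integral_comp (coindEval k G V) _ F' (fun _ => rfl) _).symm.trans ?_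
  refine Eq.trans ?_ (integral_restrictFun_const LinearMap.id A ν)
  classical
  refine integral_map (deltaMap k G V) F' _ (fun g => ?_) _
  ext v
  rw [restrictFun_apply]
  show _ = (CompactFun.right k G g (indic k A)).1 1 • v
  rw [right_apply, indic_apply, one_mul]
  split_ifs <;> simp

lemma toMeas_injective : Function.Injective (toMeas (k := k) (G := G) (V := V)) := by
  intro f f' h
  rw [← psiAct_map_deltaMap f, h, psiAct_map_deltaMap]

variable (V) in
/-- The comparison morphism from a free contramodule to the contramodule of linear maps
from a coinduced module. -/
noncomputable def freeToHom :
    psiObj (coind k G (V →ₗ[k] P.V)).obj ⟶ homContra (coind k G V) P :=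
  GContra.fromFree (P := homContra (coind k G V) P) (LinearMap.lcomp k P.V (coindEval k G V))

variable (V) in
/-- The linear map underlying `freeToHom`. -/
noncomputable def freeToHomLin :
    PsiV (coind k G (V →ₗ[k] P.V)).obj →ₗ[k] ((coind k G V).obj.V →ₗ[k] P.V) :=
  (freeToHom P V).lin

lemma coind_span (f : (coind k G V).obj.V) :
    f ∈ Submodule.span k {f | ∃ (C : Clopens G) (v : V), f = deltaMap k G V v (indic k C)} := by
  change smoothFun k G V at f
  let c : LocallyConstant G V := ⟨f.1, isLocallyConstant_coind f⟩
  obtain ⟨t, ht⟩ := exists_finset c (isCompact_univ (X := G))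
  have hf : f = ∑ v ∈ t, (deltaMap k G V v (indic k (fiber c v)) : smoothFun k G V) := by
    refine Subtype.ext (funext fun x => ?_)
    have : ∀ (g : V → smoothFun k G V) (x : G), (∑ v ∈ t, g v).1 x = ∑ v ∈ t, (g v).1 x := by
      intro g x
      simp
    refine Eq.trans ?_ (this (fun v => deltaMap k G V v (indic k (fiber c v))) x).symm
    rw [Finset.sum_eq_single_of_mem (f.1 x) (ht x trivial)]
    · show _ = (indic k (fiber c (f.1 x))).1 x • f.1 x
      rw [indic_apply, if_pos (show x ∈ fiber c (f.1 x) from rfl), one_smul]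
    · intro v _ hv
      show (indic k (fiber c v)).1 x • v = 0
      rw [indic_apply, if_neg fun h : x ∈ fiber c v => hv (show f.1 x = v from h).symm, zero_smul]
  rw [hf]
  exact Submodule.sum_mem (p := Submodule.span k _) fun v _ =>
    Submodule.subset_span ⟨_, v, rfl⟩

/-- The translate by g of v·1_C has the value v at 1 if g⁻¹ ∈ C and zero otherwise, so the density
is the restriction to C⁻¹. Thus the comparison is `invol`, for each v separately. -/
lemma freeToHomLin_apply (f : PsiV (coind k G (V →ₗ[k] P.V)).obj) (C : Clopens G) (v : V) :
    freeToHomLin P V f (deltaMap k G V v (indic k C)) =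
      (invol P (Meas.map (LinearMap.applyₗ v) (toMeas f))).1 C := by
  classical
  rw [invol_apply]
  refine congrArg P.act ?_
  refine Meas.ext fun A => ?_
  show integral (restrictFun (homFun (coind k G V) P (deltaMap k G V v (indic k C))) A)
    (Meas.map (LinearMap.lcomp k P.V (coindEval k G V)) (toMeas f)) = _
  refine Eq.trans ?_ (integral_restrictFun_const (LinearMap.applyₗ v) (A ⊓ invClopen C) (toMeas f))
  refine integral_map _ _ _ (fun g => ?_) _
  ext T
  have h' : g ∈ A ⊓ invClopen C ↔ g ∈ A ∧ g⁻¹ ∈ C := Iff.rfl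
  rw [restrictFun_apply, restrictFun_apply, LinearMap.comp_apply]
  simp only [h']
  by_cases hA : g ∈ A
  · simp only [hA, true_and, if_true]
    show _ = T ((indic k C).1 (g⁻¹ * 1) • v)
    rw [mul_one, indic_apply]
    split_ifs <;> simp
  · simp [hA]

/-- Hom_k(coind V, P) is isomorphic to the free contramodule on Hom_k(V, P), whatever P is: a
contramodule form of the tensor identity. Bijectivity comes from `invol` being its own inverse. -/
instance projective_homContra_coind : Projective (homContra (coind k G V) P) := by
  have : IsIso (freeToHom P V) := by
    refine GContra.isIso_of_bijective _ ⟨?_, fun l => ?_⟩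
    · intro f f' h
      change PsiV (coind k G (V →ₗ[k] P.V)).obj at f f'
      refine toMeas_injective (Meas.ext fun A => LinearMap.ext fun v => ?_)
      have : invol P (Meas.map (LinearMap.applyₗ v) (toMeas f)) =
          invol P (Meas.map (LinearMap.applyₗ v) (toMeas f')) := Meas.ext fun C => by
        rw [← freeToHomLin_apply, ← freeToHomLin_apply]
        exact congrArg (fun l : (coind k G V).obj.V →ₗ[k] P.V => l _) h
      have := congrArg (invol P) this
      rw [invol_invol, invol_invol] at this
      exact congrArg (fun ν : Meas k G P.V => ν.1 A) this
    · change (coind k G V).obj.V →ₗ[k] P.V at l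
      let m : Clopens G → V →ₗ[k] (coind k G V).obj.V := fun C =>
        { toFun := fun v => deltaMap k G V v (indic k C)
          map_add' := fun v w => by rw [map_add]; rfl
          map_smul' := fun a v => by rw [map_smul]; rfl }
      -- For each v, the map l is encoded by the measure C ↦ l(v·1_C); `invol` of it gives the
      -- measure of the preimage.
      let ρ : V →ₗ[k] Meas k G P.V :=
        { toFun := fun v => ofCompact (fun C => l (m C v)) fun C D h => by
            rw [← map_add]
            refine congrArg l ?_
            show deltaMap k G V v (indic k (C ⊔ D)) = _
            rw [indic_sup C D h, map_add]
            rfl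
          map_add' := fun v w => Meas.ext fun C => by
            show l (m C (v + w)) = _
            rw [map_add, map_add]; rfl
          map_smul' := fun a v => Meas.ext fun C => by
            show l (m C (a • v)) = _
            rw [map_smul, map_smul]; rfl }
      let ν : Meas k G (V →ₗ[k] P.V) := ofCompact (fun A => eval A ∘ₗ invol P ∘ₗ ρ) fun A B h => by
        ext v
        exact (invol P (ρ v)).2.1 A B h
      obtain ⟨f, hf⟩ := toMeas_surjective (k := k) ν
      refine ⟨f, ?_⟩
      show freeToHomLin P V f = l
      refine LinearMap.ext fun x => ?_
      induction coind_span x using Submodule.span_induction with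
      | mem x h =>
        obtain ⟨C, v, rfl⟩ := h
        rw [freeToHomLin_apply, hf]
        have : Meas.map (LinearMap.applyₗ v) ν = invol P (ρ v) := rfl
        rw [this, invol_invol]
        rfl
      | zero => rw [map_zero, map_zero]
      | add x y _ _ hx hy => rw [map_add, map_add, hx, hy]
      | smul a x _ hx => rw [map_smul, map_smul, hx]
  exact Projective.of_iso (asIso (freeToHom P V)) inferInstance

lemma projective_homContra (J : GSmooth k G) [Injective J] : Projective (homContra J P) :=
  Retract.projective (Y := homContra (coind k G J.obj.V) P)
    { i := homContraMap P (GSmooth.retractCoind J).r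
      r := homContraMap P (GSmooth.retractCoind J).i
      retract := by
        rw [← homContraMap_comp, (GSmooth.retractCoind J).retract, homContraMap_id] }

-- Embedding Z in a coinduced module leaves a cokernel of smaller injective dimension. Hom_k(-, P)
-- reverses the exact sequence and makes its middle term projective.
open Limits in
lemma hasProjectiveDimensionLE_homContra (d : ℕ) (Z : GSmooth k G)
    [hZ : HasInjectiveDimensionLE Z d] : HasProjectiveDimensionLE (homContra Z P) d := by
  induction d generalizing Z with
  | zero =>
    have : Injective Z := injective_iff_hasInjectiveDimensionLT_one.2 hZ
    have := projective_homContra P Z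
    exact projective_iff_hasProjectiveDimensionLT_one.1 this
  | succ d ih =>
    let i := toCoind (LinearMap.id : Z.obj.V →ₗ[k] _)
    let S := ShortComplex.mk i (cokernel.π i) (cokernel.condition i)
    have hS : S.ShortExact := .mk' (S.exact_of_g_is_cokernel (cokernelIsCokernel i))
      inferInstance inferInstance
    have h3 : HasInjectiveDimensionLE S.X₃ d :=
      (hS.hasInjectiveDimensionLT_X₃_iff d (injective_coind)).2 hZ
    have := ih S.X₃
    have : Projective (homContra S.X₂ P) := projective_homContra_coind P
    exact (shortExact_homContra P hS).hasProjectiveDimensionLT_X₃ (d + 1) ‹_› inferInstance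

/-- P is Hom_k(k, P) for the trivial module k, so the injective dimension of k alone bounds the
projective dimension of every contramodule. -/
lemma hasProjectiveDimensionLE_of_forall (n : ℕ)
    (hn : ∀ M : GSmooth k G, HasInjectiveDimensionLE M n) : HasProjectiveDimensionLE P n :=
  have := hn (trivialModule k G)
  have := hasProjectiveDimensionLE_homContra P n (trivialModule k G)
  hasProjectiveDimensionLT_of_iso (homContraTrivial P) (n + 1)

end HomCoind

/-! ### k(G) as induced from an open subgroup -/

namespace CompactFun

lemma out_inv_mul_mem {G : Type*} [Group G] {H : Subgroup G} (x : G) : (QuotientGroup.mk x : G ⧸ H).out⁻¹ * x ∈ H :=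
  QuotientGroup.eq.1 (QuotientGroup.out_eq' (QuotientGroup.mk x : G ⧸ H))

lemma eq_mk_of_mem {G : Type*} [Group G] {H : Subgroup G} {c : G ⧸ H} {x : G} (h : c.out⁻¹ * x ∈ H) : c = QuotientGroup.mk x := by
  rw [← QuotientGroup.eq.2 h, QuotientGroup.out_eq']

variable {k G : Type u} [Field k] [Group G] [TopologicalSpace G] [IsTopologicalGroup G]
  {H : Subgroup G}

open Classical in
/-- Extension by zero of functions from an open subgroup. -/
noncomputable def ext0 (hH : IsOpen (H : Set G)) : CompactFun k H →ₗ[k] CompactFun k G where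
  toFun t := ⟨fun x => if h : x ∈ H then t.1 ⟨x, h⟩ else 0, by
      rw [IsLocallyConstant.iff_exists_open]
      intro x
      by_cases hx : x ∈ H
      · obtain ⟨U, hU, hxU, h⟩ := (IsLocallyConstant.iff_exists_open _).1 t.2.1 ⟨x, hx⟩
        refine ⟨_, hH.isOpenMap_subtype_val U hU, ⟨_, hxU, rfl⟩, ?_⟩
        rintro _ ⟨y, hy, rfl⟩
        simp [hx, h y hy]
      · refine ⟨(H : Set G)ᶜ, (H.isClosed_of_isOpen hH).isOpen_compl, hx, fun y hy => ?_⟩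
        have hy : y ∉ H := hy
        simp [hx, hy], by
      refine HasCompactSupport.intro (K := Subtype.val '' (tsupport t.1))
        (t.2.2.isCompact.image continuous_subtype_val) fun x hx => ?_
      by_cases h : x ∈ H
      · have : (⟨x, h⟩ : H) ∉ tsupport t.1 := fun h' => hx ⟨_, h', rfl⟩
        simp [h, image_eq_zero_of_notMem_tsupport this]
      · simp [h]⟩
  map_add' s t := by
    refine CompactFun.ext fun x => ?_
    show (if h : x ∈ H then s.1 ⟨x, h⟩ + t.1 ⟨x, h⟩ else 0) =
      (if h : x ∈ H then s.1 ⟨x, h⟩ else 0) + (if h : x ∈ H then t.1 ⟨x, h⟩ else 0)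
    split_ifs <;> simp
  map_smul' a t := by
    refine CompactFun.ext fun x => ?_
    show (if h : x ∈ H then a * t.1 ⟨x, h⟩ else 0) = a * (if h : x ∈ H then t.1 ⟨x, h⟩ else 0)
    split_ifs <;> simp

lemma ext0_of_mem (hH : IsOpen (H : Set G)) (t : CompactFun k H) {x : G} (hx : x ∈ H) :
    (ext0 hH t).1 x = t.1 ⟨x, hx⟩ := dif_pos hx

lemma ext0_of_notMem (hH : IsOpen (H : Set G)) (t : CompactFun k H) {x : G} (hx : x ∉ H) :
    (ext0 hH t).1 x = 0 := dif_neg hx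

/-- Restriction of functions to an open subgroup. -/
def res0 (hH : IsOpen (H : Set G)) : CompactFun k G →ₗ[k] CompactFun k H where
  toFun s := ⟨fun x => s.1 x, s.2.1.comp_continuous continuous_subtype_val,
    s.2.2.comp_isClosedEmbedding (H.isClosed_of_isOpen hH).isClosedEmbedding_subtypeVal⟩
  map_add' _ _ := rfl
  map_smul' _ _ := rfl

lemma res0_apply (hH : IsOpen (H : Set G)) (s : CompactFun k G) (x : H) :
    (res0 hH s).1 x = s.1 x := rfl

lemma res0_ext0 (hH : IsOpen (H : Set G)) (t : CompactFun k H) : res0 hH (ext0 hH t) = t :=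
  CompactFun.ext fun x => ext0_of_mem hH t x.2

lemma ext0_left (hH : IsOpen (H : Set G)) (h : H) (t : CompactFun k H) :
    ext0 hH (left k H h t) = left k G h (ext0 hH t) := by
  refine CompactFun.ext fun x => ?_
  rw [left_apply]
  by_cases hx : x ∈ H
  · rw [ext0_of_mem hH _ hx, ext0_of_mem hH _ (H.mul_mem (H.inv_mem h.2) hx)]
    rfl
  · rw [ext0_of_notMem hH _ hx, ext0_of_notMem hH _ fun h' => hx ?_]
    simpa using H.mul_mem h.2 h'

lemma ext0_right (hH : IsOpen (H : Set G)) (h : H) (t : CompactFun k H) :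
    ext0 hH (right k H h t) = right k G h (ext0 hH t) := by
  refine CompactFun.ext fun x => ?_
  rw [right_apply]
  by_cases hx : x ∈ H
  · rw [ext0_of_mem hH _ hx, ext0_of_mem hH _ (H.mul_mem hx h.2)]
    rfl
  · rw [ext0_of_notMem hH _ hx, ext0_of_notMem hH _ fun h' => hx ?_]
    simpa using H.mul_mem h' (H.inv_mem h.2)

lemma ext0_inv (hH : IsOpen (H : Set G)) (t : CompactFun k H) :
    ext0 hH (comap (Homeomorph.inv H) t) = comap (Homeomorph.inv G) (ext0 hH t) := by
  refine CompactFun.ext fun x => ?_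
  rw [comap_apply]
  show _ = (ext0 hH t).1 x⁻¹
  by_cases hx : x ∈ H
  · rw [ext0_of_mem hH _ hx, ext0_of_mem hH _ (H.inv_mem hx)]
    rfl
  · rw [ext0_of_notMem hH _ hx, ext0_of_notMem hH _ fun h' => hx (by simpa using h')]

lemma comap_inv_inv (s : CompactFun k G) :
    comap (Homeomorph.inv G) (comap (Homeomorph.inv G) s) = s := by
  ext x; simp [comap_apply]

lemma comap_inv_left (g : G) (s : CompactFun k G) :
    comap (Homeomorph.inv G) (left k G g s) = right k G g (comap (Homeomorph.inv G) s) := by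
  ext x; simp [comap_apply]

lemma comap_inv_right (g : G) (s : CompactFun k G) :
    comap (Homeomorph.inv G) (right k G g s) = left k G g (comap (Homeomorph.inv G) s) := by
  ext x; simp [comap_apply]

lemma res0_left_ext0_of_notMem (hH : IsOpen (H : Set G)) {g : G} (hg : g ∉ H)
    (t : CompactFun k H) : res0 hH (left k G g (ext0 hH t)) = 0 := by
  refine CompactFun.ext fun x => ?_
  rw [res0_apply, left_apply, ext0_of_notMem hH _ fun h => hg ?_]
  · rfl
  · simpa using H.mul_mem x.2 (H.inv_mem h)

/-- The component of a function at a left coset. -/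
noncomputable def component (hH : IsOpen (H : Set G)) (c : G ⧸ H) :
    CompactFun k G →ₗ[k] CompactFun k H :=
  res0 hH ∘ₗ left k G c.out⁻¹

lemma component_apply (hH : IsOpen (H : Set G)) (s : CompactFun k G) (x : G) :
    (component hH (QuotientGroup.mk x) s).1 ⟨_, out_inv_mul_mem x⟩ = s.1 x := by
  show s.1 ((QuotientGroup.mk x : G ⧸ H).out⁻¹⁻¹ * ((QuotientGroup.mk x : G ⧸ H).out⁻¹ * x)) = s.1 x
  simp

/-- G/H is discrete, so the compact support has a finite image in it. -/
lemma finite_component (hH : IsOpen (H : Set G)) (s : CompactFun k G) :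
    {c : G ⧸ H | component hH c s ≠ 0}.Finite := by
  have : DiscreteTopology (G ⧸ H) := QuotientGroup.discreteTopology hH
  refine ((s.2.2.isCompact.image (f := (QuotientGroup.mk : G → G ⧸ H))
    QuotientGroup.continuous_mk).finite_of_discrete).subset fun c hc => ?_
  by_contra h
  refine hc (CompactFun.ext fun x => ?_)
  show s.1 (c.out⁻¹⁻¹ * x) = 0
  refine image_eq_zero_of_notMem_tsupport fun hx => h ⟨_, hx, ?_⟩
  exact (eq_mk_of_mem (by simp)).symm

lemma eq_sum_component (hH : IsOpen (H : Set G)) (s : CompactFun k G) :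
    s = ∑ c ∈ (finite_component hH s).toFinset, left k G c.out (ext0 hH (component hH c s)) := by
  refine CompactFun.ext fun x => ?_
  rw [sum_apply]
  have h1 : ∀ c : G ⧸ H, c ≠ QuotientGroup.mk x →
      (left k G c.out (ext0 hH (component hH c s))).1 x = 0 := fun c hc => by
    rw [left_apply, ext0_of_notMem hH _ fun h => hc (eq_mk_of_mem h)]
  have h2 : (left k G (QuotientGroup.mk x : G ⧸ H).out
      (ext0 hH (component hH (QuotientGroup.mk x : G ⧸ H) s))).1 x = s.1 x := by
    rw [left_apply, ext0_of_mem hH _ (out_inv_mul_mem x), component_apply]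
  rw [Finset.sum_eq_single (QuotientGroup.mk x : G ⧸ H) (fun c _ hc => h1 c hc), h2]
  intro h
  have h0 : component hH (QuotientGroup.mk x : G ⧸ H) s = 0 := by simpa using h
  rw [h0, map_zero, map_zero]
  rfl

lemma span_left_ext0 (hH : IsOpen (H : Set G)) (s : CompactFun k G) :
    s ∈ Submodule.span k {s | ∃ (g : G) (t : CompactFun k H), s = left k G g (ext0 hH t)} := by
  rw [eq_sum_component hH s]
  exact Submodule.sum_mem _ fun c _ => Submodule.subset_span ⟨_, _, rfl⟩

lemma span_right_ext0 (hH : IsOpen (H : Set G)) (s : CompactFun k G) :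
    s ∈ Submodule.span k {s | ∃ (g : G) (t : CompactFun k H), s = right k G g (ext0 hH t)} := by
  rw [← comap_inv_inv s, eq_sum_component hH (comap (Homeomorph.inv G) s), map_sum]
  refine Submodule.sum_mem _ fun c _ => Submodule.subset_span ⟨c.out,
    comap (Homeomorph.inv H) (component hH c (comap (Homeomorph.inv G) s)), ?_⟩
  rw [comap_inv_left, ext0_inv]

variable {E : Type*} [AddCommGroup E] [Module k E]

/-- k(G) is the direct sum of translates of k(H) by coset representatives, so L is defined by its
values there; `hT` extends the formula from representatives to all g. -/
lemma exists_descent_left (hH : IsOpen (H : Set G)) (T : G → CompactFun k H →ₗ[k] E)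
    (hT : ∀ g (h : H) t, T (g * h) t = T g (left k H h t)) :
    ∃ L : CompactFun k G →ₗ[k] E, ∀ g t, L (left k G g (ext0 hH t)) = T g t := by
  have hfin : ∀ s, (Function.support fun c : G ⧸ H => T c.out (component hH c s)).Finite :=
    fun s => (finite_component hH s).subset fun c hc h0 => hc (by
      show T c.out (component hH c s) = 0
      rw [h0, map_zero])
  refine ⟨
    { toFun := fun s => ∑ᶠ c : G ⧸ H, T c.out (component hH c s)
      map_add' := fun s s' => by
        rw [← finsum_add_distrib (hfin s) (hfin s')]
        exact finsum_congr fun c => by rw [map_add, map_add]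
      map_smul' := fun a s => by
        rw [RingHom.id_apply, smul_finsum' a (hfin s)]
        exact finsum_congr fun c => by rw [map_smul, map_smul] }, fun g t => ?_⟩
  have key : ∀ c : G ⧸ H, component hH c (left k G g (ext0 hH t)) =
      res0 hH (left k G (c.out⁻¹ * g) (ext0 hH t)) := fun c => by
    rw [map_mul]; rfl
  refine (finsum_eq_single _ (QuotientGroup.mk g : G ⧸ H) fun c hc => ?_).trans ?_
  · rw [key, res0_left_ext0_of_notMem hH (fun h => hc (eq_mk_of_mem h)), map_zero]
  · have := ext0_left hH ⟨_, out_inv_mul_mem (H := H) g⟩ t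
    rw [key, ← this, res0_ext0, ← hT]
    simp

/-- The map x ↦ x⁻¹ exchanges left and right translations. -/
lemma exists_descent_right (hH : IsOpen (H : Set G)) (T : G → CompactFun k H →ₗ[k] E)
    (hT : ∀ g (h : H) t, T (g * h) t = T g (right k H h t)) :
    ∃ L : CompactFun k G →ₗ[k] E, ∀ g t, L (right k G g (ext0 hH t)) = T g t := by
  obtain ⟨L, hL⟩ := exists_descent_left hH (fun g => T g ∘ₗ comap (Homeomorph.inv H))
    fun g h t => by
      rw [LinearMap.comp_apply, LinearMap.comp_apply, hT, comap_inv_left]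
  refine ⟨L ∘ₗ comap (Homeomorph.inv G), fun g t => ?_⟩
  rw [LinearMap.comp_apply, comap_inv_right, ← ext0_inv, hL, LinearMap.comp_apply, comap_inv_inv]

end CompactFun

/-! ### Measures as sums over cosets -/

namespace Contra.Meas

variable {k : Type*} [Field k] {G : Type*} [Group G] [TopologicalSpace G] [IsTopologicalGroup G]
  {H : Subgroup G} {V : Type*} [AddCommGroup V] [Module k V]

/-- The parametrization of a left coset of a subgroup. -/
def cosetMap (H : Subgroup G) (y : G) : C(H, G) := ⟨fun h => y * h, by fun_prop⟩

/-- The open-closed subset `yB` for an open-closed subset `B` of an open subgroup. -/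
def cosetClopen (hH : IsOpen (H : Set G)) (y : G) (B : Clopens H) : Clopens G :=
  ⟨cosetMap H y '' B,
    ((Homeomorph.mulLeft y).isClosedEmbedding.comp
      (H.isClosed_of_isOpen hH).isClosedEmbedding_subtypeVal).isClosedMap _ B.isClopen.1,
    ((Homeomorph.mulLeft y).isOpenEmbedding.comp
      hH.isOpenEmbedding_subtypeVal).isOpenMap _ B.isClopen.2⟩

/-- The compact support meets finitely many of the open cosets yH, and the part of μ on each is
carried by a copy of the compact group H. -/
lemma span_push_cosetMap [CompactSpace H] (hH : IsOpen (H : Set G)) (μ : Meas k G V) :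
    μ ∈ Submodule.span k
      {μ : Meas k G V | ∃ (y : G) (ν : Meas k H V), μ = push (cosetMap H y) ν} := by
  obtain ⟨K, hK, hμ⟩ := μ.2.2
  have : DiscreteTopology (G ⧸ H) := QuotientGroup.discreteTopology hH
  let c : LocallyConstant G (G ⧸ H) :=
    ⟨QuotientGroup.mk, (IsLocallyConstant.iff_continuous _).2 QuotientGroup.continuous_mk⟩
  obtain ⟨t, ht⟩ := exists_finset c hK
  let ν : G ⧸ H → Meas k H V := fun q => ofCompact (fun B => μ.1 (cosetClopen hH q.out B))
    fun A B h => by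
      rw [← μ.2.1]
      · exact congrArg μ.1 (Clopens.ext (Set.image_union _ _ _))
      · refine Set.disjoint_image_of_injective (fun a b hab => ?_) h
        exact Subtype.ext (mul_left_cancel hab)
  have h : μ = ∑ q ∈ t, push (cosetMap H q.out) (ν q) := by
    refine Meas.ext fun A => ?_
    rw [eq_sum hμ c t ht A, ← eval_apply A (∑ q ∈ t, _), map_sum]
    refine Finset.sum_congr rfl fun q _ => congrArg μ.1 (Clopens.ext (Set.ext fun x => ?_))
    constructor
    · rintro ⟨hx, hx'⟩
      have hx' : (QuotientGroup.mk x : G ⧸ H) = q := hx'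
      subst hx'
      refine ⟨⟨_, CompactFun.out_inv_mul_mem x⟩, ?_, ?_⟩
      · show _ * (_ * x) ∈ A
        rw [mul_inv_cancel_left]
        exact hx
      · exact mul_inv_cancel_left _ _
    · rintro ⟨h, hx, rfl⟩
      refine ⟨hx, ?_⟩
      exact (CompactFun.eq_mk_of_mem (by show q.out⁻¹ * (q.out * h) ∈ H; simp)).symm
  rw [h]
  exact Submodule.sum_mem _ fun q _ => Submodule.subset_span ⟨_, _, rfl⟩

end Contra.Meas

/-! ### Ψ and Φ commute with restriction to an open subgroup -/

section BaseChange

open Contra Contra.Meas CompactFun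

variable {k G : Type u} [Field k] [Group G] [TopologicalSpace G] [IsTopologicalGroup G]
  {H : Subgroup G} (hH : IsOpen (H : Set G))

/-- The restriction to an open subgroup of an equivariant map from `k(G)`. -/
noncomputable def psiResLin (M : GSmooth k G) :
    PsiV M.obj →ₗ[k] PsiV ((GSmooth.res k H).obj M).obj where
  toFun f :=
    { toLinearMap := f.toLinearMap ∘ₗ ext0 hH
      isIntertwining' := fun h => LinearMap.ext fun t => by
        show f (ext0 hH (CompactFun.left k H h t)) = M.obj.ρ h (f (ext0 hH t))
        rw [ext0_left, f.isIntertwining] }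
  map_add' _ _ := rfl
  map_smul' _ _ := rfl

/-- The comparison morphism from the restriction of `Ψ_G` to `Ψ_H` of the restriction. -/
noncomputable def psiRes (M : GSmooth k G) :
    (GContra.res k H).obj ((Psi k G).obj M) ⟶ (Psi k H).obj ((GSmooth.res k H).obj M) where
  lin := psiResLin hH M
  comm μ := by
    change Meas k H (PsiV M.obj) at μ
    apply Representation.IntertwiningMap.ext
    refine LinearMap.ext fun t => ?_
    let F' : LocallyConstant H (PsiV M.obj →ₗ[k] M.obj.V) :=
      ⟨fun h => psiFun M.obj (ext0 hH t) h,
        (psiFun M.obj (ext0 hH t)).isLocallyConstant.comp_continuous continuous_subtype_val⟩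
    refine (integral_push (inclMap H) (psiFun M.obj (ext0 hH t)) F' (fun _ => rfl) μ).trans ?_
    refine (integral_map (psiResLin hH M) (psiFun ((GSmooth.res k H).obj M).obj t) F'
      (fun h => ?_) μ).symm
    refine LinearMap.ext fun f => ?_
    show f (CompactFun.right k G h (ext0 hH t)) = f (ext0 hH (CompactFun.right k H h t))
    rw [ext0_right]

lemma psiRes_naturality {M N : GSmooth k G} (g : M ⟶ N) :
    (GContra.res k H).map ((Psi k G).map g) ≫ psiRes hH N =
      psiRes hH M ≫ (Psi k H).map ((GSmooth.res k H).map g) := rfl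

/-- Frobenius reciprocity: an H-map f on k(H) extends to k(G) by sending the translate gt to g f(t),
and uniquely, because the translates of k(H) span. -/
lemma isIso_psiRes (M : GSmooth k G) : IsIso (psiRes hH M) := by
  refine GContra.isIso_of_bijective _ ⟨fun f f' h => ?_, fun f => ?_⟩
  · change PsiV M.obj at f f'
    have h : ∀ t, f (ext0 hH t) = f' (ext0 hH t) := fun t =>
      congrArg (fun f : PsiV ((GSmooth.res k H).obj M).obj => f t) h
    apply Representation.IntertwiningMap.ext
    refine LinearMap.ext fun s => ?_
    show f s = f' s
    induction span_left_ext0 hH s using Submodule.span_induction with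
    | mem s hs =>
      obtain ⟨g, t, rfl⟩ := hs
      rw [f.isIntertwining, f'.isIntertwining, h]
    | zero => rw [map_zero, map_zero]
    | add x y _ _ hx hy => rw [map_add, map_add, hx, hy]
    | smul a x _ hx => rw [map_smul, map_smul, hx]
  · change PsiV ((GSmooth.res k H).obj M).obj at f
    let f₀ : CompactFun k H →ₗ[k] M.obj.V := f.toLinearMap
    have hf₀ : ∀ (h : H) t, f₀ (CompactFun.left k H h t) = M.obj.ρ h (f₀ t) :=
      fun h t => Representation.IntertwiningMap.isIntertwining _ _ f h t
    obtain ⟨L, hL⟩ := exists_descent_left hH (fun g => M.obj.ρ g ∘ₗ f₀) fun g h t => by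
      rw [LinearMap.comp_apply, LinearMap.comp_apply, hf₀, map_mul]
      rfl
    have hequiv : ∀ (g : G) (s : CompactFun k G),
        L (CompactFun.left k G g s) = M.obj.ρ g (L s) := by
      intro g s
      induction span_left_ext0 hH s using Submodule.span_induction with
      | mem s hs =>
        obtain ⟨g', t, rfl⟩ := hs
        rw [← Module.End.mul_apply, ← map_mul, hL, hL, map_mul]
        rfl
      | zero => simp
      | add x y _ _ hx hy => simp only [map_add, hx, hy]
      | smul a x _ hx => simp only [map_smul, hx]
    refine ⟨({ toLinearMap := L, isIntertwining' := fun g => LinearMap.ext (hequiv g) } :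
      PsiV M.obj), ?_⟩
    apply Representation.IntertwiningMap.ext
    refine LinearMap.ext fun t => ?_
    show L (ext0 hH t) = f₀ t
    have := hL 1 t
    simpa using this

lemma phi_mk_dirac (P : GContra k G) (s : CompactFun k G) (g : G) (p : P.V) :
    (phiRel P).mkQ (s ⊗ₜ P.act (dirac g p)) =
      (phiRel P).mkQ (CompactFun.right k G g s ⊗ₜ p) := by
  rw [phi_mk_act, integral_dirac, phiFun_apply]

/-- The comparison morphism from `Φ_H` of the restriction to the restriction of `Φ_G`. -/
noncomputable def phiRes (P : GContra k G) :
    (Phi k H).obj ((GContra.res k H).obj P) ⟶ (GSmooth.res k H).obj ((Phi k G).obj P) :=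
  ((phiPsiAdjunction k H).homEquiv _ _).symm
    ((GContra.res k H).map ((phiPsiAdjunction k G).unit.app P) ≫ psiRes hH ((Phi k G).obj P))

/-- `phiRes` is by definition the mate of `psiRes`. This and `phiRes_counit` express the unit and
counit over G, after restriction, through those over H. -/
lemma unit_psiRes (P : GContra k G) :
    (GContra.res k H).map ((phiPsiAdjunction k G).unit.app P) ≫ psiRes hH ((Phi k G).obj P) =
      (phiPsiAdjunction k H).unit.app _ ≫ (Psi k H).map (phiRes hH P) := rfl

lemma phiRes_counit (M : GSmooth k G) :
    phiRes hH ((Psi k G).obj M) ≫ (GSmooth.res k H).map ((phiPsiAdjunction k G).counit.app M) =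
      (Phi k H).map (psiRes hH M) ≫ (phiPsiAdjunction k H).counit.app _ :=
  gsmooth_hom_ext fun _ _ => rfl

lemma phiRes_naturality {P Q : GContra k G} (f : P ⟶ Q) :
    phiRes hH P ≫ (GSmooth.res k H).map ((Phi k G).map f) =
      (Phi k H).map ((GContra.res k H).map f) ≫ phiRes hH Q :=
  gsmooth_hom_ext fun _ _ => rfl

/-- Contraassociativity for a point measure at (a, b). In this order of factors the point measures
make P a right G-module. -/
lemma act_dirac_mul (P : GContra k G) (a b : G) (p : P.V) :
    P.act (dirac (a * b) p) = P.act (dirac b (P.act (dirac a p))) := by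
  classical
  have h1 : dirac (a * b) p = push (mulMap G) (dirac (k := k) (a, b) p) := rfl
  have h2 : curry (dirac (k := k) (a, b) p) = dirac b (dirac a p) := by
    refine Meas.ext fun B => Meas.ext fun A => ?_
    show (if (a, b) ∈ A ×ˢ B then p else 0) = (if b ∈ B then dirac (k := k) a p else 0).1 A
    have h : (a, b) ∈ A ×ˢ B ↔ a ∈ A ∧ b ∈ B := Iff.rfl
    simp only [h]
    by_cases hb : b ∈ B
    · simp only [hb, and_true, if_true]; rfl
    · simp only [hb, and_false, if_false]; rfl
  rw [h1, P.act_assoc, h2, map_dirac]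

lemma act_push_mulRight (P : GContra k G) (g : G) (μ : Meas k G P.V) :
    P.act (push ⟨fun x => x * g, by fun_prop⟩ μ) = P.act (dirac g (P.act μ)) := by
  classical
  have h1 : push ⟨fun x => x * g, by fun_prop⟩ μ =
    push (mulMap G) (push ⟨fun x => (x, g), by fun_prop⟩ μ) := rfl
  have h2 : curry (push ⟨fun x => (x, g), by fun_prop⟩ μ) = dirac g μ := by
    refine Meas.ext fun B => Meas.ext fun A => ?_
    show μ.1 _ = (if g ∈ B then μ else 0).1 A
    by_cases hg : g ∈ B
    · simp only [hg, if_true]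
      exact congrArg μ.1 (Clopens.ext (Set.ext fun x => and_iff_left hg))
    · simp only [hg, if_false]
      exact (congrArg μ.1 (Clopens.ext (Set.ext fun x => iff_of_false (fun h : x ∈ A ∧ g ∈ B => hg h.2) id))).trans
        (apply_bot μ)
  rw [h1, P.act_assoc, h2, map_dirac]

/-- Contraassociativity for the image of ν under h ↦ (y, h): a measure on yH acts like one on H
whose values are first moved by y. -/
lemma act_push_cosetMap (P : GContra k G) (y : G) (ν : Meas k H P.V) :
    P.act (push (cosetMap H y) ν) =
      P.act (push (inclMap H) (Meas.map (P.act ∘ₗ dirac y) ν)) := by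
  classical
  have h1 : push (cosetMap H y) ν =
    push (mulMap G) (push ⟨fun h : H => (y, (h : G)), by fun_prop⟩ ν) := rfl
  have h2 : curry (push ⟨fun h : H => (y, (h : G)), by fun_prop⟩ ν) =
      Meas.map (dirac y) (push (inclMap H) ν) := by
    refine Meas.ext fun B => Meas.ext fun A => ?_
    show ν.1 _ = if y ∈ A then _ else _
    split_ifs with hy
    · exact congrArg ν.1 (Clopens.ext (Set.ext fun x => and_iff_right hy))
    · exact (congrArg ν.1 (Clopens.ext (Set.ext fun x => iff_of_false (fun h : y ∈ A ∧ (x : G) ∈ B => hy h.1) id))).trans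
        (apply_bot ν)
  rw [h1, P.act_assoc, h2]
  rfl

variable (P : GContra k G)

/-- The family of maps `t ↦ (p ↦ t ⊗ p g)`. -/
noncomputable def twistMap (H : Subgroup G) (g : G) :
    CompactFun k H →ₗ[k] P.V →ₗ[k] PhiV ((GContra.res k H).obj P) :=
  let Q := (GContra.res k H).obj P
  let a : P.V →ₗ[k] Q.V := P.act ∘ₗ dirac g
  LinearMap.mk₂ k (fun t p => (phiRel Q).mkQ (t ⊗ₜ a p))
    (fun t t' p => by rw [TensorProduct.add_tmul, map_add])
    (fun c t p => by rw [← TensorProduct.smul_tmul', map_smul])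
    (fun t p p' => by rw [map_add, TensorProduct.tmul_add, map_add])
    (fun c t p => by rw [map_smul, TensorProduct.tmul_smul, map_smul])

lemma twistMap_apply (g : G) (t : CompactFun k H) (p : P.V) :
    twistMap P H g t p = (phiRel ((GContra.res k H).obj P)).mkQ (t ⊗ₜ P.act (dirac g p)) := rfl

/-- An element of H passes through the tensor sign by the relation in Φ_H. This is the compatibility
required for descent to k(G). -/
lemma twistMap_mul (g : G) (h : H) (t : CompactFun k H) :
    twistMap P H (g * h) t = twistMap P H g (CompactFun.right k H h t) := by
  refine LinearMap.ext fun p => ?_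
  rw [twistMap_apply, twistMap_apply, act_dirac_mul]
  exact phi_mk_dirac ((GContra.res k H).obj P) t h _

lemma isLocallyConstant_twistMap (hH : IsOpen (H : Set G)) (t : CompactFun k H) :
    IsLocallyConstant fun g => twistMap P H g t := by
  rw [IsLocallyConstant.iff_exists_open]
  intro g
  have hU := hH.isOpenMap_subtype_val _ (isOpen_stab_right t)
  refine ⟨(fun x => g⁻¹ * x) ⁻¹' _, hU.preimage (continuous_const_mul g⁻¹),
    ⟨1, by simp, by simp⟩, ?_⟩
  rintro x ⟨h, hh, hx⟩
  have hh : CompactFun.right k H h t = t := hh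
  have hx : (h : G) = g⁻¹ * x := hx
  have : x = g * h := by rw [hx, mul_inv_cancel_left]
  rw [this, twistMap_mul, hh]

/-- The relation defining Φ_H concerns measures on H; this is its extension to measures on G. By
linearity μ may be taken on one coset yH, where moving the values by y reduces it to H. -/
lemma phi_mk_act_eq_integral [CompactSpace H] (hH : IsOpen (H : Set G)) (t : CompactFun k H)
    (μ : Meas k G P.V) :
    (phiRel ((GContra.res k H).obj P)).mkQ (t ⊗ₜ P.act μ) =
      integral ⟨fun g => twistMap P H g t, isLocallyConstant_twistMap P hH t⟩ μ := by
  set F : LocallyConstant G (P.V →ₗ[k] PhiV ((GContra.res k H).obj P)) :=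
    ⟨fun g => twistMap P H g t, isLocallyConstant_twistMap P hH t⟩
  let L : Meas k G P.V →ₗ[k] PhiV ((GContra.res k H).obj P) :=
    (phiRel ((GContra.res k H).obj P)).mkQ ∘ₗ
      (TensorProduct.mk k (CompactFun k H) ((GContra.res k H).obj P).V t) ∘ₗ P.act
  have key : L μ = integralₗ F μ := by
    induction span_push_cosetMap hH μ using Submodule.span_induction with
    | mem μ h =>
      obtain ⟨y, ν, rfl⟩ := h
      let Q := (GContra.res k H).obj P
      let a : P.V →ₗ[k] Q.V := P.act ∘ₗ dirac y
      have h1 : L (push (cosetMap H y) ν) = (phiRel Q).mkQ (t ⊗ₜ Q.act (Meas.map a ν)) :=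
        congrArg (fun p => (phiRel Q).mkQ (t ⊗ₜ (p : Q.V))) (act_push_cosetMap P y ν)
      let F' : LocallyConstant H (Q.V →ₗ[k] PhiV Q) :=
        (phiFun Q t).map fun T => (phiRel Q).mkQ ∘ₗ T
      let F'' : LocallyConstant H (P.V →ₗ[k] PhiV Q) := F'.map fun T => T ∘ₗ a
      rw [h1, phi_mk_act, ← integral_comp (phiRel Q).mkQ (phiFun Q t) F' (fun _ => rfl),
        integral_map a F' F'' fun _ => rfl]
      refine (integral_push (cosetMap H y) F F'' (fun h => ?_) ν).symm
      exact (twistMap_mul P y h t).symm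
    | zero => rw [map_zero, map_zero]
    | add x y _ _ hx hy => rw [map_add, map_add, hx, hy]
    | smul c x _ hx => rw [map_smul, map_smul, hx]
  exact key

/-- The inverse sends the right translate by g of t ∈ k(H), tensored with p, to t ⊗ pg, where pg is
the action of the point measure at g. Descent makes this well defined on k(G) ⊗ P. -/
lemma isIso_phiRes [CompactSpace H] : IsIso (phiRes hH P) := by
  let Q := (GContra.res k H).obj P
  obtain ⟨L, hL⟩ := exists_descent_right hH (twistMap P H) (twistMap_mul P)
  let L' : CompactFun k G ⊗[k] P.V →ₗ[k] PhiV Q := TensorProduct.lift L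
  have hL' : ∀ (s : CompactFun k G) (p : P.V), L' (s ⊗ₜ p) = L s p := fun _ _ => rfl
  have hrel : phiRel P ≤ LinearMap.ker L' := by
    refine Submodule.span_le.2 ?_
    rintro _ ⟨s, μ, rfl⟩
    show L' _ = 0
    rw [map_sub, sub_eq_zero, hL']
    let A : CompactFun k G →ₗ[k] PhiV Q := (LinearMap.applyₗ (P.act μ)) ∘ₗ L
    let F' : CompactFun k G → LocallyConstant G (P.V →ₗ[k] PhiV Q) := fun s =>
      (phiFun P s).map fun T => L' ∘ₗ T
    rw [← integral_comp L' (phiFun P s) (F' s) fun _ => rfl]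
    show A s = _
    -- By linearity s is a right translate by g of some t ∈ k(H). Then π(μ)g is the contraaction of
    -- the right translate of μ by g, and the relation extended to G applies.
    induction span_right_ext0 hH s using Submodule.span_induction with
    | mem s hs =>
      obtain ⟨g, t, rfl⟩ := hs
      show L _ (P.act μ) = _
      rw [hL, twistMap_apply, ← act_push_mulRight, phi_mk_act_eq_integral P hH]
      refine integral_push _ _ _ (fun x => ?_) μ
      refine LinearMap.ext fun p => ?_
      show L (CompactFun.right k G x (CompactFun.right k G g (ext0 hH t))) p = _
      rw [← Module.End.mul_apply, ← map_mul, hL]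
      rfl
    | zero =>
      rw [map_zero]
      refine (integral_eq_zero _ (μ.2.2.choose_spec.2) fun x _ => LinearMap.ext fun p => ?_).symm
      show L (CompactFun.right k G x 0) p = 0
      simp
    | add s s' _ _ hs hs' =>
      rw [map_add, hs, hs']
      refine (integral_add_fun _ _ _ (fun x => LinearMap.ext fun p => ?_) μ).symm
      show L (CompactFun.right k G x (s + s')) p = L (CompactFun.right k G x s) p +
        L (CompactFun.right k G x s') p
      simp
    | smul a s _ hs =>
      rw [map_smul, hs]
      refine (integral_smul_fun a _ _ (fun x => LinearMap.ext fun p => ?_) μ).symm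
      show L (CompactFun.right k G x (a • s)) p = a • L (CompactFun.right k G x s) p
      simp
  let γ : PhiV P →ₗ[k] PhiV Q := (phiRel P).liftQ L' hrel
  let B : PhiV Q →ₗ[k] PhiV P := GSmooth.lin (phiRes hH P)
  have hγ : ∀ x, γ (B x) = x := by
    intro x
    obtain ⟨x, rfl⟩ := (phiRel Q).mkQ_surjective x
    induction x using TensorProduct.induction_on with
    | zero => rw [map_zero, map_zero, map_zero]
    | add x y hx hy => rw [map_add, map_add, map_add, hx, hy]
    | tmul t p =>
      change P.V at p
      show L (ext0 hH t) p = _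
      have := hL 1 t
      rw [map_one, Module.End.one_apply] at this
      rw [this]
      exact congrArg (fun q : Q.V => (phiRel Q).mkQ (t ⊗ₜ q)) (P.act_unit p)
  -- Injectivity comes from the left inverse γ; surjectivity, from moving the translation by g over
  -- to p.
  refine GSmooth.isIso_of_bijective _ ⟨fun a b h => ?_, fun x => ?_⟩
  · exact (hγ a).symm.trans ((congrArg γ h).trans (hγ b))
  · change PhiV P at x
    obtain ⟨x, rfl⟩ := (phiRel P).mkQ_surjective x
    show (phiRel P).mkQ x ∈ LinearMap.range B
    induction x using TensorProduct.induction_on with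
    | zero => rw [map_zero]; exact Submodule.zero_mem _
    | add x y hx hy => rw [map_add]; exact Submodule.add_mem _ hx hy
    | tmul s p =>
      induction span_right_ext0 hH s using Submodule.span_induction with
      | mem s hs =>
        obtain ⟨g, t, rfl⟩ := hs
        rw [← phi_mk_dirac]
        let q : Q.V := P.act (dirac g p)
        exact ⟨(phiRel Q).mkQ (t ⊗ₜ q), rfl⟩
      | zero => rw [TensorProduct.zero_tmul, map_zero]; exact Submodule.zero_mem _
      | add x y _ _ hx hy =>
        rw [TensorProduct.add_tmul, map_add]
        exact Submodule.add_mem _ hx hy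
      | smul c x _ hx =>
        rw [← TensorProduct.smul_tmul', map_smul]
        exact Submodule.smul_mem _ _ hx

end BaseChange

/-! ### Relatively injective and relatively projective objects -/

section ClosureProperties

open Limits ZeroObject

variable {A B : Type*} [Category* A] [Abelian A] [Category* B] [Abelian B] (F : A ⥤ B) [F.Additive]

/-- The objects sent to injective objects by a functor. -/
def injectiveAfter : ObjectProperty A := fun X => Injective (F.obj X)

/-- The objects sent to projective objects by a functor. -/
def projectiveAfter : ObjectProperty A := fun X => Projective (F.obj X)

instance : (injectiveAfter F).IsClosedUnderIsomorphisms where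
  of_iso e h := Injective.of_iso (F.mapIso e) h

instance : (projectiveAfter F).IsClosedUnderIsomorphisms where
  of_iso e h := Projective.of_iso (F.mapIso e) h

instance : (injectiveAfter F).ContainsZero where
  exists_zero := ⟨(0 : A), isZero_zero A, (F.map_isZero (isZero_zero A)).injective⟩

instance : (projectiveAfter F).ContainsZero where
  exists_zero := ⟨(0 : A), isZero_zero A, (F.map_isZero (isZero_zero A)).projective⟩

instance : (injectiveAfter F).IsClosedUnderBinaryProducts where
  limitsOfShape_le := by
    rintro X ⟨p⟩
    let e : X ≅ p.diag.obj ⟨.left⟩ ⊞ p.diag.obj ⟨.right⟩ :=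
      p.isLimit.conePointsIsoOfNatIso (limit.isLimit _) (diagramIsoPair p.diag) ≪≫
        (biprod.isoProd _ _).symm
    have h1 : Injective (F.obj (p.diag.obj ⟨.left⟩)) := p.prop_diag_obj _
    have h2 : Injective (F.obj (p.diag.obj ⟨.right⟩)) := p.prop_diag_obj _
    have := preservesBinaryBiproducts_of_preservesBiproducts F
    exact Injective.of_iso (F.mapIso e ≪≫ F.mapBiprod _ _).symm inferInstance

instance : (projectiveAfter F).IsClosedUnderBinaryProducts where
  limitsOfShape_le := by
    rintro X ⟨p⟩
    let e : X ≅ p.diag.obj ⟨.left⟩ ⊞ p.diag.obj ⟨.right⟩ :=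
      p.isLimit.conePointsIsoOfNatIso (limit.isLimit _) (diagramIsoPair p.diag) ≪≫
        (biprod.isoProd _ _).symm
    have h1 : Projective (F.obj (p.diag.obj ⟨.left⟩)) := p.prop_diag_obj _
    have h2 : Projective (F.obj (p.diag.obj ⟨.right⟩)) := p.prop_diag_obj _
    have := preservesBinaryBiproducts_of_preservesBiproducts F
    exact Projective.of_iso (F.mapIso e ≪≫ F.mapBiprod _ _).symm inferInstance

end ClosureProperties

/-! ### Adapted objects over G -/

section Final

open Contra Contra.Meas CompactFun

variable {k G : Type u} [Field k] [Group G] [TopologicalSpace G] [IsTopologicalGroup G]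
  {H : Subgroup G}

/-- The evaluation of linear maps from a coinduced module at the constant function. -/
noncomputable def homContraCoindEval (P : GContra k G) :
    homContra (GSmooth.coind k G k) P ⟶ P :=
  let one : (GSmooth.coind k G k).obj.V :=
    (⟨fun _ => 1, by
      have : {g : G | GSmooth.funRep k G k g (fun _ => 1) = fun _ => 1} = Set.univ :=
        Set.eq_univ_of_forall fun g => rfl
      show IsOpen _
      rw [this]
      exact isOpen_univ⟩ : GSmooth.smoothFun k G k)
  let e : ((GSmooth.coind k G k).obj.V →ₗ[k] P.V) →ₗ[k] P.V := LinearMap.applyₗ one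
  ⟨e, fun μ => congrArg P.act (Eq.trans
    (congrArg (fun F => dens F μ) (LocallyConstant.ext fun _ => rfl)) (dens_const e μ))⟩

/-- The map f ↦ f(1)p takes the constant function 1 to p. -/
lemma epi_homContraCoindEval (P : GContra k G) : Epi (homContraCoindEval P) :=
  GContra.epi_of_surj _ fun p =>
    ⟨(LinearMap.toSpanSingleton k P.V p) ∘ₗ GSmooth.coindEval k G k, one_smul k p⟩

/-- Restriction commutes with Hom_k(-, P), and coinduced modules stay injective over H. This yields
enough adapted contramodules even for noncompact G. -/
lemma projectiveAfter_homContra_coind [CompactSpace H] (hH : IsOpen (H : Set G))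
    (P : GContra k G) :
    projectiveAfter (GContra.res k H) (homContra (GSmooth.coind k G k) P) :=
  have := GSmooth.injective_res_coind (k := k) (V := k) hH
  Projective.of_iso (resHomContra (GSmooth.coind k G k) P H).symm (projective_homContra _ _)

lemma isIso_of_isIso_smoothRes {M N : GSmooth k G} (f : M ⟶ N)
    (h : IsIso ((GSmooth.res k H).map f)) : IsIso f :=
  GSmooth.isIso_of_bijective f (by exact GSmooth.bijective_of_isIso ((GSmooth.res k H).map f))

lemma isIso_of_isIso_contraRes {M N : GContra k G} (f : M ⟶ N)
    (h : IsIso ((GContra.res k H).map f)) : IsIso f :=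
  GContra.isIso_of_bijective f (by exact GContra.bijective_of_isIso ((GContra.res k H).map f))

/-- A right adjoint is left exact, so surjectivity is at stake. Over H the sequence splits and Ψ_H
keeps its last map surjective; `psiRes` carries this back to G. -/
lemma shortExact_psi (hH : IsOpen (H : Set G)) (S : ShortComplex (GSmooth k G)) (hS : S.ShortExact)
    (h : injectiveAfter (GSmooth.res k H) S.X₁) : (S.map (Psi k G)).ShortExact := by
  have : Injective (S.map (GSmooth.res k H)).X₁ := h
  let σ := (GSmooth.shortExact_res H hS).splittingOfInjective
  have := hS.mono_f
  have := isIso_psiRes hH S.X₂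
  have := isIso_psiRes hH S.X₃
  have : (Psi k G).IsRightAdjoint := (phiPsiAdjunction k G).isRightAdjoint
  have hs : Function.Surjective ((GContra.res k H).map ((Psi k G).map S.g)).lin := by
    have h1 : IsSplitEpi ((Psi k H).map ((GSmooth.res k H).map S.g)) :=
      have : IsSplitEpi ((GSmooth.res k H).map S.g) := ⟨⟨σ.s, σ.s_g⟩⟩
      inferInstance
    have h2 : Epi ((GContra.res k H).map ((Psi k G).map S.g) ≫ psiRes hH S.X₃) := by
      rw [psiRes_naturality]
      exact epi_comp _ _
    have h3 := epi_comp ((GContra.res k H).map ((Psi k G).map S.g) ≫ psiRes hH S.X₃)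
      (inv (psiRes hH S.X₃))
    rw [Category.assoc, IsIso.hom_inv_id, Category.comp_id] at h3
    exact GContra.surjective_of_epi _
  have : Epi (S.map (Psi k G)).g := GContra.epi_of_surj _ hs
  have : Mono (S.map (Psi k G)).f := inferInstanceAs (Mono ((Psi k G).map S.f))
  exact .mk' (hS.exact.map_of_mono_of_preservesKernel (Psi k G) ‹_› inferInstance) ‹_› ‹_›

variable [CompactSpace H]

/-- Restriction to H detects isomorphisms, and it takes the counit to that of H up to the
isomorphisms `phiRes` and `psiRes`. -/
lemma isIso_counit_of_injectiveAfter (hH : IsOpen (H : Set G)) (M : GSmooth k G)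
    (hM : injectiveAfter (GSmooth.res k H) M) :
    IsIso ((phiPsiAdjunction k G).counit.app M) := by
  have : Injective ((GSmooth.res k H).obj M) := hM
  have := isIso_phiRes hH ((Psi k G).obj M)
  have := isIso_psiRes hH M
  have := isIso_counit_of_injective ((GSmooth.res k H).obj M)
  have h : IsIso (phiRes hH ((Psi k G).obj M) ≫
      (GSmooth.res k H).map ((phiPsiAdjunction k G).counit.app M)) := by
    rw [phiRes_counit]
    exact IsIso.comp_isIso
  exact isIso_of_isIso_smoothRes _ (IsIso.of_isIso_comp_left (phiRes hH ((Psi k G).obj M)) _)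

lemma isIso_unit_of_projectiveAfter (hH : IsOpen (H : Set G)) (P : GContra k G)
    (hP : projectiveAfter (GContra.res k H) P) :
    IsIso ((phiPsiAdjunction k G).unit.app P) := by
  have : Projective ((GContra.res k H).obj P) := hP
  have := isIso_phiRes hH P
  have := isIso_psiRes hH ((Phi k G).obj P)
  have := isIso_unit_of_projective ((GContra.res k H).obj P)
  have h : IsIso ((GContra.res k H).map ((phiPsiAdjunction k G).unit.app P) ≫
      psiRes hH ((Phi k G).obj P)) := by
    rw [unit_psiRes]
    exact IsIso.comp_isIso
  exact isIso_of_isIso_contraRes _ (IsIso.of_isIso_comp_right _ (psiRes hH ((Phi k G).obj P)))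

lemma projectiveAfter_psi (hH : IsOpen (H : Set G)) (M : GSmooth k G) (hM : injectiveAfter (GSmooth.res k H) M) :
    projectiveAfter (GContra.res k H) ((Psi k G).obj M) :=
  have : Injective ((GSmooth.res k H).obj M) := hM
  have := isIso_psiRes hH M
  Projective.of_iso (asIso (psiRes hH M)).symm (projective_psi _)

lemma injectiveAfter_phi (hH : IsOpen (H : Set G)) (P : GContra k G) (hP : projectiveAfter (GContra.res k H) P) :
    injectiveAfter (GSmooth.res k H) ((Phi k G).obj P) :=
  have : Projective ((GContra.res k H).obj P) := hP
  have := isIso_phiRes hH P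
  Injective.of_iso (asIso (phiRes hH P)) (injective_phi _)

/-- Dually, a left adjoint is right exact and only injectivity is at stake; over H the sequence
splits because its last term is projective. -/
lemma shortExact_phi (hH : IsOpen (H : Set G)) (S : ShortComplex (GContra k G)) (hS : S.ShortExact)
    (h : projectiveAfter (GContra.res k H) S.X₃) : (S.map (Phi k G)).ShortExact := by
  have : Projective (S.map (GContra.res k H)).X₃ := h
  let σ := (GContra.shortExact_res H hS).splittingOfProjective
  have := hS.epi_g
  have := isIso_phiRes hH S.X₁
  have := isIso_phiRes hH S.X₂
  have : (Phi k G).IsLeftAdjoint := (phiPsiAdjunction k G).isLeftAdjoint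
  have hs : Function.Injective (GSmooth.lin ((GSmooth.res k H).map ((Phi k G).map S.f))) := by
    have h1 : IsSplitMono ((Phi k H).map ((GContra.res k H).map S.f)) :=
      have : IsSplitMono ((GContra.res k H).map S.f) := ⟨⟨σ.r, σ.f_r⟩⟩
      inferInstance
    have h2 : Mono (phiRes hH S.X₁ ≫ (GSmooth.res k H).map ((Phi k G).map S.f)) := by
      rw [phiRes_naturality]
      exact mono_comp _ _
    have h3 := mono_comp (inv (phiRes hH S.X₁))
      (phiRes hH S.X₁ ≫ (GSmooth.res k H).map ((Phi k G).map S.f))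
    rw [IsIso.inv_hom_id_assoc] at h3
    exact GSmooth.injective_of_mono _
  have : Mono (S.map (Phi k G)).f := GSmooth.mono_of_injective _ hs
  have : Epi (S.map (Phi k G)).g := inferInstanceAs (Epi ((Phi k G).map S.g))
  exact .mk' (hS.exact.map_of_epi_of_preservesCokernel (Phi k G) ‹_› inferInstance) ‹_› ‹_›

end Final

theorem mainTheorem1 (k G : Type u) [Field k] [Group G] [TopologicalSpace G]
    [IsTopologicalGroup G] [LocallyCompactSpace G] [TotallyDisconnectedSpace G]
    (hG : ∃ H : Subgroup G, IsOpen (H : Set G) ∧ IsCompact (H : Set G) ∧ FiniteCohDim k H)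
    [HasDerivedCategory.{w} (GSmooth k G)] [HasDerivedCategory.{w'} (GContra k G)]
    (s : DerivedSymbol) :
    ∃ (e : StarDerivedCat (GSmooth k G) s ≌ StarDerivedCat (GContra k G) s)
      (_ : e.functor.CommShift ℤ) (_ : e.inverse.CommShift ℤ),
      IsRightDerived (Psi k G) s e.functor ∧ IsLeftDerived (Phi k G) s e.inverse := by
  obtain ⟨H, hH, hc, n, hn⟩ := hG
  have : CompactSpace H := isCompact_iff_compactSpace.1 hc
  refine exists_derived_equivalence_of_adapted (phiPsiAdjunction k G)
    (injectiveAfter (GSmooth.res k H)) (projectiveAfter (GContra.res k H))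
    (fun M => ⟨_, GSmooth.toCoind LinearMap.id, GSmooth.mono_toCoind_id M,
      GSmooth.injective_res_coind hH⟩)
    (fun P => ⟨_, homContraCoindEval P, epi_homContraCoindEval P,
      projectiveAfter_homContra_coind hH P⟩)
    -- Dimensions are measured over H, so that dimension 0 means adapted and the bound n holds for
    -- all modules, and through Hom_k(-, P) for all contramodules.
    (fun d M => HasInjectiveDimensionLE ((GSmooth.res k H).obj M) d)
    (fun M h => injective_iff_hasInjectiveDimensionLT_one.2 h)
    (fun d S hS h1 h2 => ?_) ⟨n, fun M => hn _⟩
    (fun d P => HasProjectiveDimensionLE ((GContra.res k H).obj P) d)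
    (fun M h => projective_iff_hasProjectiveDimensionLT_one.2 h)
    (fun d S hS h3 h2 => ?_) ⟨n, fun P => hasProjectiveDimensionLE_of_forall _ n hn⟩
    (fun S hS h1 _ _ => shortExact_psi hH S hS h1)
    (fun S hS _ _ h3 => shortExact_phi hH S hS h3)
    (projectiveAfter_psi hH) (injectiveAfter_phi hH) (isIso_counit_of_injectiveAfter hH)
    (isIso_unit_of_projectiveAfter hH) s
  · have : Injective (S.map (GSmooth.res k H)).X₂ := h2
    exact (GSmooth.shortExact_res H hS).hasInjectiveDimensionLT_X₃ (d + 1) inferInstance h1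
  · have : Projective (S.map (GContra.res k H)).X₂ := h2
    exact (GContra.shortExact_res H hS).hasProjectiveDimensionLT_X₁ (d + 1) inferInstance h3
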